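/- **Setting.** Terms are $M,N ::= x \mid a \mid f(M_1,\dots,M_n)$ (variables, names, constructors $f$). A destructor $g$ is given by a finite set $\mathrm{def}(g)$ of rewrite rules $g(M_1,\dots,M_n)\to M$ over terms without names, with $\mathrm{vars}(M)\subseteq\bigcup_i\mathrm{vars}(M_i)$; $g(M'_1,\dots,M'_n)\to M'$ holds iff it is an instance of such a rule. Constructors and destructors are public or private. Some public constructors $f$ are *data constructors*: they come with public destructors $g_i$ defined by the single rule $g_i(f(x_1,\dots,x_n))\to x_i$. Processes, up to renaming of bound names and variables, are $$P,Q ::= \overline{M}\langle N\rangle.P \mid M(x).P \mid 0 \mid P|Q \mid\, !P \mid (\nu a)P \mid \mathsf{let}\ x=g(M_1,\dots,M_n)\ \mathsf{in}\ P\ \mathsf{else}\ Q \mid \mathsf{if}\ M=N\ \mathsf{then}\ P\ \mathsf{else}\ Q \mid \mathsf{event}(M).P .$$ A configuration $E,\mathcal P$ is a finite set of names and a finite multiset of closed processes. Reduction rewrites elements of $\mathcal P$: $0$ is removed; $!P$ becomes $P,!P$; $P|Q$ becomes $P,Q$; $(\nu a)P$ becomes $P\{a'/a\}$ for some $a'\notin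 E$, which is added to $E$; $\overline{M}\langle N\rangle.Q,\ M(x).P$ become $Q,\ P\{N/x\}$ (communication of $N$ on $M$); the $\mathsf{let}$ process becomes $P\{M'/x\}$ if $g(M_1,\dots,M_n)\to M'$, and $Q$ if there is no such $M'$; the conditional becomes $P$ if $M$ and $N$ are the same term and $Q$ otherwise; $\mathsf{event}(M).P$ becomes $P$. Let $\mathrm{Init}$ be a finite set of names. An *$\mathrm{Init}$-adversary* is a closed process $Q$ with $\mathrm{fn}(Q)\subseteq\mathrm{Init}$ that contains no event and uses only public constructors and destructors. A closed process $P_0$ *preserves the secrecy of all instances of $N$ from $\mathrm{Init}$* if, for every $\mathrm{Init}$-adversary $Q$, every finite set of names $E_0\supseteq \mathrm{fn}(P_0)\cup\mathrm{Init}\cup\mathrm{fn}(N)$ and every substitution $\sigma$, no trace $E_0,\{P_0,Q\}\to^* E',\mathcal P'$ contains a communication of $\sigma N$ on a channel $c\in\mathrm{Init}$. **Clauses.** Patterns are $p::=x\mid a[p_1,\dots,p_n,i_1,\dots,i_k]\mid f(p_1,\dots,p_n)$, where $a$ is a name function symbol and the $i_j$ are session identifiers (constants or variables of a separate sort). Facts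 are $\mathrm{attacker}(p)$, $\mathrm{message}(p,p')$, $\text{m-event}(p)$, $\mathrm{event}(p)$; a clause $H\Rightarrow C$ has a finite multiset $H$ of facts as hypothesis. The instrumented process $P_0'=\mathrm{instr}(P_0)$ is $P_0$ with each replication labelled by a distinct session identifier variable $i$, and each restriction $(\nu a)$ labelled by $a[t,s]$, where $a$ is a symbol proper to this restriction, $t$ lists the variables bound above it by inputs and by applications of non-deterministic destructors (those that can return different results on the same arguments), and $s$ lists the session identifiers above it. Its translation $[\![P_0']\!]\rho\,\emptyset$, with $\rho$ mapping each free name $a$ to $a[\,]$, is defined by: - $[\![0]\!]\rho H=\emptyset$, $[\![P|Q]\!]\rho H=[\![P]\!]\rho H\cup[\![Q]\!]\rho H$, $[\![!^iP]\!]\rho H=[\![P]\!](\rho[i\mapsto i])H$, $[\![(\nu a:\ell)P]\!]\rho H=[\![P]\!](\rho[a\mapsto\rho(\ell)])H$; - $[\![M(x).P]\!]\rho H=[\![P]\!](\rho[x\mapsto x])(H\wedge\mathrm{message}(\rho M,x))$, with $x$ fresh; - $[\![\overline M\langle N\rangle.P]\!]\rho H=[\![P]\!]\rho H\cup\{H\Rightarrow\mathrm{message}(\rho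 M,\rho N)\}$; - $[\![\mathsf{event}(M).P]\!]\rho H=[\![P]\!]\rho(H\wedge\text{m-event}(\rho M))\cup\{H\Rightarrow\mathrm{event}(\rho M)\}$; - $[\![\mathsf{let}\ x=g(M_1,\dots,M_n)\ \mathsf{in}\ P\ \mathsf{else}\ Q]\!]\rho H$ is the union of $[\![Q]\!]\rho H$ and of the $[\![P]\!]((\sigma\rho)[x\mapsto\sigma'p'])(\sigma H)$ over the rules $g(p'_1,\dots,p'_n)\to p'$ in $\mathrm{def}(g)$ for which there is a (then most general) pair $(\sigma,\sigma')$ with $\sigma\rho M_j=\sigma'p'_j$ for all $j$; - $[\![\mathsf{if}\ M=N\ \mathsf{then}\ P\ \mathsf{else}\ Q]\!]\rho H=[\![P]\!](\sigma\rho)(\sigma H)\cup[\![Q]\!]\rho H$, with $\sigma$ the most general unifier of $\rho M,\rho N$ (the first set is dropped if there is none). $\mathcal R_{P_0',\mathrm{Init}}$ consists of this translation and of the clauses: $\mathrm{attacker}(a[\,])$ for $a\in\mathrm{Init}$; $\mathrm{attacker}(b_0[x])$ for a special symbol $b_0$; $\bigwedge_j\mathrm{attacker}(x_j)\Rightarrow\mathrm{attacker}(f(x_1,\dots,x_n))$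 for public $f$; $\bigwedge_j\mathrm{attacker}(M_j)\Rightarrow\mathrm{attacker}(M)$ for each rule $g(M_1,\dots,M_n)\to M$ of a public $g$; $\mathrm{message}(x,y)\wedge\mathrm{attacker}(x)\Rightarrow\mathrm{attacker}(y)$; $\mathrm{attacker}(x)\wedge\mathrm{attacker}(y)\Rightarrow\mathrm{message}(x,y)$. **Algorithm.** $H_1\Rightarrow C_1$ *subsumes* $H_2\Rightarrow C_2$ if $\sigma C_1=C_2$ and $\sigma H_1\subseteq H_2$ (as multisets) for some $\sigma$; $\mathrm{elim}$ removes subsumed clauses from a set, keeping one among clauses equal up to renaming. For $R=H\Rightarrow C$ and $R'=H'\Rightarrow C'$ with variables renamed apart and $F_0\in H'$ unifiable with $C$, with most general unifier $\sigma$, let $R\circ_{F_0}R'=\sigma(H\cup(H'\setminus\{F_0\}))\Rightarrow\sigma C'$. Fix a selection function $\mathrm{sel}$ with $\mathrm{sel}(H\Rightarrow C)\subseteq H$ that never selects facts $\mathrm{attacker}(x)$ ($x$ a variable) or $\text{m-event}(p)$ (the unselectable facts) and is non-empty on $H\Rightarrow\mathrm{attacker}(x)$ whenever $H$ contains a selectable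 fact; and a set $\mathcal F_{\mathrm{not}}$ of facts. Let $$\mathrm{simplify}=\mathrm{elimattx}\circ\mathrm{elimtaut}\circ\mathrm{elimnot}\circ\mathrm{elimredundanthyp}\circ\mathrm{elimdup}\circ\mathrm{decomp},$$ $$\mathrm{simplify}'=\mathrm{elimattx}\circ\mathrm{elimnot}\circ\mathrm{elimredundanthyp}\circ\mathrm{elimdup}\circ\mathrm{decomphyp},$$ where: $\mathrm{decomp}$ recursively replaces $\mathrm{attacker}(f(p_1,\dots,p_n))$, $f$ a data constructor, by $\mathrm{attacker}(p_1)\wedge\dots\wedge\mathrm{attacker}(p_n)$ in hypotheses and, producing one clause for each resulting fact, in the conclusion ($\mathrm{decomphyp}$: in hypotheses only), leaving unchanged the clauses $\bigwedge_j\mathrm{attacker}(x_j)\Rightarrow\mathrm{attacker}(f(x_1,\dots,x_n))$ and $\mathrm{attacker}(f(x_1,\dots,x_n))\Rightarrow\mathrm{attacker}(x_i)$ for data constructors $f$; $\mathrm{elimdup}$ removes duplicate hypotheses; $\mathrm{elimredundanthyp}$ replaces, any number of times (possibly none, depending on settings), a clause $H\wedge H'\Rightarrow C$ by $H'\Rightarrow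 C$ when $\sigma H\subseteq H'$ for some $\sigma$ that does not change the variables of $H'$ and $C$; $\mathrm{elimnot}$ deletes clauses with an instance of a fact of $\mathcal F_{\mathrm{not}}$ in their hypotheses; $\mathrm{elimtaut}$ deletes clauses whose conclusion is one of their hypotheses; $\mathrm{elimattx}$ removes hypotheses $\mathrm{attacker}(x)$ such that $x$ occurs nowhere else in the clause. $\mathrm{saturate}(\mathcal R_0)$: start from $\mathcal R=\emptyset$; for each $R\in\mathcal R_0$ do $\mathcal R\leftarrow\mathrm{elim}(\mathrm{simplify}(R)\cup\mathcal R)$; then, until a fixpoint is reached, for $R,R'\in\mathcal R$ with $\mathrm{sel}(R)=\emptyset$ and $F_0\in\mathrm{sel}(R')$ such that $R\circ_{F_0}R'$ is defined, do $\mathcal R\leftarrow\mathrm{elim}(\mathrm{simplify}(R\circ_{F_0}R')\cup\mathcal R)$; return $\{R\in\mathcal R\mid\mathrm{sel}(R)=\emptyset\}$. $\mathrm{derivable}(F,\mathcal R_1)=\mathrm{deriv}(F\Rightarrow F,\emptyset,\mathcal R_1)$, where $\mathrm{deriv}(R,\mathcal R,\mathcal R_1)$ is $\emptyset$ if some clause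 of $\mathcal R$ subsumes $R$; otherwise $\{R\}$ if $\mathrm{sel}(R)=\emptyset$; otherwise the union of the $\mathrm{deriv}(R'',\{R\}\cup\mathcal R,\mathcal R_1)$ over $R'\in\mathcal R_1$, $F_0\in\mathrm{sel}(R)$ such that $R'\circ_{F_0}R$ is defined, and $R''\in\mathrm{simplify}'(R'\circ_{F_0}R)$. $\mathrm{solve}_{P_0',\mathrm{Init}}(F)$: let $\mathcal R_1=\mathrm{saturate}(\mathcal R_{P_0',\mathrm{Init}})$; terminate with error if $\mathrm{derivable}(F',\mathcal R_1)\ne\emptyset$ for some $F'\in\mathcal F_{\mathrm{not}}$; otherwise return $\mathrm{derivable}(F,\mathcal R_1)$. **Corollary (Secrecy).** Let $P_0$ be a closed process, $P_0'=\mathrm{instr}(P_0)$, $N$ a term, and $p$ the pattern obtained from $N$ by replacing each name $a$ with $a[\,]$. If $\mathrm{solve}_{P_0',\mathrm{Init}}(\mathrm{attacker}(p))$ terminates without error and returns $\emptyset$ (for some choice of the selection function, of $\mathcal F_{\mathrm{not}}$ and of the settings above), then $P_0$ preserves the secrecy of all instances of $N$ from $\mathrm{Init}$. -/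

import Mathlib

namespace SecProto

/-! ## Terms, rewrite rules and signatures -/

/-- The constructor symbols, with their arities. -/
structure ConSig where
  Con : Type
  arity : Con → ℕ

/-- Terms with variables in `V` and names in `A`. -/
inductive Term (S : ConSig) (V A : Type) : Type
  | var (x : V) : Term S V A
  | name (a : A) : Term S V A
  | app (f : S.Con) (ts : Fin (S.arity f) → Term S V A) : Term S V A

namespace Term

variable {S : ConSig} {V A V' A' : Type}

/-- The variables of a term. -/
def vars : Term S V A → Set V
  | var x => {x}
  | name _ => ∅
  | app _ ts => {x | ∃ i, x ∈ (ts i).vars}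

/-- The names of a term. -/
def names : Term S V A → Set A
  | var _ => ∅
  | name a => {a}
  | app _ ts => {a | ∃ i, a ∈ (ts i).names}

/-- Simultaneous substitution of terms for variables and renaming of names. -/
def subst (σ : V → Term S V' A') (ν : A → A') : Term S V A → Term S V' A'
  | var x => σ x
  | name a => name (ν a)
  | app f ts => app f (fun i => (ts i).subst σ ν)

end Term

/-- A rewrite rule `g(M₁, …, Mₙ) → M`: the terms contain no names, and the variables of `M`
occur in `M₁, …, Mₙ`. -/
structure Rule (S : ConSig) (n : ℕ) where
  args : Fin n → Term S ℕ Empty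
  res : Term S ℕ Empty
  vars_subset : ∀ x ∈ res.vars, ∃ i, x ∈ (args i).vars

/-- Constructors and destructors, public or private. Each destructor `g` is defined by the finite
set `rules g`. A data constructor `f` is public and comes with public destructors `gᵢ` defined by
the single rule `gᵢ(f(x₁, …, xₙ)) → xᵢ`. -/
structure Signature extends ConSig where
  conPublic : Con → Prop
  Des : Type
  desArity : Des → ℕ
  desPublic : Des → Prop
  rules : (g : Des) → Finset (Rule toConSig (desArity g))
  isData : Con → Prop
  data_public : ∀ f, isData f → conPublic f
  data_proj : ∀ f, isData f → ∀ i : Fin (arity f), ∃ g, desPublic g ∧ desArity g = 1 ∧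
    ∃ r, rules g = {r} ∧ ∃ x : Fin (arity f) → ℕ, Function.Injective x ∧
      (∀ j, r.args j = Term.app f (fun l => Term.var (x l))) ∧ r.res = Term.var (x i)

/-- `g(M₁, …, Mₙ) → M` for arbitrary terms: an instance of a rule of `g`. -/
def Reduces (S : Signature) {V A : Type} (g : S.Des)
    (Ms : Fin (S.desArity g) → Term S.toConSig V A) (M : Term S.toConSig V A) : Prop :=
  ∃ r ∈ S.rules g, ∃ σ : ℕ → Term S.toConSig V A,
    (∀ i, Ms i = (r.args i).subst σ Empty.elim) ∧ M = r.res.subst σ Empty.elim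

/-! ## Processes

Free names are natural numbers. Bound variables and bound names are well-scoped de Bruijn indices
(the innermost binder has index `0`), so that processes are identified up to renaming of bound
names and variables: `Proc S n m` has at most `n` free variables and `m` pending bound names, and
closed processes are the elements of `Proc S 0 0`. -/

/-- Terms in the scope of `n` variables and `m` bound names. -/
abbrev PTerm (S : Signature) (n m : ℕ) : Type := Term S.toConSig (Fin n) (ℕ ⊕ Fin m)

/-- Closed terms. -/
abbrev CTerm (S : Signature) : Type := PTerm S 0 0

/-- Processes. -/
inductive Proc (S : Signature) : ℕ → ℕ → Type
  | nil {n m : ℕ} : Proc S n m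
  | out {n m : ℕ} (M N : PTerm S n m) (P : Proc S n m) : Proc S n m
  | inp {n m : ℕ} (M : PTerm S n m) (P : Proc S (n + 1) m) : Proc S n m
  | par {n m : ℕ} (P Q : Proc S n m) : Proc S n m
  | repl {n m : ℕ} (P : Proc S n m) : Proc S n m
  | res {n m : ℕ} (P : Proc S n (m + 1)) : Proc S n m
  | letDes {n m : ℕ} (g : S.Des) (Ms : Fin (S.desArity g) → PTerm S n m)
      (P : Proc S (n + 1) m) (Q : Proc S n m) : Proc S n m
  | cond {n m : ℕ} (M N : PTerm S n m) (P Q : Proc S n m) : Proc S n m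
  | event {n m : ℕ} (M : PTerm S n m) (P : Proc S n m) : Proc S n m

/-- Extension of a substitution of names under a binder for names. -/
def liftName {m m' : ℕ} (ν : Fin m → ℕ ⊕ Fin m') : Fin (m + 1) → ℕ ⊕ Fin (m' + 1) :=
  Fin.cons (Sum.inr 0) (fun j => Sum.map id Fin.succ (ν j))

/-- The action on all names of a substitution of names for bound names. -/
def onNames {m m' : ℕ} (ν : Fin m → ℕ ⊕ Fin m') : ℕ ⊕ Fin m → ℕ ⊕ Fin m' :=
  Sum.elim Sum.inl ν

/-- Extension of a substitution of terms under a binder for variables. -/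
def liftVar {S : Signature} {n n' m' : ℕ} (σ : Fin n → PTerm S n' m') :
    Fin (n + 1) → PTerm S (n' + 1) m' :=
  Fin.cons (Term.var 0) (fun j => (σ j).subst (fun x => Term.var x.succ) id)

/-- Weakening of a substitution of terms under a binder for names. -/
def weakenName {S : Signature} {n n' m' : ℕ} (σ : Fin n → PTerm S n' m') :
    Fin n → PTerm S n' (m' + 1) :=
  fun j => (σ j).subst Term.var (Sum.map id Fin.succ)

namespace Proc

variable {S : Signature}

/-- Capture-avoiding simultaneous substitution. -/
def subst : {n m : ℕ} → Proc S n m → {n' m' : ℕ} →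
    (Fin n → PTerm S n' m') → (Fin m → ℕ ⊕ Fin m') → Proc S n' m'
  | _, _, nil, _, _, _, _ => nil
  | _, _, out M N P, _, _, σ, ν =>
      out (M.subst σ (onNames ν)) (N.subst σ (onNames ν)) (P.subst σ ν)
  | _, _, inp M P, _, _, σ, ν => inp (M.subst σ (onNames ν)) (P.subst (liftVar σ) ν)
  | _, _, par P Q, _, _, σ, ν => par (P.subst σ ν) (Q.subst σ ν)
  | _, _, repl P, _, _, σ, ν => repl (P.subst σ ν)
  | _, _, res P, _, _, σ, ν => res (P.subst (weakenName σ) (liftName ν))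
  | _, _, letDes g Ms P Q, _, _, σ, ν =>
      letDes g (fun i => (Ms i).subst σ (onNames ν)) (P.subst (liftVar σ) ν) (Q.subst σ ν)
  | _, _, cond M N P Q, _, _, σ, ν =>
      cond (M.subst σ (onNames ν)) (N.subst σ (onNames ν)) (P.subst σ ν) (Q.subst σ ν)
  | _, _, event M P, _, _, σ, ν => event (M.subst σ (onNames ν)) (P.subst σ ν)

/-- `P{M/x}` for the outermost variable `x` of `P`. -/
def instVar (P : Proc S 1 0) (M : CTerm S) : Proc S 0 0 := P.subst (fun _ => M) Sum.inr

/-- `P{a/b}` for the outermost bound name `b` of `P`. -/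
def instName (P : Proc S 0 1) (a : ℕ) : Proc S 0 0 := P.subst Term.var (fun _ => Sum.inl a)

/-- Free names. -/
def fn : {n m : ℕ} → Proc S n m → Set ℕ
  | _, _, nil => ∅
  | _, _, out M N P => {a | Sum.inl a ∈ M.names} ∪ {a | Sum.inl a ∈ N.names} ∪ P.fn
  | _, _, inp M P => {a | Sum.inl a ∈ M.names} ∪ P.fn
  | _, _, par P Q => P.fn ∪ Q.fn
  | _, _, repl P => P.fn
  | _, _, res P => P.fn
  | _, _, letDes _ Ms P Q => {a | ∃ i, Sum.inl a ∈ (Ms i).names} ∪ P.fn ∪ Q.fn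
  | _, _, cond M N P Q =>
      {a | Sum.inl a ∈ M.names} ∪ {a | Sum.inl a ∈ N.names} ∪ P.fn ∪ Q.fn
  | _, _, event M P => {a | Sum.inl a ∈ M.names} ∪ P.fn

/-- The process contains no event. -/
def EventFree : {n m : ℕ} → Proc S n m → Prop
  | _, _, nil => True
  | _, _, out _ _ P => P.EventFree
  | _, _, inp _ P => P.EventFree
  | _, _, par P Q => P.EventFree ∧ Q.EventFree
  | _, _, repl P => P.EventFree
  | _, _, res P => P.EventFree
  | _, _, letDes _ _ P Q => P.EventFree ∧ Q.EventFree
  | _, _, cond _ _ P Q => P.EventFree ∧ Q.EventFree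
  | _, _, event _ _ => False

end Proc

/-- The term contains only public constructors. -/
def Term.PublicOnly {S : Signature} {V A : Type} : Term S.toConSig V A → Prop
  | .var _ => True
  | .name _ => True
  | .app f ts => S.conPublic f ∧ ∀ i, (ts i).PublicOnly

/-- The process uses only public constructors and destructors. -/
def Proc.PublicOnly {S : Signature} : {n m : ℕ} → Proc S n m → Prop
  | _, _, .nil => True
  | _, _, .out M N P => M.PublicOnly ∧ N.PublicOnly ∧ P.PublicOnly
  | _, _, .inp M P => M.PublicOnly ∧ P.PublicOnly
  | _, _, .par P Q => P.PublicOnly ∧ Q.PublicOnly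
  | _, _, .repl P => P.PublicOnly
  | _, _, .res P => P.PublicOnly
  | _, _, .letDes g Ms P Q =>
      S.desPublic g ∧ (∀ i, (Ms i).PublicOnly) ∧ P.PublicOnly ∧ Q.PublicOnly
  | _, _, .cond M N P Q => M.PublicOnly ∧ N.PublicOnly ∧ P.PublicOnly ∧ Q.PublicOnly
  | _, _, .event M P => M.PublicOnly ∧ P.PublicOnly

/-- `Init`-adversaries. -/
structure IsAdversary {S : Signature} (Init : Finset ℕ) (Q : Proc S 0 0) : Prop where
  fn_subset : Q.fn ⊆ Init
  eventFree : Q.EventFree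
  publicOnly : Q.PublicOnly

/-! ## Operational semantics -/

/-- Semantic configurations: a finite set of names and a finite multiset of closed processes. -/
structure Config (S : Signature) where
  env : Finset ℕ
  procs : Multiset (Proc S 0 0)

/-- Communication of the message `M` on the channel `ch`. -/
def CommStep {S : Signature} (ch M : CTerm S) (c c' : Config S) : Prop :=
  ∃ (E : Finset ℕ) (Ps : Multiset (Proc S 0 0)) (Q : Proc S 0 0) (P : Proc S 1 0),
    c = ⟨E, Proc.out ch M Q ::ₘ Proc.inp ch P ::ₘ Ps⟩ ∧ c' = ⟨E, Q ::ₘ P.instVar M ::ₘ Ps⟩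

/-- Execution of `event(M)`. -/
def EventStep {S : Signature} (M : CTerm S) (c c' : Config S) : Prop :=
  ∃ (E : Finset ℕ) (Ps : Multiset (Proc S 0 0)) (P : Proc S 0 0),
    c = ⟨E, Proc.event M P ::ₘ Ps⟩ ∧ c' = ⟨E, P ::ₘ Ps⟩

/-- The reduction relation. -/
inductive Red {S : Signature} : Config S → Config S → Prop
  | nil (E : Finset ℕ) (Ps : Multiset (Proc S 0 0)) : Red ⟨E, Proc.nil ::ₘ Ps⟩ ⟨E, Ps⟩
  | repl (E : Finset ℕ) (Ps : Multiset (Proc S 0 0)) (P : Proc S 0 0) :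
      Red ⟨E, Proc.repl P ::ₘ Ps⟩ ⟨E, P ::ₘ Proc.repl P ::ₘ Ps⟩
  | par (E : Finset ℕ) (Ps : Multiset (Proc S 0 0)) (P Q : Proc S 0 0) :
      Red ⟨E, Proc.par P Q ::ₘ Ps⟩ ⟨E, P ::ₘ Q ::ₘ Ps⟩
  | res (E : Finset ℕ) (Ps : Multiset (Proc S 0 0)) (P : Proc S 0 1) (a : ℕ) (ha : a ∉ E) :
      Red ⟨E, Proc.res P ::ₘ Ps⟩ ⟨insert a E, P.instName a ::ₘ Ps⟩
  | comm (c c' : Config S) (ch M : CTerm S) (h : CommStep ch M c c') : Red c c'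
  | des1 (E : Finset ℕ) (Ps : Multiset (Proc S 0 0)) (g : S.Des)
      (Ms : Fin (S.desArity g) → CTerm S) (P : Proc S 1 0) (Q : Proc S 0 0) (M : CTerm S)
      (h : Reduces S g Ms M) : Red ⟨E, Proc.letDes g Ms P Q ::ₘ Ps⟩ ⟨E, P.instVar M ::ₘ Ps⟩
  | des2 (E : Finset ℕ) (Ps : Multiset (Proc S 0 0)) (g : S.Des)
      (Ms : Fin (S.desArity g) → CTerm S) (P : Proc S 1 0) (Q : Proc S 0 0)
      (h : ¬ ∃ M, Reduces S g Ms M) : Red ⟨E, Proc.letDes g Ms P Q ::ₘ Ps⟩ ⟨E, Q ::ₘ Ps⟩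
  | cond1 (E : Finset ℕ) (Ps : Multiset (Proc S 0 0)) (M : CTerm S) (P Q : Proc S 0 0) :
      Red ⟨E, Proc.cond M M P Q ::ₘ Ps⟩ ⟨E, P ::ₘ Ps⟩
  | cond2 (E : Finset ℕ) (Ps : Multiset (Proc S 0 0)) (M N : CTerm S) (P Q : Proc S 0 0)
      (h : M ≠ N) : Red ⟨E, Proc.cond M N P Q ::ₘ Ps⟩ ⟨E, Q ::ₘ Ps⟩
  | event (c c' : Config S) (M : CTerm S) (h : EventStep M c c') : Red c c'

/-- Traces: finite sequences of reductions starting from `c₀`. -/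
def IsTrace {S : Signature} (c₀ : Config S) (T : List (Config S)) : Prop :=
  T.head? = some c₀ ∧ T.IsChain Red

/-! ## Correspondences and secrecy -/

/-- Atoms over terms of type `X`. -/
inductive Atom (X : Type) : Type
  | attacker (M : X)
  | message (M M' : X)
  | event (M : X)

namespace Atom

def map {X Y : Type} (φ : X → Y) : Atom X → Atom Y
  | attacker M => attacker (φ M)
  | message M M' => message (φ M) (φ M')
  | event M => event (φ M)

def names {S : Signature} {V A : Type} : Atom (Term S.toConSig V A) → Set A
  | attacker M => M.names
  | message M M' => M.names ∪ M'.names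
  | event M => M.names

end Atom

/-- The trace `T` satisfies the atom. -/
def Satisfies {S : Signature} (Init : Finset ℕ) (T : List (Config S)) : Atom (CTerm S) → Prop
  | .attacker M => ∃ c c', [c, c'] <:+: T ∧
      ∃ a ∈ Init, CommStep (Term.name (Sum.inl a)) M c c'
  | .message M M' => ∃ c c', [c, c'] <:+: T ∧ CommStep M M' c c'
  | .event M => ∃ c c', [c, c'] <:+: T ∧ EventStep M c c'

/-- Terms of correspondences: variables and (free) names are natural numbers. -/
abbrev QTerm (S : Signature) : Type := Term S.toConSig ℕ ℕ

/-- The closed instance `σM`. -/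
def QTerm.inst {S : Signature} (σ : ℕ → CTerm S) (M : QTerm S) : CTerm S :=
  Term.subst σ Sum.inl M

/-- `P₀` satisfies the correspondence `α ⇒ ⋁ⱼ (αⱼ ⇝ ⋀ₖ event(Mⱼₖ))` against `Init`-adversaries;
`rhs` is the list of the pairs of `αⱼ` and the list of the `Mⱼₖ`. -/
def SatisfiesCorrespondence {S : Signature} (Init : Finset ℕ) (P₀ : Proc S 0 0)
    (α : Atom (QTerm S)) (rhs : List (Atom (QTerm S) × List (QTerm S))) : Prop :=
  ∀ Q : Proc S 0 0, IsAdversary Init Q →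
  ∀ E₀ : Finset ℕ, P₀.fn ⊆ E₀ → Init ⊆ E₀ → α.names ⊆ E₀ →
    (∀ d ∈ rhs, d.1.names ⊆ E₀ ∧ ∀ M ∈ d.2, M.names ⊆ E₀) →
  ∀ σ : ℕ → CTerm S, ∀ T : List (Config S), IsTrace ⟨E₀, {P₀, Q}⟩ T →
    Satisfies Init T (α.map (QTerm.inst σ)) →
    ∃ σ' : ℕ → CTerm S, ∃ d ∈ rhs, d.1.map (QTerm.inst σ') = α.map (QTerm.inst σ) ∧
      ∀ M ∈ d.2, Satisfies Init T (Atom.event (QTerm.inst σ' M))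

/-- `P₀` preserves the secrecy of all instances of `N` from `Init`: it satisfies the
correspondence `attacker(N) ⇝ false`. -/
def PreservesSecrecy {S : Signature} (Init : Finset ℕ) (P₀ : Proc S 0 0) (N : QTerm S) : Prop :=
  SatisfiesCorrespondence Init P₀ (Atom.attacker N) []

/-! ## Patterns, facts, clauses -/

/-- Name function symbols: one for each free name, one for each restriction of the process
(identified by its position in the syntax tree), and the special symbol `b₀`. -/
inductive NameSym : Type
  | free (a : ℕ)
  | bound (pos : List ℕ)
  | b0

/-- Session identifiers: constants and variables. -/
inductive Sess : Type
  | const (l : ℕ)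
  | var (i : ℕ)

/-- Patterns: ordinary variables, names `a[p₁, …, pₙ, i₁, …, iₖ]`, constructor applications. -/
inductive Pat (S : Signature) : Type
  | var (x : ℕ) : Pat S
  | name (a : NameSym) {n k : ℕ} (ps : Fin n → Pat S) (is : Fin k → Sess) : Pat S
  | app (f : S.Con) (ps : Fin (S.arity f) → Pat S) : Pat S

/-- Well-sorted substitutions. -/
structure Subst (S : Signature) where
  pat : ℕ → Pat S
  ses : ℕ → Sess

section

variable {S : Signature}

def Sess.subst (σ : Subst S) : Sess → Sess
  | .const l => .const l
  | .var i => σ.ses i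

def Pat.subst (σ : Subst S) : Pat S → Pat S
  | .var x => σ.pat x
  | .name a ps is => .name a (fun j => (ps j).subst σ) (fun j => (is j).subst σ)
  | .app f ps => .app f (fun j => (ps j).subst σ)

/-- Composition: first `σ`, then `θ`. -/
def Subst.comp (σ θ : Subst S) : Subst S where
  pat x := (σ.pat x).subst θ
  ses i := (σ.ses i).subst θ

/-- Variables: `Sum.inl` for ordinary variables, `Sum.inr` for session identifier variables. -/
def Sess.vars : Sess → Set (ℕ ⊕ ℕ)
  | .const _ => ∅
  | .var i => {Sum.inr i}

def Pat.vars : Pat S → Set (ℕ ⊕ ℕ)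
  | .var x => {Sum.inl x}
  | .name _ ps is => {v | (∃ j, v ∈ (ps j).vars) ∨ ∃ j, v ∈ (is j).vars}
  | .app _ ps => {v | ∃ j, v ∈ (ps j).vars}

/-- The two substitutions agree on the variables in `X`. -/
def Subst.AgreeOn (X : Set (ℕ ⊕ ℕ)) (σ τ : Subst S) : Prop :=
  (∀ x, Sum.inl x ∈ X → σ.pat x = τ.pat x) ∧ (∀ i, Sum.inr i ∈ X → σ.ses i = τ.ses i)

/-- `σ` is a most general substitution satisfying `U`, as far as the variables in `X` are
concerned. -/
def MostGeneral (X : Set (ℕ ⊕ ℕ)) (U : Subst S → Prop) (σ : Subst S) : Prop :=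
  U σ ∧ ∀ τ, U τ → ∃ θ, τ.AgreeOn X (σ.comp θ)

/-- `(σ, σ')` is a most general pair of substitutions satisfying `U`, as far as the variables
in `X` (for `σ`) and in `X'` (for `σ'`) are concerned. -/
def MostGeneralPair (X X' : Set (ℕ ⊕ ℕ)) (U : Subst S → Subst S → Prop) (σ σ' : Subst S) :
    Prop :=
  U σ σ' ∧ ∀ τ τ', U τ τ' → ∃ θ, τ.AgreeOn X (σ.comp θ) ∧ τ'.AgreeOn X' (σ'.comp θ)

variable (S) in
/-- Facts. -/
inductive Fact : Type
  | attacker (p : Pat S)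
  | message (p q : Pat S)
  | mevent (p : Pat S)
  | event (p : Pat S)

namespace Fact

def subst (σ : Subst S) : Fact S → Fact S
  | attacker p => attacker (p.subst σ)
  | message p q => message (p.subst σ) (q.subst σ)
  | mevent p => mevent (p.subst σ)
  | event p => event (p.subst σ)

def vars : Fact S → Set (ℕ ⊕ ℕ)
  | attacker p => p.vars
  | message p q => p.vars ∪ q.vars
  | mevent p => p.vars
  | event p => p.vars

end Fact

/-- The variables of a multiset of facts. -/
def hypVars (H : Multiset (Fact S)) : Set (ℕ ⊕ ℕ) := {v | ∃ F ∈ H, v ∈ F.vars}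

variable (S) in
/-- Horn clauses `hyps ⇒ concl`. -/
structure Clause where
  hyps : Multiset (Fact S)
  concl : Fact S

def Clause.vars (R : Clause S) : Set (ℕ ⊕ ℕ) := hypVars R.hyps ∪ R.concl.vars

end

/-- The pattern `a[]` of a free name. -/
def freeName {S : Signature} (a : ℕ) : Pat S :=
  Pat.name (NameSym.free a) (n := 0) (k := 0) Fin.elim0 Fin.elim0

/-- Extension to terms of a map from variables and names to patterns. -/
def Term.toPat {S : Signature} {V A : Type} (φ : V → Pat S) (ψ : A → Pat S) :
    Term S.toConSig V A → Pat S
  | .var x => φ x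
  | .name a => ψ a
  | .app f ts => Pat.app f (fun i => (ts i).toPat φ ψ)

/-- The pattern obtained from `N` by replacing each name `a` with `a[]`. -/
def QTerm.encode {S : Signature} (N : QTerm S) : Pat S := Term.toPat Pat.var freeName N

/-- The terms of rewrite rules are patterns, since they contain no names. -/
def ruleTerm {S : Signature} (M : Term S.toConSig ℕ Empty) : Pat S :=
  Term.toPat Pat.var Empty.elim M

/-! ## Instrumented processes -/

/-- Restriction labels `a[M₁, …, Mₙ, i₁, …, iₖ]`. -/
structure Label (S : Signature) (n m k : ℕ) where
  sym : NameSym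
  args : List (PTerm S n m)
  ids : List (Fin k)

/-- Instrumented processes: replications bind a session identifier variable (a de Bruijn index
below `k`), and restrictions carry a label. -/
inductive IProc (S : Signature) : ℕ → ℕ → ℕ → Type
  | nil {n m k : ℕ} : IProc S n m k
  | out {n m k : ℕ} (M N : PTerm S n m) (P : IProc S n m k) : IProc S n m k
  | inp {n m k : ℕ} (M : PTerm S n m) (P : IProc S (n + 1) m k) : IProc S n m k
  | par {n m k : ℕ} (P Q : IProc S n m k) : IProc S n m k
  | repl {n m k : ℕ} (P : IProc S n m (k + 1)) : IProc S n m k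
  | res {n m k : ℕ} (l : Label S n m k) (P : IProc S n (m + 1) k) : IProc S n m k
  | letDes {n m k : ℕ} (g : S.Des) (Ms : Fin (S.desArity g) → PTerm S n m)
      (P : IProc S (n + 1) m k) (Q : IProc S n m k) : IProc S n m k
  | cond {n m k : ℕ} (M N : PTerm S n m) (P Q : IProc S n m k) : IProc S n m k
  | event {n m k : ℕ} (M : PTerm S n m) (P : IProc S n m k) : IProc S n m k

/-- The destructor may return several different results for the same arguments. -/
def NonDeterministic (S : Signature) (g : S.Des) : Prop :=
  ∃ (Ms : Fin (S.desArity g) → CTerm S) (M M' : CTerm S),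
    Reduces S g Ms M ∧ Reduces S g Ms M' ∧ M ≠ M'

open Classical in
/-- Instrumentation of a subprocess at position `pos`, where `t` lists (from top to bottom) the
variables bound above it by inputs and by non-deterministic destructor applications, and `s` the
session identifiers of the replications above it. -/
noncomputable def instrAt {S : Signature} : {n m k : ℕ} → Proc S n m →
    (pos : List ℕ) → (t : List (Fin n)) → (s : List (Fin k)) → IProc S n m k
  | _, _, _, .nil, _, _, _ => .nil
  | _, _, _, .out M N P, pos, t, s => .out M N (instrAt P (pos ++ [0]) t s)
  | _, _, _, .inp M P, pos, t, s =>
      .inp M (instrAt P (pos ++ [0]) (t.map Fin.succ ++ [0]) s)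
  | _, _, _, .par P Q, pos, t, s =>
      .par (instrAt P (pos ++ [0]) t s) (instrAt Q (pos ++ [1]) t s)
  | _, _, _, .repl P, pos, t, s =>
      .repl (instrAt P (pos ++ [0]) t (s.map Fin.succ ++ [0]))
  | _, _, _, .res P, pos, t, s =>
      .res ⟨NameSym.bound pos, t.map Term.var, s⟩ (instrAt P (pos ++ [0]) t s)
  | _, _, _, .letDes g Ms P Q, pos, t, s =>
      .letDes g Ms
        (instrAt P (pos ++ [0])
          (if NonDeterministic S g then t.map Fin.succ ++ [0] else t.map Fin.succ) s)
        (instrAt Q (pos ++ [1]) t s)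
  | _, _, _, .cond M N P Q, pos, t, s =>
      .cond M N (instrAt P (pos ++ [0]) t s) (instrAt Q (pos ++ [1]) t s)
  | _, _, _, .event M P, pos, t, s => .event M (instrAt P (pos ++ [0]) t s)

/-- The instrumented process associated with a closed process. -/
noncomputable def instr {S : Signature} (P₀ : Proc S 0 0) : IProc S 0 0 0 :=
  instrAt P₀ [] [] []

/-! ## Generation of clauses -/

/-- Environments `ρ` of the translation. Free names are always mapped to `a[]`. -/
structure Env (S : Signature) (n m k : ℕ) where
  var : Fin n → Pat S
  name : Fin m → Pat S
  ses : Fin k → Sess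

namespace Env

variable {S : Signature} {n m k : ℕ}

def vars (ρ : Env S n m k) : Set (ℕ ⊕ ℕ) :=
  {v | (∃ j, v ∈ (ρ.var j).vars) ∨ (∃ j, v ∈ (ρ.name j).vars) ∨ ∃ j, v ∈ (ρ.ses j).vars}

/-- The extension of `ρ` to terms. -/
def term (ρ : Env S n m k) (M : PTerm S n m) : Pat S :=
  Term.toPat ρ.var (Sum.elim freeName ρ.name) M

/-- The extension of `ρ` to restriction labels. -/
def label (ρ : Env S n m k) (l : Label S n m k) : Pat S :=
  Pat.name l.sym (fun j : Fin l.args.length => ρ.term (l.args.get j))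
    (fun j : Fin l.ids.length => ρ.ses (l.ids.get j))

def subst (ρ : Env S n m k) (σ : Subst S) : Env S n m k where
  var j := (ρ.var j).subst σ
  name j := (ρ.name j).subst σ
  ses j := (ρ.ses j).subst σ

def pushVar (ρ : Env S n m k) (p : Pat S) : Env S (n + 1) m k :=
  { ρ with var := Fin.cons p ρ.var }

def pushName (ρ : Env S n m k) (p : Pat S) : Env S n (m + 1) k :=
  { ρ with name := Fin.cons p ρ.name }

def pushSes (ρ : Env S n m k) (i : Sess) : Env S n m (k + 1) :=
  { ρ with ses := Fin.cons i ρ.ses }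

/-- The environment of a closed process. -/
def empty : Env S 0 0 0 := ⟨Fin.elim0, Fin.elim0, Fin.elim0⟩

end Env

/-- `σρ(M₁) = σ'p₁, …, σρ(Mₙ) = σ'pₙ` for the left-hand side `g(p₁, …, pₙ)` of the rule. -/
def MatchesRule {S : Signature} {n m k : ℕ} {g : S.Des} (ρ : Env S n m k)
    (Ms : Fin (S.desArity g) → PTerm S n m) (r : Rule S.toConSig (S.desArity g))
    (σ σ' : Subst S) : Prop :=
  ∀ i, (ρ.term (Ms i)).subst σ = (ruleTerm (r.args i)).subst σ'

/-- `σρ(M) = σρ(N)`. -/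
def UnifiesTerms {S : Signature} {n m k : ℕ} (ρ : Env S n m k) (M N : PTerm S n m)
    (σ : Subst S) : Prop :=
  (ρ.term M).subst σ = (ρ.term N).subst σ

/-- `Translates P ρ H T`: the set `T` is the translation of `P` in the environment `ρ` with
hypotheses `H`. It is determined up to the choice of the fresh variables and of the most general
unifiers, which are unique up to renaming. -/
inductive Translates {S : Signature} : {n m k : ℕ} → IProc S n m k → Env S n m k →
    Multiset (Fact S) → Set (Clause S) → Prop
  | nil {n m k : ℕ} (ρ : Env S n m k) (H : Multiset (Fact S)) : Translates .nil ρ H ∅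
  | par {n m k : ℕ} (ρ : Env S n m k) (H : Multiset (Fact S)) (P Q : IProc S n m k)
      (T U : Set (Clause S)) (hP : Translates P ρ H T) (hQ : Translates Q ρ H U) :
      Translates (.par P Q) ρ H (T ∪ U)
  | repl {n m k : ℕ} (ρ : Env S n m k) (H : Multiset (Fact S)) (P : IProc S n m (k + 1))
      (T : Set (Clause S)) (i : ℕ) (hi : Sum.inr i ∉ ρ.vars ∪ hypVars H)
      (hP : Translates P (ρ.pushSes (.var i)) H T) : Translates (.repl P) ρ H T
  | res {n m k : ℕ} (ρ : Env S n m k) (H : Multiset (Fact S)) (l : Label S n m k)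
      (P : IProc S n (m + 1) k) (T : Set (Clause S))
      (hP : Translates P (ρ.pushName (ρ.label l)) H T) : Translates (.res l P) ρ H T
  | inp {n m k : ℕ} (ρ : Env S n m k) (H : Multiset (Fact S)) (M : PTerm S n m)
      (P : IProc S (n + 1) m k) (T : Set (Clause S)) (x : ℕ)
      (hx : Sum.inl x ∉ ρ.vars ∪ hypVars H)
      (hP : Translates P (ρ.pushVar (.var x)) (.message (ρ.term M) (.var x) ::ₘ H) T) :
      Translates (.inp M P) ρ H T
  | out {n m k : ℕ} (ρ : Env S n m k) (H : Multiset (Fact S)) (M N : PTerm S n m)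
      (P : IProc S n m k) (T : Set (Clause S)) (hP : Translates P ρ H T) :
      Translates (.out M N P) ρ H (T ∪ {⟨H, .message (ρ.term M) (ρ.term N)⟩})
  | letDes {n m k : ℕ} (ρ : Env S n m k) (H : Multiset (Fact S)) (g : S.Des)
      (Ms : Fin (S.desArity g) → PTerm S n m) (P : IProc S (n + 1) m k) (Q : IProc S n m k)
      (σ σ' : Rule S.toConSig (S.desArity g) → Subst S)
      (T : Rule S.toConSig (S.desArity g) → Set (Clause S)) (U : Set (Clause S))
      (hσ : ∀ r ∈ S.rules g, (∃ τ τ', MatchesRule ρ Ms r τ τ') →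
        MostGeneralPair (ρ.vars ∪ hypVars H) {v | ∃ i, v ∈ (ruleTerm (S := S) (r.args i)).vars}
          (MatchesRule ρ Ms r) (σ r) (σ' r))
      (hP : ∀ r ∈ S.rules g, (∃ τ τ', MatchesRule ρ Ms r τ τ') →
        Translates P ((ρ.subst (σ r)).pushVar ((ruleTerm r.res).subst (σ' r)))
          (H.map (Fact.subst (σ r))) (T r))
      (hQ : Translates Q ρ H U) :
      Translates (.letDes g Ms P Q) ρ H
        ({R | ∃ r ∈ S.rules g, (∃ τ τ', MatchesRule ρ Ms r τ τ') ∧ R ∈ T r} ∪ U)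
  | cond {n m k : ℕ} (ρ : Env S n m k) (H : Multiset (Fact S)) (M N : PTerm S n m)
      (P Q : IProc S n m k) (σ : Subst S) (T U : Set (Clause S))
      (hσ : (∃ τ, UnifiesTerms ρ M N τ) →
        MostGeneral (ρ.vars ∪ hypVars H) (UnifiesTerms ρ M N) σ)
      (hP : (∃ τ, UnifiesTerms ρ M N τ) →
        Translates P (ρ.subst σ) (H.map (Fact.subst σ)) T)
      (hQ : Translates Q ρ H U) :
      Translates (.cond M N P Q) ρ H ({R | (∃ τ, UnifiesTerms ρ M N τ) ∧ R ∈ T} ∪ U)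
  | event {n m k : ℕ} (ρ : Env S n m k) (H : Multiset (Fact S)) (M : PTerm S n m)
      (P : IProc S n m k) (T : Set (Clause S))
      (hP : Translates P ρ (.mevent (ρ.term M) ::ₘ H) T) :
      Translates (.event M P) ρ H (T ∪ {⟨H, .event (ρ.term M)⟩})

/-- `attacker(x₁) ∧ … ∧ attacker(xₙ) ⇒ attacker(f(x₁, …, xₙ))`. -/
def clauseRf {S : Signature} (f : S.Con) (x : Fin (S.arity f) → ℕ) : Clause S :=
  ⟨Finset.univ.val.map (fun j => .attacker (.var (x j))),
    .attacker (.app f (fun j => .var (x j)))⟩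

/-- `attacker(M₁) ∧ … ∧ attacker(Mₙ) ⇒ attacker(M)` for a rule `g(M₁, …, Mₙ) → M`. -/
def clauseRg {S : Signature} {n : ℕ} (r : Rule S.toConSig n) : Clause S :=
  ⟨Finset.univ.val.map (fun j => .attacker (ruleTerm (r.args j))), .attacker (ruleTerm r.res)⟩

/-- `attacker(f(x₁, …, xₙ)) ⇒ attacker(xᵢ)`. -/
def clauseProj {S : Signature} (f : S.Con) (x : Fin (S.arity f) → ℕ) (i : Fin (S.arity f)) :
    Clause S :=
  ⟨{.attacker (.app f (fun j => .var (x j)))}, .attacker (.var (x i))⟩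

/-- The clauses for the attacker. -/
def attackerClauses (S : Signature) (Init : Finset ℕ) : Set (Clause S) :=
  {R | ∃ a ∈ Init, R = ⟨0, .attacker (freeName a)⟩} ∪
  {⟨0, .attacker (.name .b0 (n := 1) (k := 0) (fun _ => .var 0) Fin.elim0)⟩} ∪
  {R | ∃ f, S.conPublic f ∧ R = clauseRf f (fun j => j.val)} ∪
  {R | ∃ g, S.desPublic g ∧ ∃ r ∈ S.rules g, R = clauseRg r} ∪
  {⟨{.message (.var 0) (.var 1), .attacker (.var 0)}, .attacker (.var 1)⟩,
    ⟨{.attacker (.var 0), .attacker (.var 1)}, .message (.var 0) (.var 1)⟩}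

/-- `R₀` is the set of clauses representing the instrumented process `P'` in parallel with any
`Init`-adversary. -/
def IsClauseSet {S : Signature} (P' : IProc S 0 0 0) (Init : Finset ℕ) (R₀ : Set (Clause S)) :
    Prop :=
  ∃ T, Translates P' Env.empty 0 T ∧ R₀ = T ∪ attackerClauses S Init

/-! ## Resolution and simplification of clauses -/

section

variable {S : Signature}

/-- `R₁` subsumes `R₂`. -/
def Clause.Subsumes (R₁ R₂ : Clause S) : Prop :=
  ∃ σ : Subst S, R₁.concl.subst σ = R₂.concl ∧ R₁.hyps.map (Fact.subst σ) ≤ R₂.hyps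

/-- `C` (of a first clause) and `F` (of a second clause, with variables renamed apart) are unified
by `σ` acting on the first clause and `σ'` acting on the second one. -/
def UnifiesFacts (C F : Fact S) (σ σ' : Subst S) : Prop := C.subst σ = F.subst σ'

/-- The resolvent of `R` and `R'` upon the hypothesis `F₀` of `R'` is defined. -/
def Resolvable (R : Clause S) (F₀ : Fact S) (R' : Clause S) : Prop :=
  F₀ ∈ R'.hyps ∧ ∃ τ τ', UnifiesFacts R.concl F₀ τ τ'

/-- `R''` is the resolvent of `R` and `R'` upon the hypothesis `F₀` of `R'` (which is unique up to
renaming). -/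
def IsResolvent (R : Clause S) (F₀ : Fact S) (R' R'' : Clause S) : Prop :=
  ∃ (H : Multiset (Fact S)) (σ σ' : Subst S), R'.hyps = F₀ ::ₘ H ∧
    MostGeneralPair R.vars R'.vars (UnifiesFacts R.concl F₀) σ σ' ∧
    R'' = ⟨R.hyps.map (Fact.subst σ) + H.map (Fact.subst σ'), R'.concl.subst σ'⟩

/-- Facts that must not be selected. -/
def Unselectable (F : Fact S) : Prop :=
  (∃ x, F = .attacker (.var x)) ∨ ∃ p, F = .mevent p

open Classical in
/-- The patterns `p₁, …, pₙ` such that the recursive decomposition of data constructors replaces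
`attacker(p)` with `attacker(p₁), …, attacker(pₙ)`. -/
noncomputable def Pat.decomp : Pat S → Multiset (Pat S)
  | .var x => {.var x}
  | .name a ps is => {.name a ps is}
  | .app f ps => if S.isData f then ∑ j, (ps j).decomp else {.app f ps}

noncomputable def Fact.decomp : Fact S → Multiset (Fact S)
  | .attacker p => p.decomp.map .attacker
  | .message p q => {.message p q}
  | .mevent p => {.mevent p}
  | .event p => {.event p}

/-- The clause is, up to renaming, one of the clauses for a data constructor and its associated
destructors; decomposition leaves it unchanged. -/
def IsDataClause (R : Clause S) : Prop :=
  ∃ f, S.isData f ∧ ∃ x : Fin (S.arity f) → ℕ, Function.Injective x ∧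
    (R = clauseRf f x ∨ ∃ i, R = clauseProj f x i)

open Classical in
/-- Decomposition of data constructors in the hypotheses and the conclusion. -/
noncomputable def decomp (R : Clause S) : Set (Clause S) :=
  if IsDataClause R then {R}
  else {R' | ∃ C ∈ R.concl.decomp, R' = ⟨R.hyps.bind Fact.decomp, C⟩}

open Classical in
/-- Decomposition of data constructors in the hypotheses only. -/
noncomputable def decomphyp (R : Clause S) : Clause S :=
  if IsDataClause R then R else ⟨R.hyps.bind Fact.decomp, R.concl⟩

open Classical in
/-- Elimination of duplicate hypotheses. -/
noncomputable def elimdup (R : Clause S) : Clause S := ⟨R.hyps.dedup, R.concl⟩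

open Classical in
/-- Elimination of the hypotheses `attacker(x)` such that `x` does not occur elsewhere. -/
noncomputable def elimattx (R : Clause S) : Clause S :=
  ⟨R.hyps.filter (fun F => ¬ ∃ x, F = .attacker (.var x) ∧ Sum.inl x ∉ R.concl.vars ∧
      Sum.inl x ∉ hypVars (R.hyps.erase F)),
    R.concl⟩

/-- Tautologies. -/
def IsTautology (R : Clause S) : Prop := R.concl ∈ R.hyps

/-- Some hypothesis of `R` is an instance of a fact in `Fnot`. -/
def HasNotHyp (Fnot : Set (Fact S)) (R : Clause S) : Prop :=
  ∃ F ∈ R.hyps, ∃ F' ∈ Fnot, ∃ σ : Subst S, F = F'.subst σ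

/-- Elimination of redundant hypotheses: `H ∧ H' ⇒ C` becomes `H' ⇒ C` when `σH ⊆ H'` for some
`σ` that does not change the variables of `H'` and `C`. -/
def RedundantStep (R R' : Clause S) : Prop :=
  R'.concl = R.concl ∧ ∃ H : Multiset (Fact S), R.hyps = H + R'.hyps ∧
    ∃ σ : Subst S, (∀ F ∈ H, F.subst σ ∈ R'.hyps) ∧ σ.AgreeOn R'.vars ⟨Pat.var, Sess.var⟩

variable (S) in
/-- The parameters of the solving algorithm: a selection function, the set `Fnot` of secrecy
assumptions, and the extent to which redundant hypotheses are eliminated (possibly not at all). -/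
structure Settings where
  sel : Clause S → Set (Fact S)
  sel_subset : ∀ R, ∀ F ∈ sel R, F ∈ R.hyps
  sel_selectable : ∀ R, ∀ F ∈ sel R, ¬ Unselectable F
  sel_attacker : ∀ R x, R.concl = .attacker (.var x) → (∃ F ∈ R.hyps, ¬ Unselectable F) →
    (sel R).Nonempty
  Fnot : Set (Fact S)
  elimredundanthyp : Clause S → Clause S
  elimredundanthyp_steps : ∀ R, Relation.ReflTransGen RedundantStep R (elimredundanthyp R)

namespace Settings

variable (cfg : Settings S)

/-- `elimattx ∘ elimtaut ∘ elimnot ∘ elimredundanthyp ∘ elimdup ∘ decomp`. -/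
def simplify (R : Clause S) : Set (Clause S) :=
  {R' | ∃ R₁ ∈ decomp R, ∃ R₂, R₂ = cfg.elimredundanthyp (elimdup R₁) ∧
    ¬ HasNotHyp cfg.Fnot R₂ ∧ ¬ IsTautology R₂ ∧ R' = elimattx R₂}

/-- `elimattx ∘ elimnot ∘ elimredundanthyp ∘ elimdup ∘ decomphyp`. -/
def simplify' (R : Clause S) : Set (Clause S) :=
  {R' | ∃ R₂, R₂ = cfg.elimredundanthyp (elimdup (decomphyp R)) ∧
    ¬ HasNotHyp cfg.Fnot R₂ ∧ R' = elimattx R₂}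

end Settings

/-- `Rs'` is obtained from `Rs` by removing subsumed clauses (among clauses that are equal up to
renaming, one is kept). -/
def IsElim (Rs Rs' : Set (Clause S)) : Prop :=
  Rs' ⊆ Rs ∧ (∀ R ∈ Rs, ∃ R' ∈ Rs', R'.Subsumes R) ∧
    ∀ R ∈ Rs', ∀ R' ∈ Rs', R'.Subsumes R → R' = R

/-! ## The solving algorithm

A terminating run of the algorithm is described by relations between inputs and outputs; the order
in which clauses are considered and the choice of variables in resolvents are left free. -/

namespace Settings

variable (cfg : Settings S)

/-- `Rs ← elim(simplify(R) ∪ Rs)`. -/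
def Insert (R : Clause S) (Rs Rs' : Set (Clause S)) : Prop :=
  IsElim (cfg.simplify R ∪ Rs) Rs'

/-- Successive insertion of the clauses of a list. -/
inductive InsertAll : List (Clause S) → Set (Clause S) → Set (Clause S) → Prop
  | nil (Rs : Set (Clause S)) : InsertAll [] Rs Rs
  | cons (R : Clause S) (L : List (Clause S)) (Rs Rs' Rs'' : Set (Clause S))
      (h : cfg.Insert R Rs Rs') (hL : InsertAll L Rs' Rs'') : InsertAll (R :: L) Rs Rs''

/-- One step of the fixpoint iteration. -/
def SaturateStep (Rs Rs' : Set (Clause S)) : Prop :=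
  ∃ R ∈ Rs, ∃ R' ∈ Rs, ∃ F₀ ∈ cfg.sel R', ∃ R'', cfg.sel R = ∅ ∧ IsResolvent R F₀ R' R'' ∧
    cfg.Insert R'' Rs Rs'

/-- The fixpoint is reached. -/
def IsSaturated (Rs : Set (Clause S)) : Prop :=
  ∀ R ∈ Rs, cfg.sel R = ∅ → ∀ R' ∈ Rs, ∀ F₀ ∈ cfg.sel R', Resolvable R F₀ R' →
    ∃ R'', IsResolvent R F₀ R' R'' ∧ cfg.Insert R'' Rs Rs

/-- First phase: `R₁ = saturate(R₀)`. -/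
def Saturate (R₀ R₁ : Set (Clause S)) : Prop :=
  ∃ (L : List (Clause S)) (Rs Rs' : Set (Clause S)), (∀ R, R ∈ L ↔ R ∈ R₀) ∧
    cfg.InsertAll L ∅ Rs ∧ Relation.ReflTransGen cfg.SaturateStep Rs Rs' ∧
    cfg.IsSaturated Rs' ∧ R₁ = {R ∈ Rs' | cfg.sel R = ∅}

/-- The clauses on which the search from `R` continues, where `res R' F₀` is the chosen resolvent
of `R'` and `R` upon `F₀`. -/
def next (R₁ : Set (Clause S)) (R : Clause S) (res : Clause S → Fact S → Clause S) :
    Set (Clause S) :=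
  {R₃ | ∃ R' ∈ R₁, ∃ F₀ ∈ cfg.sel R, Resolvable R' F₀ R ∧ R₃ ∈ cfg.simplify' (res R' F₀)}

/-- `Deriv R₁ R Rs D`: the backwards depth-first search from `R`, having already seen `Rs`,
terminates and returns `D`. -/
inductive Deriv (R₁ : Set (Clause S)) : Clause S → Set (Clause S) → Set (Clause S) → Prop
  | cycle (R : Clause S) (Rs : Set (Clause S)) (h : ∃ R' ∈ Rs, R'.Subsumes R) : Deriv R₁ R Rs ∅
  | done (R : Clause S) (Rs : Set (Clause S)) (h : ¬ ∃ R' ∈ Rs, R'.Subsumes R)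
      (hsel : cfg.sel R = ∅) : Deriv R₁ R Rs {R}
  | step (R : Clause S) (Rs : Set (Clause S)) (h : ¬ ∃ R' ∈ Rs, R'.Subsumes R)
      (hsel : cfg.sel R ≠ ∅) (res : Clause S → Fact S → Clause S)
      (hres : ∀ R' ∈ R₁, ∀ F₀ ∈ cfg.sel R, Resolvable R' F₀ R → IsResolvent R' F₀ R (res R' F₀))
      (D : Clause S → Set (Clause S))
      (hD : ∀ R₃ ∈ cfg.next R₁ R res, Deriv R₁ R₃ (insert R Rs) (D R₃)) :
      Deriv R₁ R Rs {R' | ∃ R₃ ∈ cfg.next R₁ R res, R' ∈ D R₃}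

/-- Second phase: `D = derivable(F, R₁)`. -/
def Derivable (F : Fact S) (R₁ D : Set (Clause S)) : Prop := cfg.Deriv R₁ ⟨{F}, F⟩ ∅ D

/-- The algorithm terminates without error on `P'`, `Init` and `F`, and returns `D`. -/
def Solve (P' : IProc S 0 0 0) (Init : Finset ℕ) (F : Fact S) (D : Set (Clause S)) : Prop :=
  ∃ R₀ R₁, IsClauseSet P' Init R₀ ∧ cfg.Saturate R₀ R₁ ∧
    (∀ F' ∈ cfg.Fnot, cfg.Derivable F' R₁ ∅) ∧ cfg.Derivable F R₁ D

end Settings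

end

end SecProto

/-! The argument is a contraposition through one set of facts: the set `D` of facts derivable from
the saturated clauses without selected hypotheses, where every m-event fact is granted. If an
adversary obtains an instance of `N`, then an instance of `attacker(p)` lies in `D`; if the
backwards search returns `∅`, no such instance lies in `D`.

Traces to facts (`exists_attacker_mem`). Along a trace each name receives a pattern: names of the
initial set keep `a[]`, a name created by a subprocess of `P₀` receives the instance of its label,
and a name created by the adversary receives a pattern known to the attacker. Every running process
is either a closed instance of a subprocess of `P₀` at which the translation hypotheses hold in `D`,
or an adversary process all of whose names and messages are known in `D`. Reduction preserves this
for any `D` closed under the initial clauses and containing the m-events, and every communication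
yields a message fact in `D`. Distinct names may share a pattern: else branches are translated
without any condition, so only equalities have to be transported.

Closure under the initial clauses (`Covered.derivable_of_fixpoint`). Take an instance, with
derivable hypotheses, of a clause at the fixpoint. If a hypothesis is selected, resolve it with the
last clause of a shortest derivation of that hypothesis: the resolvent is again covered by the
fixpoint, and one height in the multiset of heights of the hypotheses is replaced by smaller ones.
The Dershowitz-Manna order is well founded, so this ends at a clause without selection. Decomposing
data constructors must not spoil the measure, hence the key lemma `derivableIn_component`: if
`attacker(f(p₁, …, pₙ))` has a derivation of height at most `k`, so has each `attacker(pᵢ)`.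

The backwards search (`Settings.Derivable.not_derivableIn_succ`). An empty answer yields a set of
clauses, all with a selection, closed under resolution steps up to subsumption. A derivable instance
of such a clause would descend forever in the same multiset order, so none exists.

Deleting clauses with a hypothesis in `Fnot` is harmless only if no instance of such a fact is
derivable, which is itself read off from the search. The circle is broken by induction on the height
of derivations (`noneDerivable_of_derivable`): excluding a derivation of height `k + 1` needs the
assumption only at height `k`. -/

namespace SecProto

/-! ## Substitutions -/

section

variable {S : Signature}

lemma Sess.subst_subst (s : Sess) (σ θ : Subst S) :
    (s.subst σ).subst θ = s.subst (σ.comp θ) := by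
  cases s <;> rfl

lemma Pat.subst_subst (p : Pat S) (σ θ : Subst S) :
    (p.subst σ).subst θ = p.subst (σ.comp θ) := by
  induction p with
  | var x => rfl
  | name a ps is ih => simp only [Pat.subst, ih, Sess.subst_subst]
  | app f ps ih => simp only [Pat.subst, ih]

lemma Fact.subst_subst (F : Fact S) (σ θ : Subst S) :
    (F.subst σ).subst θ = F.subst (σ.comp θ) := by
  cases F <;> simp only [Fact.subst, Pat.subst_subst]

lemma Subst.AgreeOn.mono {X Y : Set (ℕ ⊕ ℕ)} {σ τ : Subst S} (h : σ.AgreeOn Y τ) (hXY : X ⊆ Y) :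
    σ.AgreeOn X τ :=
  ⟨fun x hx => h.1 x (hXY hx), fun i hi => h.2 i (hXY hi)⟩

lemma Sess.subst_congr {σ τ : Subst S} (s : Sess) (h : σ.AgreeOn s.vars τ) :
    s.subst σ = s.subst τ := by
  cases s with
  | const l => rfl
  | var i => exact h.2 i rfl

lemma Pat.subst_congr {σ τ : Subst S} (p : Pat S) (h : σ.AgreeOn p.vars τ) :
    p.subst σ = p.subst τ := by
  induction p with
  | var x => exact h.1 x rfl
  | name a ps is ih =>
    have h₁ : ∀ j, (ps j).subst σ = (ps j).subst τ :=
      fun j => ih j (h.mono fun v hv => Or.inl ⟨j, hv⟩)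
    have h₂ : ∀ j, (is j).subst σ = (is j).subst τ :=
      fun j => Sess.subst_congr _ (h.mono fun v hv => Or.inr ⟨j, hv⟩)
    simp only [Pat.subst, h₁, h₂]
  | app f ps ih =>
    have h₁ : ∀ j, (ps j).subst σ = (ps j).subst τ := fun j => ih j (h.mono fun v hv => ⟨j, hv⟩)
    simp only [Pat.subst, h₁]

lemma Fact.subst_congr {σ τ : Subst S} (F : Fact S) (h : σ.AgreeOn F.vars τ) :
    F.subst σ = F.subst τ := by
  cases F with
  | attacker p => simp only [Fact.subst, p.subst_congr h]
  | message p q =>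
    simp only [Fact.subst, p.subst_congr (h.mono Set.subset_union_left),
      q.subst_congr (h.mono Set.subset_union_right)]
  | mevent p => simp only [Fact.subst, p.subst_congr h]
  | event p => simp only [Fact.subst, p.subst_congr h]

lemma map_subst_congr {σ τ : Subst S} (H : Multiset (Fact S)) (h : σ.AgreeOn (hypVars H) τ) :
    H.map (Fact.subst σ) = H.map (Fact.subst τ) :=
  Multiset.map_congr rfl fun F hF => F.subst_congr (h.mono fun _ hv => ⟨F, hF, hv⟩)

lemma map_subst_subst (H : Multiset (Fact S)) (σ θ : Subst S) :
    (H.map (Fact.subst σ)).map (Fact.subst θ) = H.map (Fact.subst (σ.comp θ)) := by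
  simp only [Multiset.map_map, Function.comp_def, Fact.subst_subst]

/-- The identity substitution. -/
def Subst.id : Subst S := ⟨Pat.var, Sess.var⟩

lemma Sess.subst_id (s : Sess) : s.subst (Subst.id : Subst S) = s := by
  cases s <;> rfl

lemma Pat.subst_id (p : Pat S) : p.subst Subst.id = p := by
  induction p with
  | var x => rfl
  | name a ps is ih => simp only [Pat.subst, ih, Sess.subst_id]
  | app f ps ih => simp only [Pat.subst, ih]

lemma Fact.subst_id (F : Fact S) : F.subst Subst.id = F := by
  cases F <;> simp only [Fact.subst, Pat.subst_id]

lemma Clause.Subsumes.refl (R : Clause S) : R.Subsumes R := by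
  refine ⟨Subst.id, R.concl.subst_id, le_of_eq ?_⟩
  simp only [Fact.subst_id, Multiset.map_id']

lemma Clause.Subsumes.trans {R₁ R₂ R₃ : Clause S} (h₁ : R₁.Subsumes R₂) (h₂ : R₂.Subsumes R₃) :
    R₁.Subsumes R₃ := by
  obtain ⟨σ, hc, hh⟩ := h₁
  obtain ⟨τ, hc', hh'⟩ := h₂
  refine ⟨σ.comp τ, ?_, ?_⟩
  · rw [← Fact.subst_subst, hc, hc']
  · rw [← map_subst_subst]
    exact (Multiset.map_le_map hh).trans hh'

lemma Pat.eq_var_of_subst {p : Pat S} {θ : Subst S} {z : ℕ} (h : p.subst θ = .var z) :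
    ∃ y, p = .var y := by
  cases p with
  | var y => exact ⟨y, rfl⟩
  | name a ps is => cases h
  | app f ps => cases h

/-- A pattern with a variable as an instance is itself a variable. Hence a clause subsuming one
whose hypotheses are all unselectable has nothing to select either, and belongs to the output of the
saturation. -/
lemma Unselectable.of_subst {F : Fact S} {σ : Subst S} (h : Unselectable (F.subst σ)) :
    Unselectable F := by
  cases F with
  | attacker p =>
    rcases h with ⟨x, hx⟩ | ⟨p, hp⟩
    · obtain ⟨y, rfl⟩ := Pat.eq_var_of_subst (Fact.attacker.inj hx)
      exact Or.inl ⟨y, rfl⟩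
    · cases hp
  | message p q => rcases h with ⟨x, hx⟩ | ⟨p, hp⟩ <;> contradiction
  | mevent p => exact Or.inr ⟨p, rfl⟩
  | event p => rcases h with ⟨x, hx⟩ | ⟨p, hp⟩ <;> contradiction

/-! ## Decomposition of data constructors -/

/-- Facts `attacker(f(p₁, …, pₙ))` where `f` is a data constructor. -/
def DataHeaded (F : Fact S) : Prop := ∃ f ps, S.isData f ∧ F = .attacker (.app f ps)

lemma DataHeaded.subst {F : Fact S} (h : DataHeaded F) (σ : Subst S) : DataHeaded (F.subst σ) := by
  obtain ⟨f, ps, hf, rfl⟩ := h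
  exact ⟨f, _, hf, rfl⟩

lemma DataHeaded.of_subst {F : Fact S} {σ : Subst S} (h : DataHeaded (F.subst σ))
    (hF : ¬ Unselectable F) : DataHeaded F := by
  obtain ⟨f, ps, hf, h⟩ := h
  cases F with
  | attacker p =>
    cases p with
    | var x => exact absurd (Or.inl ⟨x, rfl⟩) hF
    | name a ps is => cases h
    | app g qs =>
      obtain rfl : g = f := by injection h with h; injection h
      exact ⟨g, qs, hf, rfl⟩
  | _ => cases h

lemma not_dataHeaded_of_unselectable {F : Fact S} (h : Unselectable F) : ¬ DataHeaded F := by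
  rintro ⟨f, ps, -, rfl⟩
  rcases h with ⟨x, hx⟩ | ⟨p, hp⟩
  · injection hx with hx
    cases hx
  · cases hp

lemma Pat.mem_decomp_app {f : S.Con} {ps : Fin (S.arity f) → Pat S} (hf : S.isData f)
    {q : Pat S} : q ∈ (Pat.app f ps).decomp ↔ ∃ j, q ∈ (ps j).decomp := by
  simp [Pat.decomp, hf, Multiset.mem_sum]

lemma Pat.not_dataHeaded_of_mem_decomp {p q : Pat S} (h : q ∈ p.decomp) :
    ¬ DataHeaded (Fact.attacker q) := by
  induction p with
  | var x =>
    rw [Pat.decomp, Multiset.mem_singleton] at h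
    subst h; rintro ⟨f, ps, -, h⟩; cases h
  | name a ps is ih =>
    rw [Pat.decomp, Multiset.mem_singleton] at h
    subst h; rintro ⟨f, ps, -, h⟩; cases h
  | app f ps ih =>
    by_cases hf : S.isData f
    · obtain ⟨j, hj⟩ := (Pat.mem_decomp_app hf).1 h
      exact ih j hj
    · rw [Pat.decomp, if_neg hf, Multiset.mem_singleton] at h
      subst h
      rintro ⟨g, qs, hg, h⟩
      injection h with h; injection h with h; subst h
      exact hf hg

lemma Fact.not_dataHeaded_of_mem_decomp {F G : Fact S} (h : G ∈ F.decomp) : ¬ DataHeaded G := by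
  cases F with
  | attacker p =>
    obtain ⟨q, hq, rfl⟩ := Multiset.mem_map.1 h
    exact Pat.not_dataHeaded_of_mem_decomp hq
  | _ =>
    rw [Fact.decomp, Multiset.mem_singleton] at h
    subst h; rintro ⟨f, ps, -, h⟩; cases h

lemma Fact.decomp_of_not_dataHeaded {F : Fact S} (h : ¬ DataHeaded F) : F.decomp = {F} := by
  cases F with
  | attacker p =>
    cases p with
    | app f ps =>
      have hf : ¬ S.isData f := fun hf => h ⟨f, ps, hf, rfl⟩
      simp [Fact.decomp, Pat.decomp, hf]
    | _ => rfl
  | _ => rfl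

/-- The second decomposition on the right is needed because `σ` may put data constructors in place
of variables. -/
lemma Pat.decomp_subst (p : Pat S) (σ : Subst S) :
    (p.subst σ).decomp = p.decomp.bind fun q => (q.subst σ).decomp := by
  induction p with
  | app f ps ih =>
    by_cases hf : S.isData f
    · simp only [Pat.subst, Pat.decomp, if_pos hf, ih]
      -- Binding is packaged as an additive map so that it commutes with the sum over the arguments.
      let φ : Multiset (Pat S) →+ Multiset (Pat S) :=
        ⟨⟨fun s => s.bind fun q => (q.subst σ).decomp, Multiset.zero_bind _⟩,
          fun a b => Multiset.add_bind a b _⟩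
      exact (map_sum φ _ _).symm
    · simp [Pat.subst, Pat.decomp, hf]
  | _ => simp [Pat.decomp]

lemma Fact.decomp_subst (F : Fact S) (σ : Subst S) :
    (F.subst σ).decomp = F.decomp.bind fun G => (G.subst σ).decomp := by
  cases F with
  | attacker p =>
    simp only [Fact.subst, Fact.decomp, Pat.decomp_subst p, Multiset.map_bind, Multiset.bind_map]
  | _ => simp [Fact.decomp, Fact.subst]

open Classical in
/-- The hypotheses of a clause after decomposition. -/
noncomputable def decompHyps (R : Clause S) : Multiset (Fact S) :=
  if IsDataClause R then R.hyps else R.hyps.bind Fact.decomp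

open Classical in
/-- The conclusions of a clause after decomposition. -/
noncomputable def decompConcls (R : Clause S) : Multiset (Fact S) :=
  if IsDataClause R then {R.concl} else R.concl.decomp

lemma mem_decomp_iff {R R' : Clause S} :
    R' ∈ SecProto.decomp R ↔ ∃ C ∈ decompConcls R, R' = ⟨decompHyps R, C⟩ := by
  unfold SecProto.decomp decompConcls decompHyps
  split_ifs <;> simp

lemma decomphyp_eq (R : Clause S) : decomphyp R = ⟨decompHyps R, R.concl⟩ := by
  unfold decomphyp decompHyps
  split_ifs <;> rfl

/-- Full decomposition of an instance does not see whether the clause was decomposed beforehand.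
This makes a measure computed on fully decomposed hypotheses insensitive to this stage of the
simplification. -/
lemma bind_decomp_decompHyps (R : Clause S) (θ : Subst S) :
    ((decompHyps R).map (Fact.subst θ)).bind Fact.decomp =
      (R.hyps.map (Fact.subst θ)).bind Fact.decomp := by
  unfold decompHyps
  split_ifs
  · rfl
  · simp only [Multiset.bind_map, Multiset.bind_assoc]
    exact Multiset.bind_congr fun F _ => (F.decomp_subst θ).symm

/-! ## Simplification -/

lemma redundantStep_le {R R' : Clause S} (h : Relation.ReflTransGen RedundantStep R R') :
    R'.concl = R.concl ∧ R'.hyps ≤ R.hyps := by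
  induction h with
  | refl => exact ⟨rfl, le_rfl⟩
  | tail _ h ih =>
    obtain ⟨hc, H, hH, -⟩ := h
    refine ⟨hc.trans ih.1, le_trans ?_ ih.2⟩
    rw [hH]
    exact Multiset.le_add_left _ _

lemma elimredundanthyp_elimdup_le (cfg : Settings S) (R : Clause S) :
    (cfg.elimredundanthyp (elimdup R)).concl = R.concl ∧
      (cfg.elimredundanthyp (elimdup R)).hyps ≤ R.hyps ∧
      (cfg.elimredundanthyp (elimdup R)).hyps.Nodup := by
  classical
  obtain ⟨hc, hh⟩ := redundantStep_le (cfg.elimredundanthyp_steps (elimdup R))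
  refine ⟨hc, hh.trans ?_, Multiset.nodup_of_le hh ?_⟩
  · exact Multiset.dedup_le _
  · exact Multiset.nodup_dedup _

lemma elimattx_le (R : Clause S) :
    (elimattx R).concl = R.concl ∧ (elimattx R).hyps ≤ R.hyps :=
  by
  classical
  exact ⟨rfl, Multiset.filter_le _ _⟩

lemma HasNotHyp.mono {Fnot : Set (Fact S)} {R R' : Clause S} (h : HasNotHyp Fnot R)
    (hR : R.hyps ≤ R'.hyps) : HasNotHyp Fnot R' := by
  obtain ⟨F, hF, h⟩ := h
  exact ⟨F, Multiset.mem_of_le hR hF, h⟩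

/-- Every clause obtained by simplifying `R` is subsumed by a clause of `Rs`. -/
def Covered (cfg : Settings S) (Rs : Set (Clause S)) (R : Clause S) : Prop :=
  ∀ R₁ ∈ cfg.simplify R, ∃ R₂ ∈ Rs, R₂.Subsumes R₁

/-- After decomposition, simplification only drops hypotheses or deletes the clause, and deletion
has two causes: a hypothesis in `Fnot` or a tautology. Since having fewer hypotheses only
strengthens a clause, the effects of `elimdup`, `elimredundanthyp` and `elimattx` can be forgotten
from here on. -/
lemma Covered.cases {cfg : Settings S} {Rs : Set (Clause S)} {R : Clause S}
    (h : Covered cfg Rs R) {C : Fact S} (hC : C ∈ decompConcls R) :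
    HasNotHyp cfg.Fnot ⟨decompHyps R, C⟩ ∨ C ∈ decompHyps R ∨
      ∃ R' ∈ Rs, ∃ s : Subst S, R'.concl.subst s = C ∧
        R'.hyps.map (Fact.subst s) ≤ decompHyps R := by
  obtain ⟨hc, hh, -⟩ := elimredundanthyp_elimdup_le cfg ⟨decompHyps R, C⟩
  by_cases h₁ : HasNotHyp cfg.Fnot (cfg.elimredundanthyp (elimdup ⟨decompHyps R, C⟩))
  · exact Or.inl (h₁.mono hh)
  by_cases h₂ : IsTautology (cfg.elimredundanthyp (elimdup ⟨decompHyps R, C⟩))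
  · refine Or.inr (Or.inl ?_)
    rw [IsTautology, hc] at h₂
    exact Multiset.mem_of_le hh h₂
  obtain ⟨R', hR', s, hs, hs'⟩ := h _ ⟨_, mem_decomp_iff.2 ⟨C, hC, rfl⟩, _, rfl, h₁, h₂, rfl⟩
  exact Or.inr (Or.inr ⟨R', hR', s, hs.trans hc, (hs'.trans (elimattx_le _).2).trans hh⟩)

lemma not_isTautology_of_mem_simplify {cfg : Settings S} {R R' : Clause S}
    (h : R' ∈ cfg.simplify R) : ¬ IsTautology R' := by
  obtain ⟨R₁, -, R₂, rfl, -, h, rfl⟩ := h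
  exact fun h' => h (Multiset.mem_of_le (elimattx_le _).2 h')

/-- If `z` were absent from the conclusion, the surviving hypothesis would owe its survival to
another hypothesis containing `z`. That one cannot have been removed: a removed hypothesis is
`attacker(w)`, and containing `z` would make it a duplicate. -/
lemma mem_vars_of_elimattx_hyps_eq {R : Clause S} (hR : R.hyps.Nodup) {z : ℕ}
    (h : (elimattx R).hyps = {.attacker (.var z)}) : Sum.inl z ∈ R.concl.vars := by
  classical
  by_contra hz
  have hmem : Fact.attacker (.var z) ∈ (elimattx R).hyps := by rw [h]; simp
  have h₁ := (Multiset.mem_filter.1 hmem).2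
  simp only [not_exists, not_and, not_not] at h₁
  obtain ⟨G, hG, hzG⟩ := h₁ z rfl hz
  have hne : G ≠ .attacker (.var z) := by
    rintro rfl
    exact (hR.mem_erase_iff.1 (by convert hG)).1 rfl
  have hGR : G ∈ R.hyps := Multiset.mem_of_mem_erase hG
  have hGn : G ∉ (elimattx R).hyps := by rw [h]; simpa using hne
  refine hGn (Multiset.mem_filter.2 ⟨hGR, ?_⟩)
  rintro ⟨w, rfl, -, hw⟩
  obtain rfl : z = w := by simpa [Fact.vars, Pat.vars] using hzG
  exact hne rfl

lemma mem_vars_of_mem_simplify {cfg : Settings S} {R R' : Clause S}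
    (h : R' ∈ cfg.simplify R) {z : ℕ} (hz : R'.hyps = {.attacker (.var z)}) :
    Sum.inl z ∈ R'.concl.vars := by
  obtain ⟨R₁, -, R₂, rfl, -, -, rfl⟩ := h
  exact mem_vars_of_elimattx_hyps_eq (elimredundanthyp_elimdup_le cfg R₁).2.2 hz

lemma clauseRf_hyps {f : S.Con} {x : Fin (S.arity f) → ℕ} {F : Fact S} :
    F ∈ (clauseRf f x).hyps ↔ ∃ j, F = .attacker (.var (x j)) := by
  simp [clauseRf, eq_comm]

/-- The conclusion of a simplified clause is `attacker(f(p₁, …, pₙ))` for a data constructor `f`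
only if it comes from the clause for `f`. -/
lemma eq_clauseRf_of_dataHeaded_concl {cfg : Settings S} {R R' : Clause S}
    (h : R' ∈ cfg.simplify R) (hd : DataHeaded R'.concl) :
    ∃ f x, S.isData f ∧ Function.Injective x ∧ R' = clauseRf (S := S) f x := by
  classical
  obtain ⟨R₁, hR₁, R₂, rfl, -, -, rfl⟩ := h
  obtain ⟨C, hC, rfl⟩ := mem_decomp_iff.1 hR₁
  have hconcl : (elimattx (cfg.elimredundanthyp (elimdup ⟨decompHyps R, C⟩))).concl = C :=
    (elimredundanthyp_elimdup_le cfg ⟨decompHyps R, C⟩).1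
  rw [hconcl] at hd
  by_cases hR : IsDataClause R
  · have hdh : decompHyps R = R.hyps := if_pos hR
    rw [decompConcls, if_pos hR, Multiset.mem_singleton] at hC
    subst hC
    obtain ⟨f, hf, x, hx, rfl | ⟨i, rfl⟩⟩ := hR
    · refine ⟨f, x, hf, hx, ?_⟩
      rw [hdh]
      have hnd : (clauseRf f x).hyps.Nodup :=
        Finset.univ.nodup.map fun i j hij => hx (by simpa using hij)
      have hvar : ∀ j, Sum.inl (x j) ∈ (clauseRf f x).concl.vars := fun j => ⟨j, rfl⟩
      have h₁ : elimdup ⟨(clauseRf f x).hyps, (clauseRf f x).concl⟩ = clauseRf f x := by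
        unfold elimdup
        congr 1
        exact Multiset.dedup_eq_self.2 hnd
      rw [h₁]
      have h₂ : ∀ R', Relation.ReflTransGen RedundantStep (clauseRf f x) R' →
          R' = clauseRf f x := by
        intro R' h'
        induction h' with
        | refl => rfl
        | @tail R₀ R' _ h' ih =>
          subst ih
          obtain ⟨hc, H, hH, σ, hσ, hσ'⟩ := h'
          -- All variables of the hypotheses occur in the conclusion, so the substitution justifying
          -- a redundancy step fixes them. A removed hypothesis would then have a second copy among
          -- those that remain.
          have hzero : H = 0 := by
            by_contra hne
            obtain ⟨F, hF⟩ := Multiset.exists_mem_of_ne_zero hne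
            obtain ⟨j, rfl⟩ := clauseRf_hyps.1 (hH ▸ Multiset.mem_add.2 (Or.inl hF))
            have h₃ := hσ _ hF
            have h₄ : σ.pat (x j) = .var (x j) := hσ'.1 (x j) (Or.inr (by rw [hc]; exact hvar j))
            simp only [Fact.subst, Pat.subst, h₄] at h₃
            rw [hH] at hnd
            exact Multiset.disjoint_left.1 (Multiset.nodup_add.1 hnd).2.2 hF h₃
          rw [hzero, zero_add] at hH
          cases R'; simp only at hc hH; subst hc; rw [← hH]
      rw [h₂ _ (cfg.elimredundanthyp_steps _)]
      unfold elimattx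
      have h₅ : ∀ F ∈ (clauseRf f x).hyps, ¬ ∃ y, F = .attacker (.var y) ∧
          Sum.inl y ∉ (clauseRf f x).concl.vars ∧
          Sum.inl y ∉ hypVars ((clauseRf f x).hyps.erase F) := by
        intro F hF
        obtain ⟨j, rfl⟩ := clauseRf_hyps.1 hF
        rintro ⟨y, hy, hy', -⟩
        obtain rfl : x j = y := by simpa using hy
        exact hy' (hvar j)
      rw [Multiset.filter_eq_self.2 (fun F hF => by convert h₅ F hF)]
    · obtain ⟨g, ps, -, hg⟩ := hd
      cases hg
  · rw [decompConcls, if_neg hR] at hC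
    exact absurd hd (Fact.not_dataHeaded_of_mem_decomp hC)

/-- A simplified clause has a hypothesis `attacker(f(p₁, …, pₙ))` for a data constructor `f` only
if it comes from a clause for a projection of `f`. -/
lemma isDataClause_of_dataHeaded_mem_decompHyps {R : Clause S} {F : Fact S}
    (hF : F ∈ decompHyps R) (hd : DataHeaded F) :
    ∃ f x i, S.isData f ∧ Function.Injective x ∧ R = clauseProj (S := S) f x i := by
  by_cases hR : IsDataClause R
  · rw [decompHyps, if_pos hR] at hF
    obtain ⟨f, hf, x, hx, rfl | ⟨i, rfl⟩⟩ := hR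
    · obtain ⟨j, rfl⟩ := clauseRf_hyps.1 hF
      exact absurd hd (not_dataHeaded_of_unselectable (Or.inl ⟨_, rfl⟩))
    · exact ⟨f, x, i, hf, hx, rfl⟩
  · rw [decompHyps, if_neg hR] at hF
    obtain ⟨G, -, hG⟩ := Multiset.mem_bind.1 hF
    exact absurd hd (Fact.not_dataHeaded_of_mem_decomp hG)

/-- Decomposition leaves a data constructor at the head of a hypothesis only in a projection clause.
Such a clause has a single hypothesis, so as long as this one survives the clause is intact. -/
lemma clauseProj_of_dataHeaded_hyp {cfg : Settings S} {R R' : Clause S}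
    (h : R' ∈ cfg.simplify R) {F : Fact S} (hF : F ∈ R'.hyps) (hd : DataHeaded F) :
    ∃ f x i, S.isData f ∧ Function.Injective x ∧ R' = clauseProj (S := S) f x i := by
  classical
  obtain ⟨R₁, hR₁, R₂, rfl, -, -, rfl⟩ := h
  obtain ⟨C, hC, rfl⟩ := mem_decomp_iff.1 hR₁
  obtain ⟨hc, hh, -⟩ := elimredundanthyp_elimdup_le cfg ⟨decompHyps R, C⟩
  have hle := (elimattx_le _).2.trans hh
  obtain ⟨f, x, i, hf, hx, rfl⟩ :=
    isDataClause_of_dataHeaded_mem_decompHyps (Multiset.mem_of_le hle hF) hd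
  have hR : IsDataClause (clauseProj f x i) := ⟨f, hf, x, hx, Or.inr ⟨i, rfl⟩⟩
  refine ⟨f, x, i, hf, hx, ?_⟩
  rw [decompConcls, if_pos hR, Multiset.mem_singleton] at hC
  subst hC
  have e : decompHyps (clauseProj f x i) = (clauseProj f x i).hyps := if_pos hR
  rw [e] at hF hle hc ⊢
  have hconcl := (elimattx_le (cfg.elimredundanthyp
    (elimdup ⟨(clauseProj f x i).hyps, (clauseProj f x i).concl⟩))).1.trans hc
  generalize elimattx (cfg.elimredundanthyp
    (elimdup ⟨(clauseProj f x i).hyps, (clauseProj f x i).concl⟩)) = R' at hF hle hconcl ⊢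
  cases R' with | mk H C =>
  simp only at hF hle hconcl
  subst hconcl
  rcases Multiset.le_singleton.1 hle with h | h
  · simp [h] at hF
  · rw [h]
    rfl

end

section

variable {S : Signature}

/-! ## Derivability -/

/-- Facts derivable from the clauses of `R₁`, by derivations of height at most `k`, where all facts
`m-event(p)` are assumed. -/
def DerivableIn (R₁ : Set (Clause S)) : ℕ → Fact S → Prop
  | 0, F => ∃ p, F = .mevent p
  | k + 1, F => (∃ p, F = .mevent p) ∨ ∃ R ∈ R₁, ∃ σ : Subst S, R.concl.subst σ = F ∧
      ∀ G ∈ R.hyps, DerivableIn R₁ k (G.subst σ)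

namespace DerivableIn

variable {R₁ : Set (Clause S)}

lemma mevent (k : ℕ) (p : Pat S) : DerivableIn R₁ k (.mevent p) := by
  cases k with
  | zero => exact ⟨p, rfl⟩
  | succ k => exact Or.inl ⟨p, rfl⟩

lemma succ {k : ℕ} {F : Fact S} (h : DerivableIn R₁ k F) : DerivableIn R₁ (k + 1) F := by
  induction k generalizing F with
  | zero => exact Or.inl h
  | succ k ih =>
    rcases h with h | ⟨R, hR, σ, hc, hh⟩
    · exact Or.inl h
    · exact Or.inr ⟨R, hR, σ, hc, fun G hG => ih (hh G hG)⟩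

lemma mono {k l : ℕ} (hkl : k ≤ l) {F : Fact S} (h : DerivableIn R₁ k F) : DerivableIn R₁ l F := by
  induction hkl with
  | refl => exact h
  | step _ ih => exact ih.succ

lemma exists_forall {H : Multiset (Fact S)} (h : ∀ F ∈ H, ∃ k, DerivableIn R₁ k F) :
    ∃ k, ∀ F ∈ H, DerivableIn R₁ k F := by
  induction H using Multiset.induction with
  | empty => exact ⟨0, fun F hF => by simp at hF⟩
  | cons F H ih =>
    obtain ⟨k, hk⟩ := ih fun G hG => h G (Multiset.mem_cons_of_mem hG)
    obtain ⟨l, hl⟩ := h F (Multiset.mem_cons_self F H)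
    refine ⟨max k l, fun G hG => ?_⟩
    rcases Multiset.mem_cons.1 hG with rfl | hG
    · exact hl.mono (le_max_right _ _)
    · exact (hk G hG).mono (le_max_left _ _)

lemma of_mem {R : Clause S} (hR : R ∈ R₁) (σ : Subst S)
    (h : ∀ G ∈ R.hyps, ∃ k, DerivableIn R₁ k (G.subst σ)) :
    ∃ k, DerivableIn R₁ k (R.concl.subst σ) := by
  obtain ⟨k, hk⟩ := exists_forall (H := R.hyps.map (Fact.subst σ)) (R₁ := R₁) (by simpa using h)
  exact ⟨k + 1, Or.inr ⟨R, hR, σ, rfl, fun G hG => hk _ (Multiset.mem_map_of_mem _ hG)⟩⟩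

end DerivableIn

/-- No instance of a fact in `Fnot` has a derivation of height at most `k`. -/
def NoneDerivable (Fnot : Set (Fact S)) (R₁ : Set (Clause S)) (k : ℕ) : Prop :=
  ∀ F ∈ Fnot, ∀ σ : Subst S, ¬ DerivableIn R₁ k (F.subst σ)

lemma NoneDerivable.mono {Fnot : Set (Fact S)} {R₁ : Set (Clause S)} {k l : ℕ}
    (h : NoneDerivable Fnot R₁ l) (hkl : k ≤ l) : NoneDerivable Fnot R₁ k :=
  fun F hF σ hd => h F hF σ (hd.mono hkl)

lemma NoneDerivable.not_hasNotHyp {Fnot : Set (Fact S)} {R₁ : Set (Clause S)} {k : ℕ}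
    (h : NoneDerivable Fnot R₁ k) {R : Clause S} {θ : Subst S}
    (hR : ∀ F ∈ R.hyps, DerivableIn R₁ k (F.subst θ)) : ¬ HasNotHyp Fnot R := by
  rintro ⟨F, hF, F', hF', σ, rfl⟩
  refine h F' hF' (σ.comp θ) ?_
  rw [← Fact.subst_subst]
  exact hR _ hF

/-- The properties of the set of clauses at the fixpoint of the saturation. -/
structure Settings.Fixpoint (cfg : Settings S) (Rs : Set (Clause S)) : Prop where
  simplified : ∀ R ∈ Rs, ∃ R₀, R ∈ cfg.simplify R₀
  resolvent : ∀ R ∈ Rs, cfg.sel R = ∅ → ∀ R' ∈ Rs, ∀ F₀ ∈ cfg.sel R', Resolvable R F₀ R' →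
    ∃ R'', IsResolvent R F₀ R' R'' ∧ Covered cfg Rs R''
  constructor : ∀ f, S.isData f → ∃ x, Function.Injective x ∧
    Covered cfg Rs (clauseRf (S := S) f x)
  projection : ∀ f, S.isData f → ∀ i, ∃ x, Function.Injective x ∧
    Covered cfg Rs (clauseProj (S := S) f x i)

/-- The clauses without selected hypotheses. -/
def Settings.unselected (cfg : Settings S) (Rs : Set (Clause S)) : Set (Clause S) :=
  {R ∈ Rs | cfg.sel R = ∅}

lemma Settings.sel_eq_empty (cfg : Settings S) {R : Clause S}
    (h : ∀ F ∈ R.hyps, Unselectable F) : cfg.sel R = ∅ :=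
  Set.eq_empty_of_forall_notMem fun F hF =>
    cfg.sel_selectable R F hF (h F (cfg.sel_subset R F hF))

lemma decompHyps_of_isDataClause {R : Clause S} (h : IsDataClause R) : decompHyps R = R.hyps :=
  if_pos h

lemma decompConcls_of_isDataClause {R : Clause S} (h : IsDataClause R) :
    decompConcls R = {R.concl} :=
  if_pos h

lemma decompHyps_eq {R : Clause S} (h : ∀ F ∈ R.hyps, ¬ DataHeaded F) :
    decompHyps R = R.hyps := by
  unfold decompHyps
  split_ifs with hR
  · rfl
  · rw [Multiset.bind_congr fun F hF => Fact.decomp_of_not_dataHeaded (h F hF)]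
    exact (Multiset.bind_singleton _ _).trans (Multiset.map_id _)

lemma decompConcls_eq {R : Clause S} (h : ¬ DataHeaded R.concl) :
    decompConcls R = {R.concl} := by
  unfold decompConcls
  split_ifs with hR
  · rfl
  · exact Fact.decomp_of_not_dataHeaded h

variable {cfg : Settings S} {Rs : Set (Clause S)}

/-- For a conclusion `attacker(x)`, an empty selection is permitted only when there is nothing
selectable; this is the use of `sel_attacker`. -/
lemma unselectable_hyps {R : Clause S} (hR : R ∈ cfg.unselected Rs) {x : ℕ}
    (hc : R.concl = .attacker (.var x)) {F : Fact S} (hF : F ∈ R.hyps) : Unselectable F := by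
  by_contra h
  have := cfg.sel_attacker R x hc ⟨F, hF, h⟩
  rw [hR.2] at this
  exact Set.not_nonempty_empty this

/-- A clause without selected hypotheses that concludes `attacker(x)` yields, by resolution with
a projection, a clause for the arguments of data constructors. -/
lemma component_of_var_concl (hfix : cfg.Fixpoint Rs) {k : ℕ}
    (hnot : NoneDerivable cfg.Fnot (cfg.unselected Rs) k) {R : Clause S}
    (hR : R ∈ cfg.unselected Rs) {x : ℕ} (hc : R.concl = .attacker (.var x)) {σ : Subst S}
    {f : S.Con} {ps : Fin (S.arity f) → Pat S} (hσ : σ.pat x = .app f ps)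
    (hhyps : ∀ G ∈ R.hyps, DerivableIn (cfg.unselected Rs) k (G.subst σ))
    {y : Fin (S.arity f) → ℕ} (hy : Function.Injective y) (i : Fin (S.arity f))
    (hproj : clauseProj (S := S) f y i ∈ Rs) :
    DerivableIn (cfg.unselected Rs) (k + 1) (.attacker (ps i)) := by
  classical
  set F₀ : Fact S := .attacker (.app f fun j => .var (y j)) with hF₀
  have hF₀sel : F₀ ∈ cfg.sel (clauseProj f y i) := by
    obtain ⟨F, hF⟩ := cfg.sel_attacker (clauseProj f y i) (y i) rfl
      ⟨F₀, Multiset.mem_singleton_self _, by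
        rintro (⟨x, hx⟩ | ⟨p, hp⟩)
        · injection hx with hx
          cases hx
        · exact absurd (hF₀.symm.trans hp) (by simp)⟩
    have := cfg.sel_subset _ F hF
    rwa [Multiset.mem_singleton.1 this] at hF
  -- This unifier renames nothing except `x`. The most general unifier factors it, so it sends the
  -- other variables of `R` and all variables `y j` to variables; this keeps the resolvent free of
  -- new selectable facts. The pair `σ`, `η` gives the instance of interest.
  let τ : Subst S := ⟨Function.update Pat.var x (.app f fun j => .var (y j)), Sess.var⟩
  have hτ : UnifiesFacts R.concl F₀ τ Subst.id := by
    simp [UnifiesFacts, hc, hF₀, Fact.subst, Pat.subst, τ, Subst.id]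
  let η : Subst S := ⟨Function.extend y ps Pat.var, Sess.var⟩
  have hη : ∀ j, η.pat (y j) = ps j := fun j => hy.extend_apply _ _ _
  have hση : UnifiesFacts R.concl F₀ σ η := by
    simp [UnifiesFacts, hc, hF₀, Fact.subst, Pat.subst, hσ, hη]
  obtain ⟨R'', ⟨H, σ₁, σ₂, hH, ⟨-, hmg⟩, rfl⟩, hcov⟩ :=
    hfix.resolvent R hR.1 hR.2 _ hproj F₀ hF₀sel
      ⟨Multiset.mem_singleton_self _, τ, Subst.id, hτ⟩
  obtain rfl : H = 0 := by
    have := congrArg Multiset.card hH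
    simpa [clauseProj] using this
  obtain ⟨θ₀, hθ₀, hθ₀'⟩ := hmg _ _ hτ
  obtain ⟨θ, hθ, hθ'⟩ := hmg _ _ hση
  simp only [Multiset.map_zero, add_zero] at hcov
  obtain ⟨w, hw⟩ : ∃ w, σ₂.pat (y i) = .var w := by
    have h : Pat.var (y i) = (σ₂.pat (y i)).subst θ₀ := hθ₀'.1 (y i) (Or.inr rfl)
    exact Pat.eq_var_of_subst h.symm
  have hconcl : (clauseProj f y i).concl.subst σ₂ = .attacker (.var w) := by
    simp [clauseProj, Fact.subst, Pat.subst, hw]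
  have hconclθ : (Fact.attacker (Pat.var w)).subst θ = .attacker (ps i) := by
    rw [← hconcl, Fact.subst_subst, ← Fact.subst_congr _ (hθ'.mono fun v hv => Or.inr hv)]
    simp [clauseProj, Fact.subst, Pat.subst, hη]
  -- The variable `x` instantiated by the resolution is not the argument of an attacker hypothesis,
  -- since a simplified clause is not a tautology. All attacker hypotheses therefore remain on
  -- variables, and decomposition has no effect on the resolvent.
  have huns : ∀ F ∈ R.hyps.map (Fact.subst σ₁), Unselectable F := by
    intro F hF
    obtain ⟨G, hG, rfl⟩ := Multiset.mem_map.1 hF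
    rcases unselectable_hyps hR hc hG with ⟨z, rfl⟩ | ⟨p, rfl⟩
    · have hzx : z ≠ x := by
        rintro rfl
        obtain ⟨R₀, hR₀⟩ := hfix.simplified R hR.1
        exact not_isTautology_of_mem_simplify hR₀ (by rw [IsTautology, hc]; exact hG)
      have h : τ.pat z = (σ₁.pat z).subst θ₀ := hθ₀.1 z (Or.inl ⟨_, hG, rfl⟩)
      rw [show τ.pat z = .var z from Function.update_of_ne hzx _ _] at h
      obtain ⟨w, hw⟩ := Pat.eq_var_of_subst h.symm
      exact Or.inl ⟨w, by simp [Fact.subst, Pat.subst, hw]⟩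
    · exact Or.inr ⟨_, rfl⟩
  have hder : ∀ F ∈ R.hyps.map (Fact.subst σ₁),
      DerivableIn (cfg.unselected Rs) k (F.subst θ) := by
    intro F hF
    obtain ⟨G, hG, rfl⟩ := Multiset.mem_map.1 hF
    rw [Fact.subst_subst, ← Fact.subst_congr _ (hθ.mono fun v hv => Or.inl ⟨G, hG, hv⟩)]
    exact hhyps G hG
  rw [hconcl] at hcov
  have hdh := decompHyps_eq (R := ⟨R.hyps.map (Fact.subst σ₁), .attacker (.var w)⟩)
    fun F hF => not_dataHeaded_of_unselectable (huns F hF)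
  have hdc := decompConcls_eq (R := ⟨R.hyps.map (Fact.subst σ₁), .attacker (.var w)⟩)
    (not_dataHeaded_of_unselectable (Or.inl ⟨w, rfl⟩))
  rcases hcov.cases (by rw [hdc]; exact Multiset.mem_singleton_self _) with
    h | h | ⟨R₃, hR₃, s, hs, hs'⟩
  · rw [hdh] at h
    exact absurd h (hnot.not_hasNotHyp hder)
  · rw [hdh] at h
    rw [← hconclθ]
    exact (hder _ h).succ
  · rw [hdh] at hs'
    have hmem : ∀ G ∈ R₃.hyps, G.subst s ∈ R.hyps.map (Fact.subst σ₁) := fun G hG =>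
      Multiset.mem_of_le hs' (Multiset.mem_map_of_mem _ hG)
    refine Or.inr ⟨R₃, ⟨hR₃, cfg.sel_eq_empty fun G hG => (huns _ (hmem G hG)).of_subst⟩,
      s.comp θ, ?_, fun G hG => ?_⟩
    · rw [← Fact.subst_subst, hs, hconclθ]
    · rw [← Fact.subst_subst]
      exact hder _ (hmem G hG)

/-- The height does not grow, which applying a projection clause on top of the derivation would not
give. If the last clause concludes with the head `f`, it is the constructor clause and the component
is one of its hypotheses. If it concludes `attacker(x)`, its resolvent with the projection has the
same instantiated hypotheses and is covered by a clause without selection, which replaces it as the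
last step. -/
lemma derivableIn_component (hfix : cfg.Fixpoint Rs) {k : ℕ}
    (hnot : NoneDerivable cfg.Fnot (cfg.unselected Rs) k) {f : S.Con}
    {ps : Fin (S.arity f) → Pat S} (hf : S.isData f)
    (h : DerivableIn (cfg.unselected Rs) k (.attacker (.app f ps))) (i : Fin (S.arity f)) :
    DerivableIn (cfg.unselected Rs) k (.attacker (ps i)) := by
  cases k with
  | zero => obtain ⟨p, hp⟩ := h; cases hp
  | succ k =>
  have h₀ := h
  obtain ⟨p, hp⟩ | ⟨R, hR, σ, hσ, hh⟩ := h
  · cases hp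
  obtain ⟨R₀, hR₀⟩ := hfix.simplified R hR.1
  cases hc : R.concl with
  | attacker q =>
    rw [hc] at hσ
    injection hσ with hσ
    cases q with
    | name a qs is => cases hσ
    | app g qs =>
      obtain rfl : g = f := by injection hσ
      obtain ⟨f', x, -, hx, rfl⟩ := eq_clauseRf_of_dataHeaded_concl hR₀ ⟨g, qs, hf, hc⟩
      obtain rfl : f' = g := by injection hc with hc; injection hc
      have hσ' : (Pat.app f' fun j => .var (x j)).subst σ = .app f' ps := by
        have : (Pat.app f' fun j => Pat.var (x j)) = Pat.app f' qs := Fact.attacker.inj hc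
        rw [this, hσ]
      have : σ.pat (x i) = ps i := by
        simp only [Pat.subst, Pat.app.injEq, heq_eq_eq, true_and] at hσ'
        exact congrFun hσ' i
      rw [← this]
      exact (hh _ (clauseRf_hyps.2 ⟨i, rfl⟩)).succ
    | var x =>
      obtain ⟨y, hy, hcov⟩ := hfix.projection f hf i
      have hdata : IsDataClause (clauseProj f y i) := ⟨f, hf, y, hy, Or.inr ⟨i, rfl⟩⟩
      let η : Subst S := ⟨Function.extend y ps Pat.var, Sess.var⟩
      have hη : ∀ j, η.pat (y j) = ps j := fun j => hy.extend_apply _ _ _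
      have hconclη : (clauseProj f y i).concl.subst η = .attacker (ps i) := by
        simp [clauseProj, Fact.subst, Pat.subst, hη]
      have hder : ∀ F ∈ (clauseProj f y i).hyps,
          DerivableIn (cfg.unselected Rs) (k + 1) (F.subst η) := by
        intro F hF
        rw [Multiset.mem_singleton.1 hF]
        simpa [Fact.subst, Pat.subst, hη] using h₀
      rcases hcov.cases (by
        rw [decompConcls_of_isDataClause hdata]; exact Multiset.mem_singleton_self _) with
        h | h | ⟨R', hR', s, hs, hs'⟩
      · rw [decompHyps_of_isDataClause hdata] at h
        exact absurd h (hnot.not_hasNotHyp hder)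
      · rw [decompHyps_of_isDataClause hdata] at h
        have := Multiset.mem_singleton.1 h
        injection this with this
        cases this
      · rw [decompHyps_of_isDataClause hdata] at hs'
        obtain ⟨R₀', hR₀'⟩ := hfix.simplified R' hR'
        have hw : ∃ w, R'.concl = .attacker (.var w) := by
          cases hq : R'.concl with
          | attacker q =>
            rw [hq] at hs
            obtain ⟨w, rfl⟩ := Pat.eq_var_of_subst (Fact.attacker.inj hs)
            exact ⟨w, rfl⟩
          | _ => rw [hq] at hs; cases hs
        obtain ⟨w, hw⟩ := hw
        -- The clause covering the projection either has no hypothesis, and yields the component at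
        -- once, or has exactly one. A hypothesis on a variable would make it a tautology, so it is
        -- the projection clause itself up to renaming.
        rcases Multiset.le_singleton.1 hs' with h0 | h1
        · rw [Multiset.map_eq_zero] at h0
          refine Or.inr ⟨R', ⟨hR', cfg.sel_eq_empty fun F hF => ?_⟩, s.comp η, ?_, fun F hF => ?_⟩
          · simp [h0] at hF
          · rw [← Fact.subst_subst, hs, hconclη]
          · simp [h0] at hF
        · obtain ⟨G, hG, hGs⟩ := Multiset.map_eq_singleton.1 h1
          cases G with
          | attacker q =>
            cases q with
            | var z =>
              have hz := mem_vars_of_mem_simplify hR₀' hG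
              rw [hw] at hz
              obtain rfl : z = w := by simpa [Fact.vars, Pat.vars] using hz
              exact absurd (by rw [IsTautology, hw, hG]; exact Multiset.mem_singleton_self _)
                (not_isTautology_of_mem_simplify hR₀')
            | name a qs is => injection hGs with hGs; cases hGs
            | app g qs =>
              obtain rfl : g = f := by injection hGs with hGs; injection hGs
              obtain ⟨f', x', i', hf', hx', rfl⟩ := clauseProj_of_dataHeaded_hyp hR₀'
                (F := .attacker (.app g qs)) (by rw [hG]; exact Multiset.mem_singleton_self _)
                ⟨g, qs, hf, rfl⟩
              have hG' := Multiset.singleton_inj.1 hG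
              obtain rfl : f' = g := by injection hG' with h; injection h
              rw [← hG'] at hGs
              have h₁ : ∀ j, s.pat (x' j) = .var (y j) := by
                intro j
                simp only [Fact.subst, Pat.subst, Fact.attacker.injEq, Pat.app.injEq,
                  heq_eq_eq, true_and] at hGs
                exact congrFun hGs j
              have h₂ : s.pat (x' i') = .var (y i) := Fact.attacker.inj hs
              obtain rfl : i' = i := hy (Pat.var.inj ((h₁ i').symm.trans h₂))
              exact component_of_var_concl hfix (hnot.mono k.le_succ) hR hc hσ hh hx' i' hR'
          | _ => cases hGs
  | _ => rw [hc] at hσ; cases hσ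

lemma derivableIn_decomp (hfix : cfg.Fixpoint Rs) {k : ℕ}
    (hnot : NoneDerivable cfg.Fnot (cfg.unselected Rs) k) {F : Fact S} {θ : Subst S}
    (h : DerivableIn (cfg.unselected Rs) k (F.subst θ)) {G : Fact S} (hG : G ∈ F.decomp) :
    DerivableIn (cfg.unselected Rs) k (G.subst θ) := by
  cases F with
  | attacker p =>
    obtain ⟨q, hq, rfl⟩ := Multiset.mem_map.1 hG
    clear hG
    induction p with
    | app f ps ih =>
      by_cases hf : S.isData f
      · obtain ⟨j, hj⟩ := (Pat.mem_decomp_app hf).1 hq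
        exact ih j (derivableIn_component hfix hnot hf h j) hj
      · rw [Pat.decomp, if_neg hf, Multiset.mem_singleton] at hq
        rwa [hq]
    | _ =>
      rw [Pat.decomp, Multiset.mem_singleton] at hq
      rwa [hq]
  | _ =>
    rw [Fact.decomp, Multiset.mem_singleton] at hG
    rwa [hG]

lemma derivableIn_decompHyps (hfix : cfg.Fixpoint Rs) {k : ℕ}
    (hnot : NoneDerivable cfg.Fnot (cfg.unselected Rs) k) {R : Clause S} {θ : Subst S}
    (h : ∀ F ∈ R.hyps, DerivableIn (cfg.unselected Rs) k (F.subst θ)) :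
    ∀ F ∈ decompHyps R, DerivableIn (cfg.unselected Rs) k (F.subst θ) := by
  intro F hF
  unfold decompHyps at hF
  split_ifs at hF with hR
  · exact h F hF
  · obtain ⟨G, hG, hFG⟩ := Multiset.mem_bind.1 hF
    exact derivableIn_decomp hfix hnot (h G hG) hFG

/-! ## The measure of multisets of derivable facts -/

/-- The least height of a derivation of a derivable fact. -/
noncomputable def rank (R₁ : Set (Clause S)) (F : Fact S) : ℕ := sInf {k | DerivableIn R₁ k F}

lemma rank_le {R₁ : Set (Clause S)} {k : ℕ} {F : Fact S} (h : DerivableIn R₁ k F) :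
    rank R₁ F ≤ k :=
  Nat.sInf_le h

lemma derivableIn_rank {R₁ : Set (Clause S)} {k : ℕ} {F : Fact S} (h : DerivableIn R₁ k F) :
    DerivableIn R₁ (rank R₁ F) F :=
  Nat.sInf_mem (s := {k | DerivableIn R₁ k F}) ⟨k, h⟩

/-- The ranks of the facts obtained by decomposing data constructors. -/
noncomputable def ranks (R₁ : Set (Clause S)) (H : Multiset (Fact S)) : Multiset ℕ :=
  (H.bind Fact.decomp).map (rank R₁)

lemma ranks_add (R₁ : Set (Clause S)) (H H' : Multiset (Fact S)) :
    ranks R₁ (H + H') = ranks R₁ H + ranks R₁ H' := by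
  simp [ranks]

lemma ranks_mono (R₁ : Set (Clause S)) {H H' : Multiset (Fact S)} (h : H ≤ H') :
    ranks R₁ H ≤ ranks R₁ H' := by
  obtain ⟨T, rfl⟩ := Multiset.le_iff_exists_add.1 h
  rw [ranks_add]
  exact Multiset.le_add_right _ _

lemma ranks_decompHyps (R₁ : Set (Clause S)) (R : Clause S) (θ : Subst S) :
    ranks R₁ ((decompHyps R).map (Fact.subst θ)) = ranks R₁ (R.hyps.map (Fact.subst θ)) := by
  rw [ranks, bind_decomp_decompHyps, ranks]

/-- Both clauses keep their own substitution, as their variables are renamed apart; generality of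
the unifying pair merges the two into one instance `θ` of the resolvent. -/
lemma IsResolvent.exists_instance {R R' R'' : Clause S} {F₀ : Fact S}
    (h : IsResolvent R F₀ R' R'') {τ σ : Subst S} (hτ : UnifiesFacts R.concl F₀ τ σ) :
    ∃ (θ : Subst S) (H : Multiset (Fact S)), R'.hyps = F₀ ::ₘ H ∧
      R''.concl.subst θ = R'.concl.subst σ ∧
      R''.hyps.map (Fact.subst θ) = R.hyps.map (Fact.subst τ) + H.map (Fact.subst σ) := by
  obtain ⟨H, σ₁, σ₂, hH, ⟨-, hmg⟩, rfl⟩ := h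
  obtain ⟨θ, hθ, hθ'⟩ := hmg _ _ hτ
  refine ⟨θ, H, hH, ?_, ?_⟩
  · rw [Fact.subst_subst, ← Fact.subst_congr _ (hθ'.mono fun v hv => Or.inr hv)]
  · rw [Multiset.map_add, map_subst_subst, map_subst_subst,
      ← map_subst_congr _ (hθ.mono fun v hv => Or.inl hv),
      ← map_subst_congr H (hθ'.mono fun v hv => Or.inl ?_)]
    obtain ⟨F, hF, hv⟩ := hv
    exact ⟨F, by rw [hH]; exact Multiset.mem_cons_of_mem hF, hv⟩

/-- Resolution upon a hypothesis decreases the ranks of the hypotheses of an instance. -/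
lemma exists_resolvable (hfix : cfg.Fixpoint Rs) {k : ℕ}
    (hnot : NoneDerivable cfg.Fnot (cfg.unselected Rs) k) {R' : Clause S} {σ : Subst S}
    (hh : ∀ F ∈ R'.hyps, DerivableIn (cfg.unselected Rs) k (F.subst σ)) {F₀ : Fact S}
    (hF₀ : F₀ ∈ R'.hyps) (hs : ¬ Unselectable F₀) (hd : ¬ DataHeaded F₀) :
    ∃ R ∈ cfg.unselected Rs, Resolvable R F₀ R' ∧ ∀ R'', IsResolvent R F₀ R' R'' →
      ∃ θ : Subst S, R''.concl.subst θ = R'.concl.subst σ ∧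
        (∀ F ∈ R''.hyps, DerivableIn (cfg.unselected Rs) k (F.subst θ)) ∧
        ∃ (A B : Multiset ℕ) (r : ℕ), (∀ a ∈ A, a < r) ∧
          ranks (cfg.unselected Rs) (R'.hyps.map (Fact.subst σ)) = r ::ₘ B ∧
          ranks (cfg.unselected Rs) (R''.hyps.map (Fact.subst θ)) = A + B := by
  have hnm : ∀ p, F₀.subst σ ≠ .mevent p := fun p hp =>
    hs (Unselectable.of_subst (σ := σ) (Or.inr ⟨p, hp⟩))
  have hk := hh _ hF₀
  have hr := derivableIn_rank hk
  have hrk := rank_le hk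
  cases hrank : rank (cfg.unselected Rs) (F₀.subst σ) with
  | zero =>
    rw [hrank] at hr
    obtain ⟨p, hp⟩ := hr
    exact absurd hp (hnm p)
  | succ n =>
  rw [hrank] at hr hrk
  obtain ⟨p, hp⟩ | ⟨R, hR, τ, hτ, hRh⟩ := hr
  · exact absurd hp (hnm p)
  refine ⟨R, hR, ⟨hF₀, τ, σ, hτ⟩, fun R'' hR'' => ?_⟩
  obtain ⟨θ, H, hH, hc, hhyps⟩ := hR''.exists_instance hτ
  refine ⟨θ, hc, fun F hF => ?_, ranks (cfg.unselected Rs) (R.hyps.map (Fact.subst τ)),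
    ranks (cfg.unselected Rs) (H.map (Fact.subst σ)), n + 1, fun a ha => ?_, ?_, ?_⟩
  · have := Multiset.mem_map_of_mem (Fact.subst θ) hF
    rw [hhyps] at this
    rcases Multiset.mem_add.1 this with h | h
    · obtain ⟨G, hG, hGF⟩ := Multiset.mem_map.1 h
      rw [← hGF]
      exact (hRh G hG).mono (by omega)
    · obtain ⟨G, hG, hGF⟩ := Multiset.mem_map.1 h
      rw [← hGF]
      exact hh G (by rw [hH]; exact Multiset.mem_cons_of_mem hG)
  -- The hypotheses of the last clause of the derivation have height at most `n`, and by
  -- `derivableIn_decomp` so do their components.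
  · obtain ⟨G, hG, rfl⟩ := Multiset.mem_map.1 ha
    obtain ⟨G', hG', hG⟩ := Multiset.mem_bind.1 hG
    obtain ⟨G', hG'', rfl⟩ := Multiset.mem_map.1 hG'
    have := derivableIn_decomp hfix (hnot.mono (k := n) (by omega)) (θ := Subst.id)
      (by rw [Fact.subst_id]; exact hRh G' hG'') hG
    rw [Fact.subst_id] at this
    exact Nat.lt_succ_of_le (rank_le this)
  · rw [hH, Multiset.map_cons, ranks, Multiset.cons_bind,
      Fact.decomp_of_not_dataHeaded fun h => hd (h.of_subst hs)]
    simp [hrank, ranks]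
  · rw [hhyps, ranks_add]

/-- Trading `r` for the smaller elements of `A` is a strict descent. The larger `N'` absorbs what
subsumption and simplification drop, so inductions can be run on an upper bound of the ranks; the
decomposition keeps `B + C`, adds `A` and removes `r`. -/
lemma isDershowitzMannaLT_of_le {A B N M : Multiset ℕ} {r : ℕ} (hA : ∀ a ∈ A, a < r)
    (hM : r ::ₘ B ≤ M) (hN : N ≤ A + B) : ∃ N', N ≤ N' ∧ N'.IsDershowitzMannaLT M := by
  obtain ⟨C, rfl⟩ := Multiset.le_iff_exists_add.1 hM
  refine ⟨A + B + C, hN.trans (Multiset.le_add_right _ _), B + C, A, {r},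
    Multiset.singleton_ne_zero r, ?_, ?_, fun a ha => ⟨r, Multiset.mem_singleton_self r, hA a ha⟩⟩
  · rw [add_assoc, add_comm]
  · rw [← Multiset.singleton_add, add_assoc, add_comm]

/-! ## Soundness of the saturation -/

/-- Converse of decomposition, by rebuilding each data constructor with the clause covering its
constructor clause. The height may grow here, which is harmless: the lemma serves for conclusions,
while the measure bears on hypotheses. -/
lemma derivable_of_decomp (hfix : cfg.Fixpoint Rs)
    (hnot : ∀ k, NoneDerivable cfg.Fnot (cfg.unselected Rs) k) {F : Fact S} {θ : Subst S}
    (h : ∀ G ∈ F.decomp, ∃ k, DerivableIn (cfg.unselected Rs) k (G.subst θ)) :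
    ∃ k, DerivableIn (cfg.unselected Rs) k (F.subst θ) := by
  cases F with
  | attacker p =>
    induction p with
    | app f ps ih =>
      by_cases hf : S.isData f
      · have hj : ∀ j, ∃ k, DerivableIn (cfg.unselected Rs) k (.attacker ((ps j).subst θ)) :=
          fun j => ih j fun G hG => by
            obtain ⟨q, hq, rfl⟩ := Multiset.mem_map.1 hG
            exact h _ (Multiset.mem_map_of_mem _ ((Pat.mem_decomp_app hf).2 ⟨j, hq⟩))
        obtain ⟨x, hx, hcov⟩ := hfix.constructor f hf
        let η : Subst S := ⟨Function.extend x (fun j => (ps j).subst θ) Pat.var, Sess.var⟩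
        have hη : ∀ j, η.pat (x j) = (ps j).subst θ :=
          fun j => hx.extend_apply (fun j => (ps j).subst θ) _ j
        have hdata : IsDataClause (clauseRf f x) := ⟨f, hf, x, hx, Or.inl rfl⟩
        have hconcl : (clauseRf f x).concl.subst η = (Fact.attacker (.app f ps)).subst θ := by
          simp [clauseRf, Fact.subst, Pat.subst, hη]
        have hder : ∀ F ∈ (clauseRf f x).hyps,
            ∃ k, DerivableIn (cfg.unselected Rs) k (F.subst η) := by
          intro F hF
          obtain ⟨j, rfl⟩ := clauseRf_hyps.1 hF
          simpa [Fact.subst, Pat.subst, hη] using hj j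
        rcases hcov.cases (by
          rw [decompConcls_of_isDataClause hdata]; exact Multiset.mem_singleton_self _) with
          h | h | ⟨R', hR', s, hs, hs'⟩
        · rw [decompHyps_of_isDataClause hdata] at h
          obtain ⟨F, hF, F', hF', σ, rfl⟩ := h
          obtain ⟨k, hk⟩ := hder _ hF
          rw [Fact.subst_subst] at hk
          exact absurd hk (hnot k F' hF' _)
        · rw [decompHyps_of_isDataClause hdata] at h
          obtain ⟨j, hj⟩ := clauseRf_hyps.1 h
          injection hj with hj
          cases hj
        · rw [decompHyps_of_isDataClause hdata] at hs'
          have hmem : ∀ G ∈ R'.hyps, G.subst s ∈ (clauseRf f x).hyps := fun G hG =>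
            Multiset.mem_of_le hs' (Multiset.mem_map_of_mem _ hG)
          have hR'' : R' ∈ cfg.unselected Rs := ⟨hR', cfg.sel_eq_empty fun G hG => by
            obtain ⟨j, hj⟩ := clauseRf_hyps.1 (hmem G hG)
            exact Unselectable.of_subst (σ := s) (Or.inl ⟨_, hj⟩)⟩
          rw [← hconcl, ← hs, Fact.subst_subst]
          refine DerivableIn.of_mem hR'' _ fun G hG => ?_
          rw [← Fact.subst_subst]
          exact hder _ (hmem G hG)
      · exact h _ (by simp [Fact.decomp, Pat.decomp, hf])
    | _ => exact h _ (by simp [Fact.decomp, Pat.decomp])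
  | _ => exact h _ (by simp [Fact.decomp])

/-- Passing from `R` to the clauses that cover it does not raise the ranks, so the inductive
hypothesis `ih` for clauses of `Rs` suffices; decomposed conclusions are then reassembled. -/
lemma Covered.derivable (hfix : cfg.Fixpoint Rs)
    (hnot : ∀ k, NoneDerivable cfg.Fnot (cfg.unselected Rs) k) {R : Clause S}
    (hcov : Covered cfg Rs R) {k : ℕ} {θ : Subst S}
    (hh : ∀ F ∈ R.hyps, DerivableIn (cfg.unselected Rs) k (F.subst θ))
    (ih : ∀ R' ∈ Rs, ∀ s : Subst S,
      (∀ F ∈ R'.hyps, DerivableIn (cfg.unselected Rs) k (F.subst s)) →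
      ranks (cfg.unselected Rs) (R'.hyps.map (Fact.subst s)) ≤
        ranks (cfg.unselected Rs) (R.hyps.map (Fact.subst θ)) →
      ∃ l, DerivableIn (cfg.unselected Rs) l (R'.concl.subst s)) :
    ∃ l, DerivableIn (cfg.unselected Rs) l (R.concl.subst θ) := by
  have hd := derivableIn_decompHyps hfix (hnot k) hh
  have key : ∀ C ∈ decompConcls R, ∃ l, DerivableIn (cfg.unselected Rs) l (C.subst θ) := by
    intro C hC
    rcases hcov.cases hC with h | h | ⟨R', hR', s, hs, hs'⟩
    · exact absurd h ((hnot k).not_hasNotHyp hd)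
    · exact ⟨k, hd C h⟩
    · rw [← hs, Fact.subst_subst]
      refine ih R' hR' _ (fun F hF => ?_) ?_
      · rw [← Fact.subst_subst]
        exact hd _ (Multiset.mem_of_le hs' (Multiset.mem_map_of_mem _ hF))
      · rw [← ranks_decompHyps _ R, ← map_subst_subst]
        exact ranks_mono _ (Multiset.map_le_map hs')
  by_cases hR : IsDataClause R
  · exact key _ (by rw [decompConcls_of_isDataClause hR]; exact Multiset.mem_singleton_self _)
  · rw [decompConcls, if_neg hR] at key
    exact derivable_of_decomp hfix hnot key

/-- Induction on a bound `M` of the ranks. The height bound `k` stays fixed, since resolution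
replaces a derivable hypothesis by hypotheses of lower derivations. -/
lemma derivable_of_mem_aux (hfix : cfg.Fixpoint Rs)
    (hnot : ∀ k, NoneDerivable cfg.Fnot (cfg.unselected Rs) k) (k : ℕ) (M : Multiset ℕ) :
    ∀ R ∈ Rs, ∀ σ : Subst S,
      (∀ F ∈ R.hyps, DerivableIn (cfg.unselected Rs) k (F.subst σ)) →
      ranks (cfg.unselected Rs) (R.hyps.map (Fact.subst σ)) ≤ M →
      ∃ l, DerivableIn (cfg.unselected Rs) l (R.concl.subst σ) := by
  induction M using (Multiset.wellFounded_isDershowitzMannaLT (α := ℕ)).induction with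
  | _ M ih =>
  intro R' hR' σ hh hM
  by_cases hsel : cfg.sel R' = ∅
  · exact DerivableIn.of_mem (show R' ∈ cfg.unselected Rs from ⟨hR', hsel⟩) σ fun G hG => ⟨k, hh G hG⟩
  obtain ⟨F₀, hF₀⟩ := Set.nonempty_iff_ne_empty.2 hsel
  have hmem := cfg.sel_subset _ _ hF₀
  -- Resolution would not visibly decrease the ranks here, as `F₀` is counted through its
  -- components. The only such clause is a projection, whose soundness is known directly.
  by_cases hd : DataHeaded F₀
  · obtain ⟨R₀, hR₀⟩ := hfix.simplified R' hR'
    obtain ⟨f, x, i, hf, hx, rfl⟩ := clauseProj_of_dataHeaded_hyp hR₀ hmem hd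
    exact ⟨k, derivableIn_component hfix (hnot k) hf (hh _ (Multiset.mem_singleton_self _)) i⟩
  obtain ⟨R, hR, hres, hR''⟩ :=
    exists_resolvable hfix (hnot k) hh hmem (cfg.sel_selectable _ _ hF₀) hd
  obtain ⟨R'', hres'', hcov⟩ := hfix.resolvent R hR.1 hR.2 R' hR' F₀ hF₀ hres
  obtain ⟨θ, hc, hh'', A, B, r, hA, hr, hAB⟩ := hR'' R'' hres''
  rw [← hc]
  refine hcov.derivable hfix hnot hh'' fun R₃ hR₃ s hs hle => ?_
  obtain ⟨N, hN, hlt⟩ := isDershowitzMannaLT_of_le hA (hr ▸ hM) (hAB ▸ hle)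
  exact ih N hlt R₃ hR₃ s hs hN

/-- The facts derivable from the clauses without selected hypotheses are closed under the clauses
whose simplifications are subsumed by the fixpoint. -/
theorem Covered.derivable_of_fixpoint (hfix : cfg.Fixpoint Rs)
    (hnot : ∀ k, NoneDerivable cfg.Fnot (cfg.unselected Rs) k) {R : Clause S}
    (hcov : Covered cfg Rs R) (θ : Subst S)
    (hh : ∀ F ∈ R.hyps, ∃ k, DerivableIn (cfg.unselected Rs) k (F.subst θ)) :
    ∃ l, DerivableIn (cfg.unselected Rs) l (R.concl.subst θ) := by
  obtain ⟨k, hk⟩ := DerivableIn.exists_forall (H := R.hyps.map (Fact.subst θ))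
    (R₁ := cfg.unselected Rs) (by simpa using hh)
  exact hcov.derivable hfix hnot (fun F hF => hk _ (Multiset.mem_map_of_mem _ hF))
    fun R' hR' s hs _ => derivable_of_mem_aux hfix hnot k _ R' hR' s hs le_rfl

end

section

variable {S : Signature} {cfg : Settings S}

/-! ## The fixpoint reached by the saturation -/

lemma IsElim.covered {Rs Rs' : Set (Clause S)} {X : Set (Clause S)} (h : IsElim (X ∪ Rs) Rs')
    {R : Clause S} (hR : Covered cfg Rs R) : Covered cfg Rs' R := by
  intro R₁ hR₁
  obtain ⟨R₂, hR₂, h₂⟩ := hR R₁ hR₁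
  obtain ⟨R₃, hR₃, h₃⟩ := h.2.1 R₂ (Or.inr hR₂)
  exact ⟨R₃, hR₃, h₃.trans h₂⟩

lemma Settings.Insert.covered {R : Clause S} {Rs Rs' : Set (Clause S)} (h : cfg.Insert R Rs Rs') :
    Covered cfg Rs' R :=
  fun R₁ hR₁ => h.2.1 R₁ (Or.inl hR₁)

lemma Settings.Insert.simplified {R : Clause S} {Rs Rs' : Set (Clause S)}
    (h : cfg.Insert R Rs Rs') (hRs : ∀ R ∈ Rs, ∃ R₀, R ∈ cfg.simplify R₀) :
    ∀ R ∈ Rs', ∃ R₀, R ∈ cfg.simplify R₀ := by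
  intro R' hR'
  rcases h.1 hR' with h | h
  · exact ⟨R, h⟩
  · exact hRs R' h

lemma Settings.InsertAll.invariant {L : List (Clause S)} {Rs Rs' : Set (Clause S)}
    (h : cfg.InsertAll L Rs Rs') (hRs : ∀ R ∈ Rs, ∃ R₀, R ∈ cfg.simplify R₀) :
    (∀ R ∈ Rs', ∃ R₀, R ∈ cfg.simplify R₀) ∧
      (∀ R, Covered cfg Rs R → Covered cfg Rs' R) ∧ ∀ R ∈ L, Covered cfg Rs' R := by
  induction h with
  | nil Rs => exact ⟨hRs, fun R hR => hR, fun R hR => by simp at hR⟩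
  | cons R L Rs Rs' Rs'' h _ ih =>
    obtain ⟨h₁, h₂, h₃⟩ := ih (h.simplified hRs)
    refine ⟨h₁, fun R' hR' => h₂ R' (IsElim.covered h hR'), fun R' hR' => ?_⟩
    rcases List.mem_cons.1 hR' with rfl | hR'
    · exact h₂ _ (Settings.Insert.covered h)
    · exact h₃ R' hR'

lemma Settings.SaturateStep.invariant {Rs Rs' : Set (Clause S)}
    (h : Relation.ReflTransGen cfg.SaturateStep Rs Rs')
    (hRs : ∀ R ∈ Rs, ∃ R₀, R ∈ cfg.simplify R₀) :
    (∀ R ∈ Rs', ∃ R₀, R ∈ cfg.simplify R₀) ∧ ∀ R, Covered cfg Rs R → Covered cfg Rs' R := by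
  induction h with
  | refl => exact ⟨hRs, fun R hR => hR⟩
  | tail _ h ih =>
    obtain ⟨R, -, R', -, F₀, -, R'', -, -, h⟩ := h
    exact ⟨h.simplified ih.1, fun R hR => IsElim.covered h (ih.2 R hR)⟩

/-- The output of the saturation consists of the clauses without selected hypotheses of a set at
which the fixpoint is reached, and which covers all input clauses. -/
lemma Settings.Saturate.exists_fixpoint {R₀ R₁ : Set (Clause S)} (h : cfg.Saturate R₀ R₁)
    (hrf : ∀ f, S.isData f → ∃ x, Function.Injective x ∧ clauseRf (S := S) f x ∈ R₀)
    (hproj : ∀ f, S.isData f → ∀ i, ∃ x, Function.Injective x ∧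
      clauseProj (S := S) f x i ∈ R₀) :
    ∃ Rs, cfg.Fixpoint Rs ∧ R₁ = cfg.unselected Rs ∧ ∀ R ∈ R₀, Covered cfg Rs R := by
  obtain ⟨L, Rs, Rs', hL, hins, hstep, hsat, rfl⟩ := h
  obtain ⟨h₁, -, h₂⟩ := hins.invariant fun R hR => absurd hR (Set.notMem_empty R)
  obtain ⟨h₃, h₄⟩ := Settings.SaturateStep.invariant hstep h₁
  have hcov : ∀ R ∈ R₀, Covered cfg Rs' R := fun R hR => h₄ R (h₂ R ((hL R).2 hR))
  refine ⟨Rs', ⟨h₃, ?_, ?_, ?_⟩, rfl, hcov⟩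
  · intro R hR hs R' hR' F₀ hF₀ hres
    obtain ⟨R'', hR'', hi⟩ := hsat R hR hs R' hR' F₀ hF₀ hres
    exact ⟨R'', hR'', Settings.Insert.covered hi⟩
  · intro f hf
    obtain ⟨x, hx, hm⟩ := hrf f hf
    exact ⟨x, hx, hcov _ hm⟩
  · intro f hf i
    obtain ⟨x, hx, hm⟩ := hproj f hf i
    exact ⟨x, hx, hcov _ hm⟩

/-! ## Completeness of the backwards search -/

lemma Settings.Deriv.sel_ne_empty {R₁ : Set (Clause S)} {R : Clause S} {D : Set (Clause S)}
    (h : cfg.Deriv R₁ R ∅ D) (hD : D = ∅) : cfg.sel R ≠ ∅ := by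
  cases h with
  | cycle _ _ h => obtain ⟨R', hR', -⟩ := h; exact absurd hR' (Set.notMem_empty R')
  | done _ _ _ _ => exact absurd hD (Set.singleton_ne_empty R)
  | step _ _ _ hsel => exact hsel

/-- `X` is a set of clauses expanded by the backwards search, whose successors are subsumed by
clauses of `Y`. -/
def Settings.Expanded (cfg : Settings S) (R₁ X Y : Set (Clause S)) : Prop :=
  ∀ R ∈ X, cfg.sel R ≠ ∅ ∧ (∀ x, R.concl ≠ .attacker (.var x)) ∧
    ∃ res : Clause S → Fact S → Clause S,
      (∀ R' ∈ R₁, ∀ F₀ ∈ cfg.sel R, Resolvable R' F₀ R → IsResolvent R' F₀ R (res R' F₀)) ∧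
      ∀ R₃ ∈ cfg.next R₁ R res, ∃ R₄ ∈ Y, R₄.Subsumes R₃

lemma concl_ne_of_subst {F : Fact S} (hF : ∀ x, F ≠ .attacker (.var x)) (σ : Subst S) (x : ℕ) :
    F.subst σ ≠ .attacker (.var x) := by
  intro h
  cases F with
  | attacker p =>
    obtain ⟨y, rfl⟩ := Pat.eq_var_of_subst (Fact.attacker.inj h)
    exact hF y rfl
  | _ => cases h

lemma concl_of_mem_simplify' {R R' : Clause S} (h : R' ∈ cfg.simplify' R) :
    R'.concl = R.concl := by
  obtain ⟨R₂, rfl, -, rfl⟩ := h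
  rw [(elimattx_le _).1, (elimredundanthyp_elimdup_le cfg _).1, decomphyp_eq]

lemma IsResolvent.concl_eq {R R' R'' : Clause S} {F₀ : Fact S} (h : IsResolvent R F₀ R' R'') :
    ∃ σ, R''.concl = R'.concl.subst σ := by
  obtain ⟨H, σ, σ', -, -, rfl⟩ := h
  exact ⟨σ', rfl⟩

/-- The set `X` collects the clauses expanded in the subtree below `R`. Branches cut by the
subsumption test point to the current path `Rs` or to `R`, which joins `X` once its own successors
are treated; at the root, `Rs` is empty and `X` is closed. -/
lemma Settings.Deriv.exists_expanded {R₁ : Set (Clause S)} {R : Clause S}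
    {Rs D : Set (Clause S)} (h : cfg.Deriv R₁ R Rs D) (hD : D = ∅)
    (hR : ∀ x, R.concl ≠ .attacker (.var x)) :
    ∃ X, cfg.Expanded R₁ X (X ∪ Rs) ∧ (R ∈ X ∨ ∃ R' ∈ Rs, R'.Subsumes R) := by
  induction h with
  | cycle R Rs h => exact ⟨∅, fun R hR => absurd hR (Set.notMem_empty R), Or.inr h⟩
  | done R _ _ _ => exact absurd hD (Set.singleton_ne_empty R)
  | step R Rs _ hsel res hres D _ ih =>
    have hD' : ∀ R₃ ∈ cfg.next R₁ R res, D R₃ = ∅ := by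
      intro R₃ hR₃
      refine Set.eq_empty_of_forall_notMem fun R' hR' => ?_
      have : R' ∈ {R' | ∃ R₃ ∈ cfg.next R₁ R res, R' ∈ D R₃} := ⟨R₃, hR₃, hR'⟩
      rw [hD] at this
      exact this
    have hc : ∀ R₃ ∈ cfg.next R₁ R res, ∀ x, R₃.concl ≠ .attacker (.var x) := by
      rintro R₃ ⟨R', hR', F₀, hF₀, hr, h₃⟩ x
      obtain ⟨σ, hσ⟩ := (hres R' hR' F₀ hF₀ hr).concl_eq
      rw [concl_of_mem_simplify' h₃, hσ]
      exact concl_ne_of_subst hR σ x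
    choose X hX hmem using fun R₃ h => ih R₃ h (hD' R₃ h) (hc R₃ h)
    refine ⟨insert R {R' | ∃ R₃, ∃ h : R₃ ∈ cfg.next R₁ R res, R' ∈ X R₃ h}, ?_,
      Or.inl (Set.mem_insert _ _)⟩
    rintro R' (rfl | ⟨R₃, h₃, hR'⟩)
    · refine ⟨hsel, hR, res, hres, fun R₃ h₃ => ?_⟩
      rcases hmem R₃ h₃ with h | ⟨R₄, h₄ | h₄, hs⟩
      · exact ⟨R₃, Or.inl (Or.inr ⟨R₃, h₃, h⟩), Clause.Subsumes.refl _⟩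
      · exact ⟨R₄, Or.inl (Or.inl h₄), hs⟩
      · exact ⟨R₄, Or.inr h₄, hs⟩
    · obtain ⟨h₁, h₂, res', hres', hn⟩ := hX R₃ h₃ R' hR'
      refine ⟨h₁, h₂, res', hres', fun R₅ h₅ => ?_⟩
      obtain ⟨R₄, h₄ | h₄ | h₄, hs⟩ := hn R₅ h₅
      · exact ⟨R₄, Or.inl (Or.inr ⟨R₃, h₃, h₄⟩), hs⟩
      · exact ⟨R₄, Or.inl (Or.inl h₄), hs⟩
      · exact ⟨R₄, Or.inr h₄, hs⟩

variable {Rs : Set (Clause S)}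

/-- Derivable hypotheses contain no instance of `Fnot`, so the clause is not deleted. The condition
on the conclusion excludes projection clauses, the only ones whose hypotheses `decomphyp` leaves
with a data constructor at the head. -/
lemma exists_mem_simplify' (hfix : cfg.Fixpoint Rs) {k : ℕ}
    (hnot : NoneDerivable cfg.Fnot (cfg.unselected Rs) k) {R : Clause S}
    (hR : ∀ x, R.concl ≠ .attacker (.var x)) {θ : Subst S}
    (hh : ∀ F ∈ R.hyps, DerivableIn (cfg.unselected Rs) k (F.subst θ)) :
    ∃ R₃ ∈ cfg.simplify' R, (∀ F ∈ R₃.hyps, ¬ DataHeaded F) ∧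
      (∀ F ∈ R₃.hyps, DerivableIn (cfg.unselected Rs) k (F.subst θ)) ∧
      ranks (cfg.unselected Rs) (R₃.hyps.map (Fact.subst θ)) ≤
        ranks (cfg.unselected Rs) (R.hyps.map (Fact.subst θ)) := by
  have hd := derivableIn_decompHyps hfix hnot hh
  have hle : (cfg.elimredundanthyp (elimdup (decomphyp R))).hyps ≤ decompHyps R := by
    rw [decomphyp_eq]
    exact (elimredundanthyp_elimdup_le cfg _).2.1
  have hle' := (elimattx_le _).2.trans hle
  refine ⟨_, ⟨_, rfl, ?_, rfl⟩, fun F hF hF' => ?_, fun F hF => ?_, ?_⟩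
  · exact hnot.not_hasNotHyp fun F hF => hd F (Multiset.mem_of_le hle hF)
  · obtain ⟨f, x, i, -, -, rfl⟩ :=
      isDataClause_of_dataHeaded_mem_decompHyps (Multiset.mem_of_le hle' hF) hF'
    exact hR _ rfl
  · exact hd F (Multiset.mem_of_le hle' hF)
  · rw [← ranks_decompHyps _ R]
    exact ranks_mono _ (Multiset.map_le_map hle')

/-- Descent: a derivable instance of a clause of `X` resolves, upon a selected hypothesis, to a
derivable instance of a successor with smaller ranks, and subsumption brings it back into `X`
without raising them. -/
lemma not_derivable_of_expanded (hfix : cfg.Fixpoint Rs) {k : ℕ}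
    (hnot : NoneDerivable cfg.Fnot (cfg.unselected Rs) k) {X : Set (Clause S)}
    (hX : cfg.Expanded (cfg.unselected Rs) X X) (M : Multiset ℕ) :
    ∀ R ∈ X, (∀ F ∈ R.hyps, ¬ DataHeaded F) → ∀ σ : Subst S,
      (∀ F ∈ R.hyps, DerivableIn (cfg.unselected Rs) k (F.subst σ)) →
      ¬ ranks (cfg.unselected Rs) (R.hyps.map (Fact.subst σ)) ≤ M := by
  induction M using (Multiset.wellFounded_isDershowitzMannaLT (α := ℕ)).induction with
  | _ M ih =>
  intro R hR hd σ hh hM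
  obtain ⟨hsel, hc, res, hres, hnext⟩ := hX R hR
  obtain ⟨F₀, hF₀⟩ := Set.nonempty_iff_ne_empty.2 hsel
  have hmem := cfg.sel_subset _ _ hF₀
  obtain ⟨R', hR', hresol, hR''⟩ :=
    exists_resolvable hfix hnot hh hmem (cfg.sel_selectable _ _ hF₀) (hd _ hmem)
  have hr := hres R' hR' F₀ hF₀ hresol
  obtain ⟨θ, -, hh'', A, B, r, hA, hrB, hAB⟩ := hR'' _ hr
  obtain ⟨σ', hσ'⟩ := hr.concl_eq
  obtain ⟨R₃, hR₃, hd₃, hh₃, hle₃⟩ := exists_mem_simplify' hfix hnot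
    (fun x => by rw [hσ']; exact concl_ne_of_subst hc _ _) hh''
  obtain ⟨R₄, hR₄, s, -, hs⟩ := hnext R₃ ⟨R', hR', F₀, hF₀, hresol, hR₃⟩
  have hmem₄ : ∀ F ∈ R₄.hyps, F.subst s ∈ R₃.hyps := fun F hF =>
    Multiset.mem_of_le hs (Multiset.mem_map_of_mem _ hF)
  have hle₄ := ranks_mono (cfg.unselected Rs) (Multiset.map_le_map (f := Fact.subst θ) hs)
  rw [map_subst_subst] at hle₄
  obtain ⟨N, hN, hlt⟩ := isDershowitzMannaLT_of_le hA (hrB ▸ hM)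
    (hAB ▸ hle₄.trans hle₃)
  refine ih N hlt R₄ hR₄ (fun F hF hF' => hd₃ _ (hmem₄ F hF) (hF'.subst s)) (s.comp θ)
    (fun F hF => ?_) hN
  rw [← Fact.subst_subst]
  exact hh₃ _ (hmem₄ F hF)

lemma Settings.Derivable.not_unselectable {F : Fact S} {R₁ : Set (Clause S)}
    (h : cfg.Derivable F R₁ ∅) : ¬ Unselectable F := by
  obtain ⟨F₀, hF₀⟩ := Set.nonempty_iff_ne_empty.2 (h.sel_ne_empty rfl)
  have := cfg.sel_subset _ _ hF₀
  obtain rfl := Multiset.mem_singleton.1 this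
  exact cfg.sel_selectable _ _ hF₀

/-- The root `F ⇒ F` is treated apart for two reasons. Its hypothesis may have a data constructor at
the head, so `not_derivable_of_expanded` does not apply to it; and resolving it once consumes the
last step of the derivation, so `hnot` is needed only at height `k`. -/
lemma Settings.Derivable.not_derivableIn_succ (hfix : cfg.Fixpoint Rs) {k : ℕ}
    (hnot : NoneDerivable cfg.Fnot (cfg.unselected Rs) k) {F : Fact S}
    (h : cfg.Derivable F (cfg.unselected Rs) ∅) (σ : Subst S) :
    ¬ DerivableIn (cfg.unselected Rs) (k + 1) (F.subst σ) := by
  have hF := h.not_unselectable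
  have hFv : ∀ x, F ≠ .attacker (.var x) := fun x hx => hF (Or.inl ⟨x, hx⟩)
  obtain ⟨X, hX, hroot | ⟨R', hR', -⟩⟩ := h.exists_expanded rfl hFv
  swap
  · exact absurd hR' (Set.notMem_empty R')
  rw [Set.union_empty] at hX
  rintro (⟨p, hp⟩ | ⟨R, hR, τ, hτ, hh⟩)
  · exact hF (Unselectable.of_subst (σ := σ) (Or.inr ⟨p, hp⟩))
  obtain ⟨hsel, -, res, hres, hnext⟩ := hX _ hroot
  have hF₀ : F ∈ cfg.sel ⟨{F}, F⟩ := by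
    obtain ⟨F₀, hF₀⟩ := Set.nonempty_iff_ne_empty.2 hsel
    have := cfg.sel_subset _ _ hF₀
    rwa [Multiset.mem_singleton.1 this] at hF₀
  have hresol : Resolvable R F ⟨{F}, F⟩ := ⟨Multiset.mem_singleton_self _, τ, σ, hτ⟩
  have hr := hres R hR F hF₀ hresol
  obtain ⟨θ, H, hH, -, hhyps⟩ := hr.exists_instance hτ
  obtain rfl : H = 0 := by
    have := congrArg Multiset.card hH
    simpa using this
  have hh' : ∀ G ∈ (res R F).hyps, DerivableIn (cfg.unselected Rs) k (G.subst θ) := by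
    intro G hG
    have := Multiset.mem_map_of_mem (Fact.subst θ) hG
    rw [hhyps, Multiset.map_zero, add_zero] at this
    obtain ⟨G', hG', h⟩ := Multiset.mem_map.1 this
    rw [← h]
    exact hh G' hG'
  obtain ⟨σ', hσ'⟩ := hr.concl_eq
  obtain ⟨R₃, hR₃, hd₃, hh₃, -⟩ := exists_mem_simplify' hfix hnot
    (fun x => by rw [hσ']; exact concl_ne_of_subst hFv _ _) hh'
  obtain ⟨R₄, hR₄, s, -, hs⟩ := hnext R₃ ⟨R, hR, F, hF₀, hresol, hR₃⟩
  have hmem₄ : ∀ F ∈ R₄.hyps, F.subst s ∈ R₃.hyps := fun F hF =>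
    Multiset.mem_of_le hs (Multiset.mem_map_of_mem _ hF)
  refine not_derivable_of_expanded hfix hnot hX _ R₄ hR₄
    (fun F hF hF' => hd₃ _ (hmem₄ F hF) (hF'.subst s)) (s.comp θ) (fun F hF => ?_) le_rfl
  rw [← Fact.subst_subst]
  exact hh₃ _ (hmem₄ F hF)

/-- Height zero leaves only m-events, which a search with empty answer cannot have as its goal. -/
lemma noneDerivable_of_derivable (hfix : cfg.Fixpoint Rs)
    (h : ∀ F ∈ cfg.Fnot, cfg.Derivable F (cfg.unselected Rs) ∅) (k : ℕ) :
    NoneDerivable cfg.Fnot (cfg.unselected Rs) k := by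
  induction k with
  | zero =>
    rintro F hF σ ⟨p, hp⟩
    exact (h F hF).not_unselectable (Unselectable.of_subst (σ := σ) (Or.inr ⟨p, hp⟩))
  | succ k ih => exact fun F hF σ => (h F hF).not_derivableIn_succ hfix ih σ

end

end SecProto

namespace SecProto

/-! ## Substitution in terms and processes -/

section

variable {S : Signature}

section

variable {V A V' A' V'' A'' : Type}

lemma Term.subst_subst (M : Term S.toConSig V A) (σ : V → Term S.toConSig V' A') (ν : A → A')
    (σ' : V' → Term S.toConSig V'' A'') (ν' : A' → A'') :
    (M.subst σ ν).subst σ' ν' = M.subst (fun x => (σ x).subst σ' ν') (ν' ∘ ν) := by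
  induction M with
  | app f ts ih => simp only [Term.subst, ih]
  | _ => rfl

lemma Term.subst_id (M : Term S.toConSig V A) : M.subst Term.var id = M := by
  induction M with
  | app f ts ih => simp only [Term.subst, ih]
  | _ => rfl

lemma Term.mem_names_subst {M : Term S.toConSig V A} {σ : V → Term S.toConSig V' A'} {ν : A → A'}
    {a : A'} (h : a ∈ (M.subst σ ν).names) :
    (∃ x ∈ M.vars, a ∈ (σ x).names) ∨ ∃ b ∈ M.names, ν b = a := by
  induction M with
  | var x => exact Or.inl ⟨x, rfl, h⟩
  | name b => exact Or.inr ⟨b, rfl, (Set.mem_singleton_iff.1 h).symm⟩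
  | app f ts ih =>
    obtain ⟨i, hi⟩ := h
    rcases ih i hi with ⟨x, hx, hx'⟩ | ⟨b, hb, hb'⟩
    · exact Or.inl ⟨x, ⟨i, hx⟩, hx'⟩
    · exact Or.inr ⟨b, ⟨i, hb⟩, hb'⟩

lemma Term.names_subset_names_subst {M : Term S.toConSig V A} {σ : V → Term S.toConSig V' A'}
    {ν : A → A'} {x : V} (hx : x ∈ M.vars) : (σ x).names ⊆ (M.subst σ ν).names := by
  induction M with
  | var y => obtain rfl := Set.mem_singleton_iff.1 hx; exact subset_rfl
  | name b => exact absurd hx (Set.notMem_empty x)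
  | app f ts ih =>
    obtain ⟨i, hi⟩ := hx
    exact fun a ha => ⟨i, ih i hi ha⟩

lemma Term.toPat_subst (M : Term S.toConSig V A) (σ : V → Term S.toConSig V' A') (ν : A → A')
    (φ : V' → Pat S) (ψ : A' → Pat S) :
    (M.subst σ ν).toPat φ ψ = M.toPat (fun x => (σ x).toPat φ ψ) (ψ ∘ ν) := by
  induction M with
  | app f ts ih => simp only [Term.subst, Term.toPat, ih]
  | _ => rfl

lemma Term.subst_toPat (M : Term S.toConSig V A) (φ : V → Pat S) (ψ : A → Pat S) (θ : Subst S) :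
    (M.toPat φ ψ).subst θ = M.toPat (fun x => (φ x).subst θ) (fun a => (ψ a).subst θ) := by
  induction M with
  | app f ts ih => simp only [Pat.subst, Term.toPat, ih]
  | _ => rfl

lemma Term.toPat_congr {M : Term S.toConSig V A} {φ φ' : V → Pat S} {ψ ψ' : A → Pat S}
    (h : ∀ x ∈ M.vars, φ x = φ' x) (h' : ∀ a ∈ M.names, ψ a = ψ' a) :
    M.toPat φ ψ = M.toPat φ' ψ' := by
  induction M with
  | var x => exact h x rfl
  | name a => exact h' a rfl
  | app f ts ih =>
    have : ∀ i, (ts i).toPat φ ψ = (ts i).toPat φ' ψ' :=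
      fun i => ih i (fun x hx => h x ⟨i, hx⟩) (fun a ha => h' a ⟨i, ha⟩)
    simp only [Term.toPat, this]

end

lemma onNames_comp_onNames {m m' m'' : ℕ} (ν : Fin m → ℕ ⊕ Fin m') (ν' : Fin m' → ℕ ⊕ Fin m'') :
    onNames ν' ∘ onNames ν = onNames (fun j => onNames ν' (ν j)) := by
  funext a
  cases a <;> rfl

lemma onNames_liftName {m m' : ℕ} (ν : Fin m → ℕ ⊕ Fin m') :
    onNames (liftName ν) ∘ Sum.map id Fin.succ = Sum.map id Fin.succ ∘ onNames ν := by
  funext a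
  cases a <;> rfl

lemma liftVar_subst {n n' n'' m' m'' : ℕ} (σ : Fin n → PTerm S n' m')
    (σ' : Fin n' → PTerm S n'' m'') (ν' : Fin m' → ℕ ⊕ Fin m'') :
    (fun j => (liftVar σ j).subst (liftVar σ') (onNames ν')) =
      liftVar fun j => (σ j).subst σ' (onNames ν') := by
  funext j
  refine Fin.cases ?_ (fun j => ?_) j
  · rfl
  · simp only [liftVar, Fin.cons_succ, Term.subst_subst]
    rfl

lemma liftName_onNames {m m' m'' : ℕ} (ν : Fin m → ℕ ⊕ Fin m') (ν' : Fin m' → ℕ ⊕ Fin m'') :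
    (fun j => onNames (liftName ν') (liftName ν j)) = liftName fun j => onNames ν' (ν j) := by
  funext j
  refine Fin.cases ?_ (fun j => ?_) j
  · rfl
  · simp only [liftName, Fin.cons_succ]
    exact congrFun (onNames_liftName ν') (ν j)

lemma weakenName_subst {n n' n'' m' m'' : ℕ} (σ : Fin n → PTerm S n' m')
    (σ' : Fin n' → PTerm S n'' m'') (ν' : Fin m' → ℕ ⊕ Fin m'') :
    (fun j => (weakenName σ j).subst (weakenName σ') (onNames (liftName ν'))) =
      weakenName fun j => (σ j).subst σ' (onNames ν') := by
  funext j
  simp only [weakenName, Term.subst_subst, onNames_liftName]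
  rfl

lemma Proc.subst_subst {n m n' m' n'' m'' : ℕ} (P : Proc S n m) (σ : Fin n → PTerm S n' m')
    (ν : Fin m → ℕ ⊕ Fin m') (σ' : Fin n' → PTerm S n'' m'') (ν' : Fin m' → ℕ ⊕ Fin m'') :
    (P.subst σ ν).subst σ' ν' =
      P.subst (fun j => (σ j).subst σ' (onNames ν')) (fun j => onNames ν' (ν j)) := by
  induction P generalizing n' m' n'' m'' with
  | nil => rfl
  | _ => simp only [Proc.subst, Term.subst_subst, onNames_comp_onNames, liftVar_subst,
      weakenName_subst, liftName_onNames, *]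

lemma onNames_inr {m : ℕ} : onNames (Sum.inr : Fin m → ℕ ⊕ Fin m) = id := by
  funext a
  cases a <;> rfl

lemma liftVar_var {n m : ℕ} : liftVar (Term.var : Fin n → PTerm S n m) = Term.var := by
  funext j
  refine Fin.cases ?_ (fun j => ?_) j <;> rfl

lemma liftName_inr {m : ℕ} : liftName (Sum.inr : Fin m → ℕ ⊕ Fin m) = Sum.inr := by
  funext j
  refine Fin.cases ?_ (fun j => ?_) j <;> rfl

lemma weakenName_var {n m : ℕ} : weakenName (Term.var : Fin n → PTerm S n m) = Term.var := rfl

lemma Proc.subst_id {n m : ℕ} (P : Proc S n m) : P.subst Term.var Sum.inr = P := by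
  induction P with
  | nil => rfl
  | _ => simp only [Proc.subst, Term.subst_id, onNames_inr, liftVar_var, weakenName_var,
      liftName_inr, *]

lemma Proc.subst_closed (P : Proc S 0 0) (σ : Fin 0 → PTerm S 0 0) (ν : Fin 0 → ℕ ⊕ Fin 0) :
    P.subst σ ν = P := by
  rw [Subsingleton.elim σ Term.var, Subsingleton.elim ν Sum.inr, P.subst_id]

/-- This allows a running process to be recorded as a syntactic subprocess together with an
accumulated closed substitution, extended at each binder. -/
lemma Proc.instVar_subst {n m : ℕ} (P : Proc S (n + 1) m) (σ : Fin n → CTerm S)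
    (ν : Fin m → ℕ ⊕ Fin 0) (N : CTerm S) :
    (P.subst (liftVar σ) ν).instVar N = P.subst (Fin.cons N σ) ν := by
  rw [Proc.instVar, Proc.subst_subst, onNames_inr]
  congr 1
  funext j
  refine Fin.cases ?_ (fun j => ?_) j
  · rfl
  · simp only [liftVar, Fin.cons_succ, Term.subst_subst]
    rw [Subsingleton.elim (fun x : Fin 0 => _) Term.var]
    exact Term.subst_id _

lemma Proc.instName_subst {n m : ℕ} (P : Proc S n (m + 1)) (σ : Fin n → CTerm S)
    (ν : Fin m → ℕ ⊕ Fin 0) (a : ℕ) :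
    (P.subst (weakenName σ) (liftName ν)).instName a = P.subst σ (Fin.cons (Sum.inl a) ν) := by
  have h : onNames (fun _ : Fin 1 => (Sum.inl a : ℕ ⊕ Fin 0)) ∘ Sum.map id Fin.succ = id := by
    funext b
    rcases b with b | b
    · rfl
    · exact b.elim0
  rw [Proc.instName, Proc.subst_subst]
  congr 1
  · funext j
    simp only [weakenName, Term.subst_subst, h]
    exact Term.subst_id _
  · funext j
    refine Fin.cases ?_ (fun j => ?_) j
    · rfl
    · simp only [liftName, Fin.cons_succ]
      exact congrFun h (ν j)

/-! ## Instrumentation -/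

/-- The process underlying an instrumented process. -/
def IProc.erase : {n m k : ℕ} → IProc S n m k → Proc S n m
  | _, _, _, .nil => .nil
  | _, _, _, .out M N P => .out M N P.erase
  | _, _, _, .inp M P => .inp M P.erase
  | _, _, _, .par P Q => .par P.erase Q.erase
  | _, _, _, .repl P => .repl P.erase
  | _, _, _, .res _ P => .res P.erase
  | _, _, _, .letDes g Ms P Q => .letDes g Ms P.erase Q.erase
  | _, _, _, .cond M N P Q => .cond M N P.erase Q.erase
  | _, _, _, .event M P => .event M P.erase

/-- Labels have no operational effect, so traces are those of `P₀` while the clauses come from its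
instrumentation. -/
lemma erase_instrAt {n m : ℕ} (P : Proc S n m) {k : ℕ} (pos : List ℕ) (t : List (Fin n))
    (s : List (Fin k)) : (instrAt P pos t s).erase = P := by
  induction P generalizing k pos with
  | nil => rfl
  | _ => simp only [instrAt, IProc.erase, *]

/-! ## Soundness of the clauses -/

/-- The pattern of a closed term, where `φ` assigns patterns to names. -/
def CTerm.toPat (φ : ℕ → Pat S) (M : CTerm S) : Pat S :=
  Term.toPat Fin.elim0 (Sum.elim φ Fin.elim0) M

lemma CTerm.toPat_congr {φ φ' : ℕ → Pat S} {M : CTerm S}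
    (h : ∀ a, Sum.inl a ∈ M.names → φ a = φ' a) : CTerm.toPat φ M = CTerm.toPat φ' M := by
  refine Term.toPat_congr (fun x => x.elim0) fun a ha => ?_
  rcases a with a | a
  · exact h a ha
  · exact a.elim0

lemma subst_freeName (a : ℕ) (θ : Subst S) : (freeName a : Pat S).subst θ = freeName a := by
  simp only [freeName, Pat.subst]
  congr 1 <;> funext j <;> exact j.elim0

lemma subst_ruleTerm (M : Term S.toConSig ℕ Empty) (θ : Subst S) :
    (ruleTerm M).subst θ = M.toPat θ.pat Empty.elim := by
  rw [ruleTerm, Term.subst_toPat]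
  exact Term.toPat_congr (fun x _ => rfl) (fun a => a.elim)

lemma CTerm.toPat_rule (φ : ℕ → Pat S) (M : Term S.toConSig ℕ Empty) (τ : ℕ → CTerm S)
    (ι : ℕ → Sess) :
    CTerm.toPat φ (M.subst τ Empty.elim) =
      (ruleTerm M).subst ⟨fun x => CTerm.toPat φ (τ x), ι⟩ := by
  rw [subst_ruleTerm, CTerm.toPat, Term.toPat_subst]
  exact Term.toPat_congr (fun x _ => rfl) (fun a => a.elim)

lemma vars_ruleTerm {M : Term S.toConSig ℕ Empty} {v : ℕ ⊕ ℕ} :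
    v ∈ (ruleTerm (S := S) M).vars ↔ ∃ x ∈ M.vars, v = Sum.inl x := by
  induction M with
  | var y =>
    constructor
    · exact fun h => ⟨y, rfl, h⟩
    · rintro ⟨x, hx, rfl⟩
      rw [Set.mem_singleton_iff.1 hx]
      rfl
  | name a => exact a.elim
  | app f ts ih =>
    constructor
    · rintro ⟨i, hi⟩
      obtain ⟨x, hx, rfl⟩ := (ih i).1 hi
      exact ⟨x, ⟨i, hx⟩, rfl⟩
    · rintro ⟨x, ⟨i, hi⟩, rfl⟩
      exact ⟨i, (ih i).2 ⟨x, hi, rfl⟩⟩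

/-- The set of facts `D` is closed under the clauses of `R₀`, and contains all facts
`m-event(p)`. -/
structure ClosedUnder (R₀ : Set (Clause S)) (D : Set (Fact S)) : Prop where
  mevent : ∀ p, Fact.mevent p ∈ D
  clause : ∀ R ∈ R₀, ∀ θ : Subst S, (∀ F ∈ R.hyps, F.subst θ ∈ D) → R.concl.subst θ ∈ D

namespace ClosedUnder

variable {Init : Finset ℕ} {D : Set (Fact S)}

lemma con (h : ClosedUnder (attackerClauses S Init) D) {f : S.Con} (hf : S.conPublic f)
    {ps : Fin (S.arity f) → Pat S} (hps : ∀ j, Fact.attacker (ps j) ∈ D) :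
    Fact.attacker (.app f ps) ∈ D := by
  let θ : Subst S := ⟨fun x => if hx : x < S.arity f then ps ⟨x, hx⟩ else .var 0, Sess.var⟩
  have hθ : ∀ j : Fin (S.arity f), θ.pat j = ps j := fun j => by simp [θ]
  have := h.clause (clauseRf f fun j => j.val)
    (Or.inl (Or.inl (Or.inr ⟨f, hf, rfl⟩))) θ fun F hF => by
      obtain ⟨j, rfl⟩ := clauseRf_hyps.1 hF
      simpa [Fact.subst, Pat.subst, hθ] using hps j
  simpa [clauseRf, Fact.subst, Pat.subst, hθ] using this

lemma des (h : ClosedUnder (attackerClauses S Init) D) {g : S.Des} (hg : S.desPublic g)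
    {r : Rule S.toConSig (S.desArity g)} (hr : r ∈ S.rules g) (θ : Subst S)
    (hps : ∀ j, Fact.attacker ((ruleTerm (r.args j)).subst θ) ∈ D) :
    Fact.attacker ((ruleTerm r.res).subst θ) ∈ D := by
  refine h.clause (clauseRg r) (Or.inl (Or.inr ⟨g, hg, r, hr, rfl⟩)) θ fun F hF => ?_
  simp only [clauseRg, Multiset.mem_map] at hF
  obtain ⟨j, -, rfl⟩ := hF
  exact hps j

lemma free (h : ClosedUnder (attackerClauses S Init) D) {a : ℕ} (ha : a ∈ Init) :
    Fact.attacker (freeName a) ∈ D := by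
  have := h.clause ⟨0, .attacker (freeName a)⟩
    (Or.inl (Or.inl (Or.inl (Or.inl ⟨a, ha, rfl⟩)))) Subst.id (by simp)
  rwa [Fact.subst_id] at this

/-- Supplies a pattern for the names that the adversary creates. -/
lemma exists_b0 (h : ClosedUnder (attackerClauses S Init) D) : ∃ q, Fact.attacker q ∈ D := by
  have := h.clause _ (Or.inl (Or.inl (Or.inl (Or.inr rfl)))) Subst.id (by simp)
  rw [Fact.subst_id] at this
  exact ⟨_, this⟩

lemma listen (h : ClosedUnder (attackerClauses S Init) D) {p q : Pat S}
    (hm : Fact.message p q ∈ D) (hp : Fact.attacker p ∈ D) : Fact.attacker q ∈ D := by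
  refine h.clause ⟨{.message (.var 0) (.var 1), .attacker (.var 0)}, .attacker (.var 1)⟩
    (Or.inr (Or.inl rfl)) ⟨fun x => if x = 0 then p else q, Sess.var⟩ fun F hF => ?_
  simp only [Multiset.insert_eq_cons, Multiset.mem_cons, Multiset.mem_singleton] at hF
  rcases hF with rfl | rfl
  · exact hm
  · exact hp

lemma send (h : ClosedUnder (attackerClauses S Init) D) {p q : Pat S}
    (hp : Fact.attacker p ∈ D) (hq : Fact.attacker q ∈ D) : Fact.message p q ∈ D := by
  refine h.clause ⟨{.attacker (.var 0), .attacker (.var 1)}, .message (.var 0) (.var 1)⟩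
    (Or.inr (Or.inr (Set.mem_singleton _))) ⟨fun x => if x = 0 then p else q, Sess.var⟩ fun F hF => ?_
  simp only [Multiset.insert_eq_cons, Multiset.mem_cons, Multiset.mem_singleton] at hF
  rcases hF with rfl | rfl
  · exact hp
  · exact hq

end ClosedUnder

lemma clauseRf_mem_attackerClauses (Init : Finset ℕ) {f : S.Con} (hf : S.isData f) :
    clauseRf f (fun j => j.val) ∈ attackerClauses S Init :=
  Or.inl (Or.inl (Or.inr ⟨f, S.data_public f hf, rfl⟩))

lemma clauseRg_eq_clauseProj {n : ℕ} (hn : n = 1) (r : Rule S.toConSig n) {f : S.Con}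
    {x : Fin (S.arity f) → ℕ} {i : Fin (S.arity f)}
    (ha : ∀ j, r.args j = Term.app f fun l => Term.var (x l)) (hr : r.res = Term.var (x i)) :
    clauseRg (S := S) r = clauseProj f x i := by
  subst hn
  simp [clauseRg, clauseProj, ha, hr, ruleTerm, Term.toPat]

lemma clauseProj_mem_attackerClauses (Init : Finset ℕ) {f : S.Con} (hf : S.isData f)
    (i : Fin (S.arity f)) :
    ∃ x, Function.Injective x ∧ clauseProj f x i ∈ attackerClauses S Init := by
  obtain ⟨g, hg, hn, r, hr, x, hx, ha, hres⟩ := S.data_proj f hf i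
  refine ⟨x, hx, Or.inl (Or.inr ⟨g, hg, r, by rw [hr]; exact Finset.mem_singleton_self r, ?_⟩)⟩
  exact (clauseRg_eq_clauseProj hn r ha hres).symm

end

/-! ### Processes of the protocol and of the adversary, and their reductions -/

section

variable {S : Signature}

/-- The pattern of a closed name. -/
def namePat (φ : ℕ → Pat S) : ℕ ⊕ Fin 0 → Pat S := Sum.elim φ Fin.elim0

/-- The substitution `σ`, `ν` of closed terms and names corresponds, through the patterns `φ` of
the names in `E`, to the instance by `θ` of the environment `ρ`. -/
structure Env.Matches {n m k : ℕ} (ρ : Env S n m k) (θ : Subst S) (E : Finset ℕ) (φ : ℕ → Pat S)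
    (σ : Fin n → CTerm S) (ν : Fin m → ℕ ⊕ Fin 0) : Prop where
  var : ∀ j, CTerm.toPat φ (σ j) = (ρ.var j).subst θ
  name : ∀ j, namePat φ (ν j) = (ρ.name j).subst θ
  var_mem : ∀ j a, Sum.inl a ∈ (σ j).names → a ∈ E
  name_mem : ∀ j a, ν j = Sum.inl a → a ∈ E

lemma CTerm.toPat_subst {n m : ℕ} (φ : ℕ → Pat S) (σ : Fin n → CTerm S) (ν : Fin m → ℕ ⊕ Fin 0)
    (M : PTerm S n m) : CTerm.toPat φ (M.subst σ (onNames ν)) =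
      M.toPat (fun j => CTerm.toPat φ (σ j)) (Sum.elim φ fun j => namePat φ (ν j)) := by
  rw [CTerm.toPat, Term.toPat_subst]
  refine Term.toPat_congr (fun x _ => rfl) fun a _ => ?_
  cases a <;> rfl

namespace Env.Matches

variable {n m k : ℕ} {ρ : Env S n m k} {θ : Subst S} {E : Finset ℕ} {φ : ℕ → Pat S}
  {σ : Fin n → CTerm S} {ν : Fin m → ℕ ⊕ Fin 0}

lemma term (h : ρ.Matches θ E φ σ ν) {M : PTerm S n m}
    (hM : ∀ a, Sum.inl a ∈ M.names → φ a = freeName a) :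
    CTerm.toPat φ (M.subst σ (onNames ν)) = (ρ.term M).subst θ := by
  rw [CTerm.toPat_subst, Env.term, Term.subst_toPat]
  refine Term.toPat_congr (fun x _ => h.var x) fun a ha => ?_
  rcases a with a | j
  · exact (hM a ha).trans (subst_freeName a θ).symm
  · exact h.name j

lemma congr (h : ρ.Matches θ E φ σ ν) {θ' : Subst S} (hθ : θ.AgreeOn ρ.vars θ') :
    ρ.Matches θ' E φ σ ν where
  var j := (h.var j).trans (Pat.subst_congr _ (hθ.mono fun _ hv => Or.inl ⟨j, hv⟩))
  name j := (h.name j).trans (Pat.subst_congr _ (hθ.mono fun _ hv => Or.inr (Or.inl ⟨j, hv⟩)))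
  var_mem := h.var_mem
  name_mem := h.name_mem

lemma of_comp {θ₁ θ₂ : Subst S} (h : ρ.Matches (θ₁.comp θ₂) E φ σ ν) :
    (ρ.subst θ₁).Matches θ₂ E φ σ ν where
  var j := by rw [h.var j, Env.subst, Pat.subst_subst]
  name j := by rw [h.name j, Env.subst, Pat.subst_subst]
  var_mem := h.var_mem
  name_mem := h.name_mem

lemma pushVar (h : ρ.Matches θ E φ σ ν) {p : Pat S} {N : CTerm S}
    (hp : CTerm.toPat φ N = p.subst θ) (hN : ∀ a, Sum.inl a ∈ N.names → a ∈ E) :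
    (ρ.pushVar p).Matches θ E φ (Fin.cons N σ) ν where
  var := Fin.cases hp h.var
  name := h.name
  var_mem := Fin.cases hN h.var_mem
  name_mem := h.name_mem

lemma pushSes (h : ρ.Matches θ E φ σ ν) (i : Sess) : (ρ.pushSes i).Matches θ E φ σ ν where
  var := h.var
  name := h.name
  var_mem := h.var_mem
  name_mem := h.name_mem

lemma pushName (h : ρ.Matches θ E φ σ ν) {p : Pat S} {a : ℕ} (hp : φ a = p.subst θ)
    (ha : a ∈ E) : (ρ.pushName p).Matches θ E φ σ (Fin.cons (Sum.inl a) ν) where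
  var := h.var
  name := Fin.cases hp h.name
  var_mem := h.var_mem
  name_mem := Fin.cases (fun b hb => by
    obtain rfl : a = b := Sum.inl.inj hb
    exact ha) h.name_mem

/-- Tracking the names of all substituted terms inside `E` pays off here: the pattern of a fresh
name can be chosen freely. -/
lemma extend (h : ρ.Matches θ E φ σ ν) {a : ℕ} (ha : a ∉ E) (q : Pat S) :
    ρ.Matches θ (insert a E) (Function.update φ a q) σ ν where
  var j := by
    rw [← h.var j]
    refine CTerm.toPat_congr fun b hb => Function.update_of_ne ?_ _ _
    rintro rfl
    exact ha (h.var_mem j _ hb)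
  name j := by
    rw [← h.name j]
    cases hν : ν j with
    | inl b =>
      have hb : b ≠ a := by
        rintro rfl
        exact ha (h.name_mem j _ hν)
      exact Function.update_of_ne hb q φ
    | inr b => exact b.elim0
  var_mem j b hb := Finset.mem_insert_of_mem (h.var_mem j b hb)
  name_mem j b hb := Finset.mem_insert_of_mem (h.name_mem j b hb)

lemma names_mem (h : ρ.Matches θ E φ σ ν) {M : PTerm S n m}
    (hM : ∀ a, Sum.inl a ∈ M.names → a ∈ E) {a : ℕ}
    (ha : Sum.inl a ∈ (M.subst σ (onNames ν)).names) : a ∈ E := by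
  rcases Term.mem_names_subst ha with ⟨x, -, hx⟩ | ⟨b, hb, hb'⟩
  · exact h.var_mem x a hx
  · rcases b with b | j
    · obtain rfl : b = a := Sum.inl.inj hb'
      exact hM _ hb
    · exact h.name_mem j a hb'

end Env.Matches

/-- Closed instances of subprocesses of the instrumented process. -/
def Honest (R₀ : Set (Clause S)) (D : Set (Fact S)) (E : Finset ℕ) (φ : ℕ → Pat S)
    (proc : Proc S 0 0) : Prop :=
  ∃ (n m k : ℕ) (P : IProc S n m k) (ρ : Env S n m k) (H : Multiset (Fact S))
    (T : Set (Clause S)) (θ : Subst S) (σ : Fin n → CTerm S) (ν : Fin m → ℕ ⊕ Fin 0),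
    proc = P.erase.subst σ ν ∧ Translates P ρ H T ∧ T ⊆ R₀ ∧ (∀ F ∈ H, F.subst θ ∈ D) ∧
    ρ.Matches θ E φ σ ν ∧ ∀ a ∈ P.erase.fn, a ∈ E ∧ φ a = freeName a

/-- Closed processes run by the adversary. -/
def Hostile (D : Set (Fact S)) (E : Finset ℕ) (φ : ℕ → Pat S) (proc : Proc S 0 0) : Prop :=
  ∃ (n m : ℕ) (Q : Proc S n m) (σ : Fin n → CTerm S) (ν : Fin m → ℕ ⊕ Fin 0),
    proc = Q.subst σ ν ∧ Q.PublicOnly ∧ (∀ a ∈ Q.fn, a ∈ E ∧ Fact.attacker (φ a) ∈ D) ∧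
    (∀ j, (∀ a, Sum.inl a ∈ (σ j).names → a ∈ E) ∧ Fact.attacker (CTerm.toPat φ (σ j)) ∈ D) ∧
    ∀ j a, ν j = Sum.inl a → a ∈ E ∧ Fact.attacker (φ a) ∈ D

variable {R₀ : Set (Clause S)} {D : Set (Fact S)} {E : Finset ℕ} {φ : ℕ → Pat S}

lemma hyps_congr {H : Multiset (Fact S)} {θ θ' : Subst S} (hH : ∀ F ∈ H, F.subst θ ∈ D)
    (h : θ.AgreeOn (hypVars H) θ') : ∀ F ∈ H, F.subst θ' ∈ D := by
  intro F hF
  rw [← F.subst_congr (h.mono fun v hv => ⟨F, hF, hv⟩)]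
  exact hH F hF

lemma hyps_of_comp {H : Multiset (Fact S)} {θ₁ θ₂ : Subst S}
    (hH : ∀ F ∈ H, F.subst (θ₁.comp θ₂) ∈ D) :
    ∀ F ∈ H.map (Fact.subst θ₁), F.subst θ₂ ∈ D := by
  intro F hF
  obtain ⟨G, hG, rfl⟩ := Multiset.mem_map.1 hF
  rw [Fact.subst_subst]
  exact hH G hG

/-- Rules contain no names and create no variables, so a destructor cannot return a name absent from
its arguments. -/
lemma names_result_mem {g : S.Des} {r : Rule S.toConSig (S.desArity g)} {τ : ℕ → CTerm S}
    (h : ∀ i a, Sum.inl a ∈ ((r.args i).subst τ Empty.elim).names → a ∈ E) :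
    ∀ a, Sum.inl a ∈ (r.res.subst τ Empty.elim).names → a ∈ E := by
  intro a ha
  rcases Term.mem_names_subst ha with ⟨x, hx, hxa⟩ | ⟨b, -, -⟩
  · obtain ⟨i, hi⟩ := r.vars_subset x hx
    exact h i a (Term.names_subset_names_subst hi hxa)
  · exact b.elim

namespace Honest

lemma extend {P : Proc S 0 0} (h : Honest R₀ D E φ P) {a : ℕ} (ha : a ∉ E) (q : Pat S) :
    Honest R₀ D (insert a E) (Function.update φ a q) P := by
  obtain ⟨n, m, k, P', ρ, H, T, θ, σ, ν, hP, hT, hTR, hH, hm, hfn⟩ := h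
  refine ⟨n, m, k, P', ρ, H, T, θ, σ, ν, hP, hT, hTR, hH, hm.extend ha q, fun b hb => ?_⟩
  obtain ⟨h₁, h₂⟩ := hfn b hb
  refine ⟨Finset.mem_insert_of_mem h₁, ?_⟩
  rw [Function.update_of_ne, h₂]
  rintro rfl
  exact ha h₁

lemma out (hD : ClosedUnder R₀ D) {M N : CTerm S} {P : Proc S 0 0}
    (h : Honest R₀ D E φ (.out M N P)) :
    Fact.message (CTerm.toPat φ M) (CTerm.toPat φ N) ∈ D ∧
      (∀ a, Sum.inl a ∈ N.names → a ∈ E) ∧ Honest R₀ D E φ P := by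
  obtain ⟨n, m, k, P', ρ, H, T, θ, σ, ν, hP, hT, hTR, hH, hm, hfn⟩ := h
  cases P' <;> simp only [IProc.erase, Proc.subst, Proc.out.injEq, reduceCtorEq] at hP
  obtain ⟨rfl, rfl, rfl⟩ := hP
  cases hT with
  | out _ _ M N P T hT =>
  refine ⟨?_, fun a => hm.names_mem fun b hb => (hfn b (Or.inl (Or.inr hb))).1, ?_⟩
  · rw [hm.term fun b hb => (hfn b (Or.inl (Or.inl hb))).2,
      hm.term fun b hb => (hfn b (Or.inl (Or.inr hb))).2]
    exact hD.clause _ (hTR (Or.inr rfl)) θ hH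
  · exact ⟨n, m, k, _, ρ, H, T, θ, σ, ν, rfl, hT, Set.subset_union_left.trans hTR, hH, hm,
      fun b hb => hfn b (Or.inr hb)⟩

lemma inp {M N : CTerm S} {P : Proc S 1 0} (h : Honest R₀ D E φ (.inp M P))
    (hN : ∀ a, Sum.inl a ∈ N.names → a ∈ E)
    (hMN : Fact.message (CTerm.toPat φ M) (CTerm.toPat φ N) ∈ D) :
    Honest R₀ D E φ (P.instVar N) := by
  obtain ⟨n, m, k, P', ρ, H, T, θ, σ, ν, hP, hT, hTR, hH, hm, hfn⟩ := h
  cases P' <;> simp only [IProc.erase, Proc.subst, Proc.inp.injEq, reduceCtorEq] at hP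
  obtain ⟨rfl, rfl⟩ := hP
  cases hT with
  | inp _ _ M P T x hx hT =>
  -- The clause variable `x` is fresh for `ρ` and `H`, so it may be set to the pattern of the
  -- received message without disturbing the earlier hypotheses.
  let θ' : Subst S := ⟨Function.update θ.pat x (CTerm.toPat φ N), θ.ses⟩
  have hθ : θ.AgreeOn (ρ.vars ∪ hypVars H) θ' := by
    refine ⟨fun y hy => ?_, fun i _ => rfl⟩
    refine (Function.update_of_ne ?_ _ _).symm
    rintro rfl
    exact hx hy
  have hx' : θ'.pat x = CTerm.toPat φ N := Function.update_self _ _ _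
  have hm' := hm.congr (hθ.mono Set.subset_union_left)
  refine ⟨n + 1, m, k, _, _, _, T, θ', Fin.cons N σ, ν, Proc.instVar_subst _ _ _ _, hT, hTR, ?_,
    hm'.pushVar (p := .var x) hx'.symm hN, fun b hb => hfn b (Or.inr hb)⟩
  intro F hF
  rcases Multiset.mem_cons.1 hF with rfl | hF
  · rw [hm'.term fun b hb => (hfn b (Or.inl hb)).2] at hMN
    simpa only [Fact.subst, Pat.subst, hx'] using hMN
  · exact hyps_congr hH (hθ.mono Set.subset_union_right) F hF

lemma par {P Q : Proc S 0 0} (h : Honest R₀ D E φ (.par P Q)) :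
    Honest R₀ D E φ P ∧ Honest R₀ D E φ Q := by
  obtain ⟨n, m, k, P', ρ, H, T, θ, σ, ν, hP, hT, hTR, hH, hm, hfn⟩ := h
  cases P' <;> simp only [IProc.erase, Proc.subst, Proc.par.injEq, reduceCtorEq] at hP
  obtain ⟨rfl, rfl⟩ := hP
  cases hT with
  | par _ _ P Q T U hP hQ =>
  exact ⟨⟨n, m, k, _, ρ, H, T, θ, σ, ν, rfl, hP, Set.subset_union_left.trans hTR, hH, hm,
      fun b hb => hfn b (Or.inl hb)⟩,
    ⟨n, m, k, _, ρ, H, U, θ, σ, ν, rfl, hQ, Set.subset_union_right.trans hTR, hH, hm,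
      fun b hb => hfn b (Or.inr hb)⟩⟩

/-- The value of `θ` at the session variable is left as it is: copies need not be told apart, since
the invariant does not ask distinct names to have distinct patterns. -/
lemma repl {P : Proc S 0 0} (h : Honest R₀ D E φ (.repl P)) : Honest R₀ D E φ P := by
  obtain ⟨n, m, k, P', ρ, H, T, θ, σ, ν, hP, hT, hTR, hH, hm, hfn⟩ := h
  cases P' <;> simp only [IProc.erase, Proc.subst, Proc.repl.injEq, reduceCtorEq] at hP
  subst hP
  cases hT with
  | repl _ _ P T i _ hT =>
  exact ⟨n, m, k + 1, _, _, H, T, θ, σ, ν, rfl, hT, hTR, hH, hm.pushSes _, hfn⟩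

/-- The fresh name takes as pattern the instance of its label under `θ`, which is what the
translation stores in the environment. -/
lemma res {P : Proc S 0 1} (h : Honest R₀ D E φ (.res P)) {a : ℕ} (ha : a ∉ E) :
    ∃ q, Honest R₀ D (insert a E) (Function.update φ a q) (P.instName a) := by
  obtain ⟨n, m, k, P', ρ, H, T, θ, σ, ν, hP, hT, hTR, hH, hm, hfn⟩ := h
  cases P' <;> simp only [IProc.erase, Proc.subst, Proc.res.injEq, reduceCtorEq] at hP
  subst hP
  cases hT with
  | res _ _ l P T hT =>
  refine ⟨(ρ.label _).subst θ, n, m + 1, k, _, _, H, T, θ, σ, _, Proc.instName_subst _ _ _ _, hT,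
    hTR, hH, (hm.extend ha _).pushName (Function.update_self _ _ _)
      (Finset.mem_insert_self _ _), fun b hb => ?_⟩
  obtain ⟨h₁, h₂⟩ := hfn b hb
  refine ⟨Finset.mem_insert_of_mem h₁, ?_⟩
  rw [Function.update_of_ne, h₂]
  rintro rfl
  exact ha h₁

lemma letDes {g : S.Des} {Ms : Fin (S.desArity g) → CTerm S} {P : Proc S 1 0} {Q : Proc S 0 0}
    (h : Honest R₀ D E φ (.letDes g Ms P Q)) :
    (∀ M, Reduces S g Ms M → Honest R₀ D E φ (P.instVar M)) ∧ Honest R₀ D E φ Q := by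
  obtain ⟨n, m, k, P', ρ, H, T, θ, σ, ν, hP, hT, hTR, hH, hm, hfn⟩ := h
  cases P' <;> simp only [IProc.erase, Proc.subst, Proc.letDes.injEq, reduceCtorEq] at hP
  rename_i g' Ms' P₁ Q₁
  obtain ⟨rfl, hP₁, rfl, rfl⟩ := hP
  obtain rfl := eq_of_heq hP₁
  cases hT with
  | letDes _ _ g Ms P Q σ₁ σ₂ T U hσ hP hQ =>
  refine ⟨?_, ⟨n, m, k, _, ρ, H, U, θ, σ, ν, rfl, hQ, Set.subset_union_right.trans hTR, hH, hm,
    fun b hb => hfn b (Or.inr hb)⟩⟩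
  rintro M ⟨r, hr, τ, hMs, rfl⟩
  let τ' : Subst S := ⟨fun x => CTerm.toPat φ (τ x), Sess.var⟩
  have hmatch : MatchesRule ρ Ms' r θ τ' := by
    intro i
    rw [← hm.term fun b hb => (hfn b (Or.inl (Or.inl ⟨i, hb⟩))).2, ← CTerm.toPat_rule, ← hMs i]
  have hex : ∃ τ τ', MatchesRule ρ Ms' r τ τ' := ⟨θ, τ', hmatch⟩
  obtain ⟨-, hmg⟩ := hσ r hr hex
  -- The concrete reduction is one solution of the matching problem; the most general pair used by
  -- the translation factors it through `θ'`.
  obtain ⟨θ', hθ, hτ⟩ := hmg _ _ hmatch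
  refine ⟨n + 1, m, k, _, _, _, T r, θ', _, ν, Proc.instVar_subst _ _ _ _, hP r hr hex,
    fun R hR => hTR (Or.inl ⟨r, hr, hex, hR⟩), hyps_of_comp (hyps_congr hH
      (hθ.mono Set.subset_union_right)), ?_, fun b hb => hfn b (Or.inl (Or.inr hb))⟩
  refine (hm.congr (hθ.mono Set.subset_union_left)).of_comp.pushVar ?_ ?_
  · rw [CTerm.toPat_rule φ _ _ Sess.var, Pat.subst_subst]
    refine Pat.subst_congr _ (hτ.mono fun v hv => ?_)
    obtain ⟨x, hx, rfl⟩ := vars_ruleTerm.1 hv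
    obtain ⟨i, hi⟩ := r.vars_subset x hx
    exact ⟨i, vars_ruleTerm.2 ⟨x, hi, rfl⟩⟩
  · refine names_result_mem fun i a ha => ?_
    rw [← hMs i] at ha
    exact hm.names_mem (fun b hb => (hfn b (Or.inl (Or.inl ⟨i, hb⟩))).1) ha

/-- Equal terms have equal patterns, so the translation of the then branch applies; the else branch
keeps `ρ` and `H`, and requires no disequality. -/
lemma cond {M N : CTerm S} {P Q : Proc S 0 0} (h : Honest R₀ D E φ (.cond M N P Q)) :
    (M = N → Honest R₀ D E φ P) ∧ Honest R₀ D E φ Q := by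
  obtain ⟨n, m, k, P', ρ, H, T, θ, σ, ν, hP, hT, hTR, hH, hm, hfn⟩ := h
  cases P' <;> simp only [IProc.erase, Proc.subst, Proc.cond.injEq, reduceCtorEq] at hP
  rename_i M' N' P₁ Q₁
  obtain ⟨rfl, rfl, rfl, rfl⟩ := hP
  cases hT with
  | cond _ _ M N P Q σ₁ T U hσ hP hQ =>
  refine ⟨fun hMN => ?_, ⟨n, m, k, _, ρ, H, U, θ, σ, ν, rfl, hQ,
    Set.subset_union_right.trans hTR, hH, hm, fun b hb => hfn b (Or.inr hb)⟩⟩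
  have hu : UnifiesTerms ρ M' N' θ := by
    rw [UnifiesTerms, ← hm.term fun b hb => (hfn b (Or.inl (Or.inl (Or.inl hb)))).2,
      ← hm.term fun b hb => (hfn b (Or.inl (Or.inl (Or.inr hb)))).2, hMN]
  have hex : ∃ τ, UnifiesTerms ρ M' N' τ := ⟨θ, hu⟩
  obtain ⟨θ', hθ⟩ := (hσ hex).2 θ hu
  exact ⟨n, m, k, _, _, _, T, θ', σ, ν, rfl, hP hex, fun R hR => hTR (Or.inl ⟨hex, hR⟩),
    hyps_of_comp (hyps_congr hH (hθ.mono Set.subset_union_right)),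
    (hm.congr (hθ.mono Set.subset_union_left)).of_comp, fun b hb => hfn b (Or.inl (Or.inr hb))⟩

lemma event (hD : ClosedUnder R₀ D) {M : CTerm S} {P : Proc S 0 0}
    (h : Honest R₀ D E φ (.event M P)) : Honest R₀ D E φ P := by
  obtain ⟨n, m, k, P', ρ, H, T, θ, σ, ν, hP, hT, hTR, hH, hm, hfn⟩ := h
  cases P' <;> simp only [IProc.erase, Proc.subst, Proc.event.injEq, reduceCtorEq] at hP
  obtain ⟨rfl, rfl⟩ := hP
  cases hT with
  | event _ _ M P T hT =>
  refine ⟨n, m, k, _, ρ, _, T, θ, σ, ν, rfl, hT, Set.subset_union_left.trans hTR,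
    fun F hF => ?_, hm, fun b hb => hfn b (Or.inr hb)⟩
  rcases Multiset.mem_cons.1 hF with rfl | hF
  · exact hD.mevent _
  · exact hH F hF

end Honest

lemma Hostile.names_mem {n m : ℕ} {σ : Fin n → CTerm S} {ν : Fin m → ℕ ⊕ Fin 0}
    (hσ : ∀ j, (∀ a, Sum.inl a ∈ (σ j).names → a ∈ E) ∧
      Fact.attacker (CTerm.toPat φ (σ j)) ∈ D)
    (hν : ∀ j a, ν j = Sum.inl a → a ∈ E ∧ Fact.attacker (φ a) ∈ D) {M : PTerm S n m}
    (hM : ∀ a, Sum.inl a ∈ M.names → a ∈ E) {a : ℕ}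
    (ha : Sum.inl a ∈ (M.subst σ (onNames ν)).names) : a ∈ E := by
  rcases Term.mem_names_subst ha with ⟨x, -, hx⟩ | ⟨b, hb, hb'⟩
  · exact (hσ x).1 a hx
  · rcases b with b | j
    · obtain rfl : b = a := Sum.inl.inj hb'
      exact hM _ hb
    · exact (hν j a hb').1

/-- The adversary uses only public constructors, and each of these has a clause under which `D` is
closed. -/
lemma Hostile.attacker_mem {Init : Finset ℕ} (hD : ClosedUnder (attackerClauses S Init) D)
    {n m : ℕ} {σ : Fin n → CTerm S} {ν : Fin m → ℕ ⊕ Fin 0}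
    (hσ : ∀ j, (∀ a, Sum.inl a ∈ (σ j).names → a ∈ E) ∧
      Fact.attacker (CTerm.toPat φ (σ j)) ∈ D)
    (hν : ∀ j a, ν j = Sum.inl a → a ∈ E ∧ Fact.attacker (φ a) ∈ D) {M : PTerm S n m}
    (hM : M.PublicOnly) (hfn : ∀ a, Sum.inl a ∈ M.names → Fact.attacker (φ a) ∈ D) :
    Fact.attacker (CTerm.toPat φ (M.subst σ (onNames ν))) ∈ D := by
  rw [CTerm.toPat_subst]
  induction M with
  | var j => exact (hσ j).2
  | name a =>
    rcases a with a | j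
    · exact hfn a rfl
    · change Fact.attacker (namePat φ (ν j)) ∈ D
      cases h : ν j with
      | inl a => exact (hν j a h).2
      | inr b => exact b.elim0
  | app f ts ih => exact hD.con hM.1 fun i => ih i (hM.2 i) fun a ha => hfn a ⟨i, ha⟩

namespace Hostile

variable {Init : Finset ℕ}

lemma extend {P : Proc S 0 0} (h : Hostile D E φ P) {a : ℕ} (ha : a ∉ E) (q : Pat S) :
    Hostile D (insert a E) (Function.update φ a q) P := by
  have key : ∀ b, b ∈ E ∧ Fact.attacker (φ b) ∈ D →
      b ∈ insert a E ∧ Fact.attacker (Function.update φ a q b) ∈ D := by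
    rintro b ⟨hb, hb'⟩
    refine ⟨Finset.mem_insert_of_mem hb, ?_⟩
    rw [Function.update_of_ne]
    · exact hb'
    · rintro rfl
      exact ha hb
  obtain ⟨n, m, Q, σ, ν, hP, hQ, hfn, hσ, hν⟩ := h
  refine ⟨n, m, Q, σ, ν, hP, hQ, fun b hb => key b (hfn b hb), fun j => ⟨fun b hb =>
    Finset.mem_insert_of_mem ((hσ j).1 b hb), ?_⟩, fun j b hb => key b (hν j b hb)⟩
  rw [← CTerm.toPat_congr (φ := φ)]
  · exact (hσ j).2
  · intro b hb
    refine (Function.update_of_ne ?_ _ _).symm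
    rintro rfl
    exact ha ((hσ j).1 _ hb)

lemma out (hD : ClosedUnder (attackerClauses S Init) D) {M N : CTerm S} {P : Proc S 0 0}
    (h : Hostile D E φ (.out M N P)) :
    Fact.message (CTerm.toPat φ M) (CTerm.toPat φ N) ∈ D ∧
      (∀ a, Sum.inl a ∈ N.names → a ∈ E) ∧ Hostile D E φ P := by
  obtain ⟨n, m, Q, σ, ν, hP, hQ, hfn, hσ, hν⟩ := h
  cases Q <;> simp only [Proc.subst, Proc.out.injEq, reduceCtorEq] at hP
  obtain ⟨rfl, rfl, rfl⟩ := hP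
  exact ⟨hD.send
      (attacker_mem hD hσ hν hQ.1 fun b hb => (hfn b (Or.inl (Or.inl hb))).2)
      (attacker_mem hD hσ hν hQ.2.1 fun b hb => (hfn b (Or.inl (Or.inr hb))).2),
    fun a => names_mem hσ hν fun b hb => (hfn b (Or.inl (Or.inr hb))).1,
    n, m, _, σ, ν, rfl, hQ.2.2, fun b hb => hfn b (Or.inr hb), hσ, hν⟩

lemma inp (hD : ClosedUnder (attackerClauses S Init) D) {M N : CTerm S} {P : Proc S 1 0}
    (h : Hostile D E φ (.inp M P)) (hN : ∀ a, Sum.inl a ∈ N.names → a ∈ E)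
    (hMN : Fact.message (CTerm.toPat φ M) (CTerm.toPat φ N) ∈ D) :
    Hostile D E φ (P.instVar N) := by
  obtain ⟨n, m, Q, σ, ν, hP, hQ, hfn, hσ, hν⟩ := h
  cases Q <;> simp only [Proc.subst, Proc.inp.injEq, reduceCtorEq] at hP
  obtain ⟨rfl, rfl⟩ := hP
  exact ⟨n + 1, m, _, _, ν, Proc.instVar_subst _ _ _ _, hQ.2, fun b hb => hfn b (Or.inr hb),
    Fin.cases ⟨hN, hD.listen hMN (attacker_mem hD hσ hν hQ.1 fun b hb =>
      (hfn b (Or.inl hb)).2)⟩ hσ, hν⟩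

lemma par {P Q : Proc S 0 0} (h : Hostile D E φ (.par P Q)) :
    Hostile D E φ P ∧ Hostile D E φ Q := by
  obtain ⟨n, m, Q, σ, ν, hP, hQ, hfn, hσ, hν⟩ := h
  cases Q <;> simp only [Proc.subst, Proc.par.injEq, reduceCtorEq] at hP
  obtain ⟨rfl, rfl⟩ := hP
  exact ⟨⟨n, m, _, σ, ν, rfl, hQ.1, fun b hb => hfn b (Or.inl hb), hσ, hν⟩,
    ⟨n, m, _, σ, ν, rfl, hQ.2, fun b hb => hfn b (Or.inr hb), hσ, hν⟩⟩

lemma repl {P : Proc S 0 0} (h : Hostile D E φ (.repl P)) : Hostile D E φ P := by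
  obtain ⟨n, m, Q, σ, ν, hP, hQ, hfn, hσ, hν⟩ := h
  cases Q <;> simp only [Proc.subst, Proc.repl.injEq, reduceCtorEq] at hP
  subst hP
  exact ⟨n, m, _, σ, ν, rfl, hQ, hfn, hσ, hν⟩

/-- All names created by the adversary may share a single known pattern. -/
lemma res (hD : ClosedUnder (attackerClauses S Init) D) {P : Proc S 0 1}
    (h : Hostile D E φ (.res P)) {a : ℕ} (ha : a ∉ E) :
    ∃ q, Hostile D (insert a E) (Function.update φ a q) (P.instName a) := by
  obtain ⟨q, hq⟩ := hD.exists_b0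
  obtain ⟨n, m, Q, σ, ν, hP, hQ, hfn, hσ, hν⟩ := h.extend ha q
  cases Q <;> simp only [Proc.subst, Proc.res.injEq, reduceCtorEq] at hP
  subst hP
  refine ⟨q, n, m + 1, _, σ, _, Proc.instName_subst _ _ _ _, hQ, hfn, hσ,
    Fin.cases (fun b hb => ?_) hν⟩
  obtain rfl : a = b := Sum.inl.inj hb
  refine ⟨Finset.mem_insert_self _ _, ?_⟩
  rwa [Function.update_self]

lemma letDes (hD : ClosedUnder (attackerClauses S Init) D) {g : S.Des}
    {Ms : Fin (S.desArity g) → CTerm S} {P : Proc S 1 0} {Q : Proc S 0 0}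
    (h : Hostile D E φ (.letDes g Ms P Q)) :
    (∀ M, Reduces S g Ms M → Hostile D E φ (P.instVar M)) ∧ Hostile D E φ Q := by
  obtain ⟨n, m, Q', σ, ν, hP, hQ, hfn, hσ, hν⟩ := h
  cases Q' <;> simp only [Proc.subst, Proc.letDes.injEq, reduceCtorEq] at hP
  obtain ⟨rfl, hP₁, rfl, rfl⟩ := hP
  obtain rfl := eq_of_heq hP₁
  refine ⟨?_, n, m, _, σ, ν, rfl, hQ.2.2.2, fun b hb => hfn b (Or.inr hb), hσ, hν⟩
  rintro M ⟨r, hr, τ, hMs, rfl⟩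
  refine ⟨n + 1, m, _, _, ν, Proc.instVar_subst _ _ _ _, hQ.2.2.1,
    fun b hb => hfn b (Or.inl (Or.inr hb)), Fin.cases ⟨?_, ?_⟩ hσ, hν⟩
  · refine names_result_mem fun i a ha => ?_
    rw [← hMs i] at ha
    exact names_mem hσ hν (fun b hb => (hfn b (Or.inl (Or.inl ⟨i, hb⟩))).1) ha
  · rw [Fin.cons_zero, CTerm.toPat_rule φ _ _ Sess.var]
    refine hD.des hQ.1 hr _ fun j => ?_
    rw [← CTerm.toPat_rule, ← hMs j]
    exact attacker_mem hD hσ hν (hQ.2.1 j) fun b hb => (hfn b (Or.inl (Or.inl ⟨j, hb⟩))).2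

lemma cond {M N : CTerm S} {P Q : Proc S 0 0} (h : Hostile D E φ (.cond M N P Q)) :
    Hostile D E φ P ∧ Hostile D E φ Q := by
  obtain ⟨n, m, Q, σ, ν, hP, hQ, hfn, hσ, hν⟩ := h
  cases Q <;> simp only [Proc.subst, Proc.cond.injEq, reduceCtorEq] at hP
  obtain ⟨-, -, rfl, rfl⟩ := hP
  exact ⟨⟨n, m, _, σ, ν, rfl, hQ.2.2.1, fun b hb => hfn b (Or.inl (Or.inr hb)), hσ, hν⟩,
    ⟨n, m, _, σ, ν, rfl, hQ.2.2.2, fun b hb => hfn b (Or.inr hb), hσ, hν⟩⟩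

lemma event {M : CTerm S} {P : Proc S 0 0} (h : Hostile D E φ (.event M P)) :
    Hostile D E φ P := by
  obtain ⟨n, m, Q, σ, ν, hP, hQ, hfn, hσ, hν⟩ := h
  cases Q <;> simp only [Proc.subst, Proc.event.injEq, reduceCtorEq] at hP
  obtain ⟨-, rfl⟩ := hP
  exact ⟨n, m, _, σ, ν, rfl, hQ.2, fun b hb => hfn b (Or.inr hb), hσ, hν⟩

end Hostile

end

/-! ### The invariant along traces -/

section

variable {S : Signature} {R₀ : Set (Clause S)} {D : Set (Fact S)} {Init E₀ : Finset ℕ}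

/-- The invariant of the traces of an instrumented process with an adversary: all processes are
honest or hostile, and the names of `E₀` have the patterns of free names. -/
structure Config.Typed (R₀ : Set (Clause S)) (D : Set (Fact S)) (E₀ : Finset ℕ) (φ : ℕ → Pat S)
    (c : Config S) : Prop where
  free : ∀ a ∈ E₀, a ∈ c.env ∧ φ a = freeName a
  procs : ∀ P ∈ c.procs, Honest R₀ D c.env φ P ∨ Hostile D c.env φ P

namespace Config.Typed

variable {φ : ℕ → Pat S}

lemma replace {E : Finset ℕ} {P Q : Proc S 0 0} {Ps : Multiset (Proc S 0 0)}
    (h : Typed R₀ D E₀ φ ⟨E, P ::ₘ Ps⟩) (hQ : Honest R₀ D E φ P → Honest R₀ D E φ Q)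
    (hQ' : Hostile D E φ P → Hostile D E φ Q) : Typed R₀ D E₀ φ ⟨E, Q ::ₘ Ps⟩ := by
  refine ⟨h.free, fun P' hP' => ?_⟩
  rcases Multiset.mem_cons.1 hP' with rfl | hP'
  · exact (h.procs P (Multiset.mem_cons_self _ _)).imp hQ hQ'
  · exact h.procs P' (Multiset.mem_cons_of_mem hP')

lemma addProc {E : Finset ℕ} {P Q : Proc S 0 0} {Ps : Multiset (Proc S 0 0)}
    (h : Typed R₀ D E₀ φ ⟨E, P ::ₘ Ps⟩) (hQ : Honest R₀ D E φ P → Honest R₀ D E φ Q)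
    (hQ' : Hostile D E φ P → Hostile D E φ Q) : Typed R₀ D E₀ φ ⟨E, P ::ₘ Q ::ₘ Ps⟩ := by
  refine ⟨h.free, fun P' hP' => ?_⟩
  rw [Multiset.cons_swap, Multiset.mem_cons] at hP'
  rcases hP' with rfl | hP'
  · exact (h.procs P (Multiset.mem_cons_self _ _)).imp hQ hQ'
  · exact h.procs P' hP'

lemma message_of_commStep (hD : ClosedUnder R₀ D) (hA : attackerClauses S Init ⊆ R₀)
    {c c' : Config S} (h : c.Typed R₀ D E₀ φ) {M N : CTerm S} (hc : CommStep M N c c') :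
    Fact.message (CTerm.toPat φ M) (CTerm.toPat φ N) ∈ D := by
  have hDA : ClosedUnder (attackerClauses S Init) D :=
    ⟨hD.mevent, fun R hR => hD.clause R (hA hR)⟩
  obtain ⟨E, Ps, Q, P, rfl, rfl⟩ := hc
  rcases h.procs _ (Multiset.mem_cons_self _ _) with h | h
  · exact (h.out hD).1
  · exact (h.out hDA).1

lemma commStep (hD : ClosedUnder R₀ D) (hA : attackerClauses S Init ⊆ R₀)
    {c c' : Config S} (h : c.Typed R₀ D E₀ φ) {M N : CTerm S} (hc : CommStep M N c c') :
    c'.Typed R₀ D E₀ φ := by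
  have hDA : ClosedUnder (attackerClauses S Init) D :=
    ⟨hD.mevent, fun R hR => hD.clause R (hA hR)⟩
  have hMN := h.message_of_commStep hD hA hc
  obtain ⟨E, Ps, Q, P, rfl, rfl⟩ := hc
  have hQ : (∀ a, Sum.inl a ∈ N.names → a ∈ E) ∧ (Honest R₀ D E φ Q ∨ Hostile D E φ Q) := by
    rcases h.procs _ (Multiset.mem_cons_self _ _) with h | h
    · exact ⟨(h.out hD).2.1, Or.inl (h.out hD).2.2⟩
    · exact ⟨(h.out hDA).2.1, Or.inr (h.out hDA).2.2⟩
  refine ⟨h.free, fun P' hP' => ?_⟩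
  rcases Multiset.mem_cons.1 hP' with rfl | hP'
  · exact hQ.2
  rcases Multiset.mem_cons.1 hP' with rfl | hP'
  · rcases h.procs _ (Multiset.mem_cons_of_mem (Multiset.mem_cons_self _ _)) with h | h
    · exact Or.inl (h.inp hQ.1 hMN)
    · exact Or.inr (h.inp hDA hQ.1 hMN)
  · exact h.procs _ (Multiset.mem_cons_of_mem (Multiset.mem_cons_of_mem hP'))

lemma red (hD : ClosedUnder R₀ D) (hA : attackerClauses S Init ⊆ R₀) {c c' : Config S}
    (h : c.Typed R₀ D E₀ φ) (hc : Red c c') : ∃ φ', c'.Typed R₀ D E₀ φ' := by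
  have hDA : ClosedUnder (attackerClauses S Init) D :=
    ⟨hD.mevent, fun R hR => hD.clause R (hA hR)⟩
  cases hc with
  | nil E Ps => exact ⟨φ, h.free, fun P hP => h.procs P (Multiset.mem_cons_of_mem hP)⟩
  | repl E Ps P =>
    rw [Multiset.cons_swap]
    exact ⟨φ, h.addProc Honest.repl Hostile.repl⟩
  | par E Ps P P' =>
    rw [Multiset.cons_swap]
    have h' := h.addProc (Q := P) (fun h => h.par.1) fun h => h.par.1
    exact ⟨φ, h'.replace (fun h => h.par.2) fun h => h.par.2⟩
  | res E Ps P a ha =>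
    have : ∃ q, Honest R₀ D (insert a E) (Function.update φ a q) (P.instName a) ∨
        Hostile D (insert a E) (Function.update φ a q) (P.instName a) := by
      rcases h.procs _ (Multiset.mem_cons_self _ _) with h | h
      · exact (h.res ha).imp fun q => Or.inl
      · exact (h.res hDA ha).imp fun q => Or.inr
    obtain ⟨q, hq⟩ := this
    refine ⟨Function.update φ a q, fun b hb => ?_, fun P' hP' => ?_⟩
    · obtain ⟨h₁, h₂⟩ := h.free b hb
      refine ⟨Finset.mem_insert_of_mem h₁, ?_⟩
      rw [Function.update_of_ne, h₂]
      rintro rfl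
      exact ha h₁
    · rcases Multiset.mem_cons.1 hP' with rfl | hP'
      · exact hq
      · exact (h.procs _ (Multiset.mem_cons_of_mem hP')).imp (fun h => h.extend ha q)
          fun h => h.extend ha q
  | comm _ _ ch M hc => exact ⟨φ, h.commStep hD hA hc⟩
  | des1 E Ps g Ms P Q M hM =>
    exact ⟨φ, h.replace (fun h => h.letDes.1 M hM) fun h => (h.letDes hDA).1 M hM⟩
  | des2 E Ps g Ms P Q _ => exact ⟨φ, h.replace (fun h => h.letDes.2) fun h => (h.letDes hDA).2⟩
  | cond1 E Ps M P Q => exact ⟨φ, h.replace (fun h => h.cond.1 rfl) fun h => h.cond.1⟩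
  | cond2 E Ps M N P Q _ => exact ⟨φ, h.replace (fun h => h.cond.2) fun h => h.cond.2⟩
  | event _ _ M hc =>
    obtain ⟨E, Ps, P, rfl, rfl⟩ := hc
    exact ⟨φ, h.replace (fun h => h.event hD) fun h => h.event⟩

end Config.Typed

lemma IsTrace.forall_mem {c₀ : Config S} {T : List (Config S)} (h : IsTrace c₀ T)
    {p : Config S → Prop} (h₀ : p c₀) (hp : ∀ c c', p c → Red c c' → p c') : ∀ c ∈ T, p c := by
  obtain ⟨hhead, hchain⟩ := h
  induction T generalizing c₀ with
  | nil => simp at hhead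
  | cons c T ih =>
    obtain rfl : c = c₀ := by simpa using hhead
    intro c' hc'
    rcases List.mem_cons.1 hc' with rfl | hc'
    · exact h₀
    · cases T with
      | nil => simp at hc'
      | cons d T =>
        rw [List.isChain_cons_cons] at hchain
        exact ih (hp _ _ h₀ hchain.1) rfl hchain.2 c' hc'

lemma typed_initial {P₀ Q : Proc S 0 0} (hD : ClosedUnder (attackerClauses S Init) D)
    {T : Set (Clause S)} (hT : Translates (instr P₀) Env.empty 0 T) (hTR : T ⊆ R₀)
    (hQ : IsAdversary Init Q) (hP₀ : P₀.fn ⊆ E₀) (hInit : Init ⊆ E₀) :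
    Config.Typed R₀ D E₀ freeName ⟨E₀, {P₀, Q}⟩ := by
  refine ⟨fun a ha => ⟨ha, rfl⟩, fun P hP => ?_⟩
  simp only [Multiset.insert_eq_cons, Multiset.mem_cons, Multiset.mem_singleton] at hP
  rcases hP with rfl | rfl
  · have he : (instr P).erase = P := erase_instrAt P [] [] []
    refine Or.inl ⟨0, 0, 0, instr P, Env.empty, 0, T, Subst.id, Fin.elim0, Fin.elim0, ?_, hT, hTR,
      by simp, ⟨fun j => j.elim0, fun j => j.elim0, fun j => j.elim0, fun j => j.elim0⟩,
      fun a ha => ?_⟩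
    · rw [Proc.subst_closed, he]
    · rw [he] at ha
      exact ⟨hP₀ ha, rfl⟩
  · exact Or.inr ⟨0, 0, P, Fin.elim0, Fin.elim0, (Proc.subst_closed _ _ _).symm, hQ.publicOnly,
      fun a ha => ⟨hInit (hQ.fn_subset ha), hD.free (hQ.fn_subset ha)⟩,
      fun j => j.elim0, fun j => j.elim0⟩

/-- Soundness of the clauses: if the attacker obtains an instance of `N` then an instance of the
corresponding pattern belongs to every closed set of facts. -/
theorem exists_attacker_mem {P₀ Q : Proc S 0 0} (hD : ClosedUnder R₀ D)
    (hR₀ : IsClauseSet (instr P₀) Init R₀) (hQ : IsAdversary Init Q) (hP₀ : P₀.fn ⊆ E₀)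
    (hInit : Init ⊆ E₀) {N : QTerm S} (hN : N.names ⊆ E₀) {σ : ℕ → CTerm S}
    {T : List (Config S)} (hT : IsTrace ⟨E₀, {P₀, Q}⟩ T)
    (hs : Satisfies Init T (.attacker (N.inst σ))) :
    ∃ θ : Subst S, Fact.attacker (N.encode.subst θ) ∈ D := by
  obtain ⟨U, hU, rfl⟩ := hR₀
  have hDA : ClosedUnder (attackerClauses S Init) D :=
    ⟨hD.mevent, fun R hR => hD.clause R (Or.inr hR)⟩
  obtain ⟨c, c', hcc', a, ha, hc⟩ := hs
  have hmem : c ∈ T := hcc'.subset (by simp)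
  obtain ⟨φ, hφ⟩ := hT.forall_mem (p := fun c => ∃ φ, c.Typed (U ∪ attackerClauses S Init) D E₀ φ)
    ⟨_, typed_initial hDA hU Set.subset_union_left hQ hP₀ hInit⟩
    (fun c c' ⟨φ, h⟩ hr => h.red hD Set.subset_union_right hr) c hmem
  have hm := hφ.message_of_commStep hD Set.subset_union_right hc
  have ha' : φ a = freeName a := (hφ.free a (hInit ha)).2
  have hatt := hDA.listen hm (by
    change Fact.attacker (φ a) ∈ D
    rw [ha']
    exact hDA.free ha)
  -- The instance sends each variable of `N` to the pattern of its value at the moment of the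
  -- communication; the names of `N` lie in `E₀` and still have the pattern `a[]`.
  refine ⟨⟨fun x => CTerm.toPat φ (σ x), Sess.var⟩, ?_⟩
  convert hatt using 2
  rw [QTerm.encode, Term.subst_toPat, QTerm.inst, CTerm.toPat, Term.toPat_subst]
  refine Term.toPat_congr (fun x _ => rfl) fun b hb => ?_
  exact (subst_freeName b _).trans (hφ.free b (hN hb)).2.symm

/-- The facts derivable from the saturated clauses are closed under the initial clauses. -/
lemma closedUnder_of_fixpoint {cfg : Settings S} {Rs : Set (Clause S)} (hfix : cfg.Fixpoint Rs)
    (hnot : ∀ k, NoneDerivable cfg.Fnot (cfg.unselected Rs) k)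
    (hcov : ∀ R ∈ R₀, Covered cfg Rs R) :
    ClosedUnder R₀ {F | ∃ k, DerivableIn (cfg.unselected Rs) k F} where
  mevent p := ⟨0, .mevent 0 p⟩
  clause R hR θ hh := (hcov R hR).derivable_of_fixpoint hfix hnot θ hh

end

end SecProto

/-! ### The secrecy theorem -/

theorem mainTheorem9 (S : SecProto.Signature) (cfg : SecProto.Settings S) (Init : Finset ℕ)
    (P₀ : SecProto.Proc S 0 0) (P₀' : SecProto.IProc S 0 0 0) (hP₀' : P₀' = SecProto.instr P₀)
    (N : SecProto.QTerm S) (p : SecProto.Pat S) (hp : p = N.encode)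
    (hsolve : cfg.Solve P₀' Init (SecProto.Fact.attacker p) ∅) :
    SecProto.PreservesSecrecy Init P₀ N := by
  subst hP₀' hp
  intro Q hQ E₀ hP₀ hInit hN _ σ T hT hs
  obtain ⟨R₀, R₁, hR₀, hsat, hnot, hder⟩ := hsolve
  have hA : SecProto.attackerClauses S Init ⊆ R₀ := by
    obtain ⟨U, -, rfl⟩ := hR₀
    exact Set.subset_union_right
  obtain ⟨Rs, hfix, rfl, hcov⟩ := hsat.exists_fixpoint
    (fun f hf => ⟨fun j => j.val, Fin.val_injective,
      hA (SecProto.clauseRf_mem_attackerClauses Init hf)⟩)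
    (fun f hf i => (SecProto.clauseProj_mem_attackerClauses Init hf i).imp
      fun x hx => ⟨hx.1, hA hx.2⟩)
  have hnone := SecProto.noneDerivable_of_derivable hfix hnot
  obtain ⟨θ, k, hk⟩ := SecProto.exists_attacker_mem
    (SecProto.closedUnder_of_fixpoint hfix hnone hcov) hR₀ hQ hP₀ hInit hN hT hs
  -- Heights are upper bounds, so a derivation of height at most `k` also counts at `k + 1`, the
  -- form in which the search excludes it.
  exact absurd hk.succ (hder.not_derivableIn_succ hfix (hnone k) θ)
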